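/- Let $(M^n,g)$ be a complete (connected, smooth) Riemannian manifold, let $d\mu=e^f\,d\mathrm{vol}_g$ with $f\in C^\infty(M)$, and write $C^\infty_c(M)$ for the smooth compactly supported functions. Assume that $(M,g,\mu)$ is non-parabolic, i.e. there is no sequence $\chi_\ell\in C^\infty_c(M)$ with $0\le\chi_\ell\le1$, $\chi_\ell\to1$ uniformly on compact sets and $\int_M|d\chi_\ell|_g^2\,d\mu\to0$. Let $\dot W(M)$ be the completion of $C^\infty_c(M)$ for the norm $\varphi\mapsto\|d\varphi\|_{L^2_\mu}$, regarded as a subspace of $W^{1,2}_{loc}(M)$ by the natural injection: $u\in\dot W(M)$ with $du=\theta\in L^2_\mu(T^*M)$ if and only if there are $\varphi_k\in C^\infty_c(M)$ with $\varphi_k\to u$ in $L^2_{loc}$ and $d\varphi_k\to\theta$ in $L^2_\mu$. Let $\Delta$ be the nonnegative self-adjoint Laplacian, defined by $\int_M\langle d\varphi,d\phi\rangle\,d\mu=\int_M\varphi\,\Delta\phi\,d\mu$ for $\varphi,\phi\in C^\infty_c(M)$; let $P(t,x,y)$ be its heat kernel, i.e. the positive smooth function with $(e^{-t\Delta}f)(x)=\int_M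 P(t,x,y)f(y)\,d\mu(y)$ for all $f\in L^2_\mu$ with compact support; and let $G_o(x)=G(o,x)=\int_0^\infty P(t,o,x)\,dt\in(0,\infty]$ be the Green function with pole $o$. For a bounded open set $\mathcal U\subset M$ let $\mathcal A_{\mathcal U}=\{\varphi\in C^\infty_c(M):\varphi=1\text{ on }\mathcal U\}$ and $\mathrm{cap}(\mathcal U)=\inf_{\varphi\in\mathcal A_{\mathcal U}}\int_M|d\varphi|^2\,d\mu$. The equilibrium potential $h$ of $\mathcal U$ is the element of the closure of $\mathcal A_{\mathcal U}$ in $\dot W(M)$ with $\int_M|dh|^2\,d\mu=\mathrm{cap}(\mathcal U)$ (so $h=1$ a.e. on $\mathcal U$). Then for every $\tau>1/2$: (a) for every $o\in M$, $\min(G_o^\tau,1)\in\dot W(M)$; (b) for every bounded open set $\mathcal U\subset M$ with equilibrium potential $h$, $h^\tau\in\dot W(M)$ and $$\int_M|dh^\tau|^2\,d\mu\le\frac{\tau^2}{2\tau-1}\,\mathrm{cap}(\mathcal U).$$ -/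

import Mathlib

open Set Filter Topology MeasureTheory Bundle
open scoped Manifold ContDiff ENNReal

noncomputable section

namespace WeightedManifold

section Measure

variable {n : ℕ} {M : Type*} [MetricSpace M] [ChartedSpace (EuclideanSpace ℝ (Fin n)) M]
  [RiemannianBundle (fun x : M => TangentSpace (𝓡 n) x)]

/-- The Gram matrix `g_{ij}` of the metric in the chart `e`, at the point `z` of its target: the
`i`-th coordinate vector field is the image under the differential of `e⁻¹` of the `i`-th vector
of the standard basis. -/
def gramMatrix (e : OpenPartialHomeomorph M (EuclideanSpace ℝ (Fin n)))
    (z : EuclideanSpace ℝ (Fin n)) : Matrix (Fin n) (Fin n) ℝ :=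
  Matrix.of fun i j =>
    inner ℝ
      (mfderiv (𝓡 n) (𝓡 n) e.symm z (EuclideanSpace.single i (1 : ℝ)) :
        TangentSpace (𝓡 n) (e.symm z))
      (mfderiv (𝓡 n) (𝓡 n) e.symm z (EuclideanSpace.single j (1 : ℝ)) :
        TangentSpace (𝓡 n) (e.symm z))

variable [MeasurableSpace M]

/-- `vol` is the Riemannian volume measure: in every smooth chart it is `√(det g_{ij}) dz`.
On a second countable manifold exactly one Borel measure has this property. -/
def IsRiemannianVolume (vol : Measure M) : Prop :=
  ∀ e ∈ IsManifold.maximalAtlas (𝓡 n) ∞ M, ∀ A : Set M, MeasurableSet A → A ⊆ e.source →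
    vol A = ∫⁻ z in e '' A, ENNReal.ofReal (Real.sqrt (gramMatrix e z).det)

/-- `dμ = e^f dvol_g` for some smooth function `f`. -/
def IsWeightedVolume (n : ℕ) {M : Type*} [MetricSpace M]
    [ChartedSpace (EuclideanSpace ℝ (Fin n)) M]
    [RiemannianBundle (fun x : M => TangentSpace (𝓡 n) x)] [MeasurableSpace M]
    (μ : Measure M) : Prop :=
  ∃ (vol : Measure M) (f : M → ℝ), IsRiemannianVolume (n := n) vol ∧
    ContMDiff (𝓡 n) 𝓘(ℝ, ℝ) ∞ f ∧
    μ = vol.withDensity (fun x => ENNReal.ofReal (Real.exp (f x)))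

end Measure

section Forms

/-- Not necessarily continuous `1`-forms, that is, sections of the cotangent bundle. -/
abbrev CovectorField (n : ℕ) (M : Type*) [MetricSpace M]
    [ChartedSpace (EuclideanSpace ℝ (Fin n)) M] : Type _ :=
  (x : M) → (TangentSpace (𝓡 n) x →L[ℝ] ℝ)

variable {n : ℕ} {M : Type*} [MetricSpace M] [ChartedSpace (EuclideanSpace ℝ (Fin n)) M]

/-- The exterior derivative `dφ` of a differentiable function. -/
def differential (n : ℕ) {M : Type*} [MetricSpace M]
    [ChartedSpace (EuclideanSpace ℝ (Fin n)) M] (φ : M → ℝ) : CovectorField n M :=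
  fun x => mfderiv (𝓡 n) 𝓘(ℝ, ℝ) φ x

/-- The space `C^∞_c(M)`. -/
def testFunctions (n : ℕ) (M : Type*) [MetricSpace M]
    [ChartedSpace (EuclideanSpace ℝ (Fin n)) M] : Set (M → ℝ) :=
  {φ | ContMDiff (𝓡 n) 𝓘(ℝ, ℝ) ∞ φ ∧ HasCompactSupport φ}

variable [IsManifold (𝓡 n) ∞ M] [MeasurableSpace M]

/-- A `1`-form is measurable (up to a null set) if its values on smooth vector fields are. -/
def IsMeasurableForm (μ : Measure M) (θ : CovectorField n M) : Prop :=
  ∀ X : (x : M) → TangentSpace (𝓡 n) x,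
    ContMDiff (𝓡 n) (𝓡 n).tangent ∞ (fun x => (⟨x, X x⟩ : TangentBundle (𝓡 n) M)) →
    AEMeasurable (fun x => θ x (X x)) μ

variable [RiemannianBundle (fun x : M => TangentSpace (𝓡 n) x)]

/-- The scalar product on `T*_x M` induced, by polarization, by the norm
`|β| = sup {β ξ : g_x(ξ,ξ) = 1}`. -/
def covectorInner {x : M} (α β : TangentSpace (𝓡 n) x →L[ℝ] ℝ) : ℝ :=
  (‖α + β‖ ^ 2 - ‖α - β‖ ^ 2) / 4

/-- `∫_M |θ|² dμ ∈ [0,∞]`. -/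
def formEnergy (μ : Measure M) (θ : CovectorField n M) : ℝ≥0∞ :=
  ∫⁻ x, ‖θ x‖ₑ ^ 2 ∂μ

/-- There is a sequence `χ_ℓ ∈ C^∞_c(M)` with `0 ≤ χ_ℓ ≤ 1`, tending to `1` uniformly on compact
sets, with `∫ |dχ_ℓ|² dμ → 0`. -/
def IsParabolic (n : ℕ) {M : Type*} [MetricSpace M]
    [ChartedSpace (EuclideanSpace ℝ (Fin n)) M] [IsManifold (𝓡 n) ∞ M]
    [MeasurableSpace M] [RiemannianBundle (fun x : M => TangentSpace (𝓡 n) x)] (μ : Measure M) : Prop :=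
  ∃ χ : ℕ → M → ℝ, (∀ l, χ l ∈ testFunctions n M) ∧ (∀ l x, 0 ≤ χ l x ∧ χ l x ≤ 1) ∧
    (∀ K : Set M, IsCompact K → TendstoUniformlyOn χ (fun _ => 1) atTop K) ∧
    Tendsto (fun l => formEnergy μ (differential n (χ l))) atTop (𝓝 0)

/-- For a set `𝒜` of test functions: `u` is in the closure of `𝒜` in the homogeneous Sobolev
space, and its differential is the square integrable `1`-form `θ`. That is, some sequence in `𝒜`
converges to `u` in `L²_loc`, with differentials converging to `θ` in `L²`. -/
def MemHomClosure (μ : Measure M) (𝒜 : Set (M → ℝ)) (u : M → ℝ) (θ : CovectorField n M) : Prop :=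
  AEMeasurable u μ ∧ IsMeasurableForm μ θ ∧
  ∃ φ : ℕ → M → ℝ, (∀ k, φ k ∈ 𝒜) ∧
    Tendsto (fun k => formEnergy μ (differential n (φ k) - θ)) atTop (𝓝 0) ∧
    ∀ K : Set M, IsCompact K →
      Tendsto (fun k => ∫⁻ x in K, ‖φ k x - u x‖ₑ ^ 2 ∂μ) atTop (𝓝 0)

/-- `u` is in the homogeneous Sobolev space `Ẇ(M)` and `du = θ`. Here `Ẇ(M)`, the completion of
`C^∞_c(M)` for the norm `φ ↦ ‖dφ‖_{L²}`, is seen inside `W^{1,2}_loc(M)` through the natural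
injection, which on a non-parabolic manifold extends the inclusion of `C^∞_c(M)`. -/
def HasHomDifferential (μ : Measure M) (u : M → ℝ) (θ : CovectorField n M) : Prop :=
  MemHomClosure μ (testFunctions n M) u θ

/-- `u ∈ Ẇ(M)`. -/
def MemHomSobolev (n : ℕ) {M : Type*} [MetricSpace M]
    [ChartedSpace (EuclideanSpace ℝ (Fin n)) M] [IsManifold (𝓡 n) ∞ M]
    [MeasurableSpace M] [RiemannianBundle (fun x : M => TangentSpace (𝓡 n) x)] (μ : Measure M) (u : M → ℝ) : Prop :=
  ∃ θ : CovectorField n M, HasHomDifferential μ u θ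

/-- The functions `φ ∈ C^∞_c(M)` with `φ = 1` on `U`. -/
def admissible (n : ℕ) {M : Type*} [MetricSpace M]
    [ChartedSpace (EuclideanSpace ℝ (Fin n)) M] (U : Set M) : Set (M → ℝ) :=
  {φ | φ ∈ testFunctions n M ∧ ∀ x ∈ U, φ x = 1}

/-- `cap(U) = inf {∫ |dφ|² dμ : φ ∈ C^∞_c(M), φ = 1 on U}`. -/
def capacity (n : ℕ) {M : Type*} [MetricSpace M]
    [ChartedSpace (EuclideanSpace ℝ (Fin n)) M] [IsManifold (𝓡 n) ∞ M]
    [MeasurableSpace M] [RiemannianBundle (fun x : M => TangentSpace (𝓡 n) x)] (μ : Measure M) (U : Set M) : ℝ≥0∞ :=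
  ⨅ φ ∈ admissible n U, formEnergy μ (differential n φ)

/-- `h` is the equilibrium potential of `U`: the function in `Ẇ(M)` with `∫ |dh|² dμ = cap(U)` that
satisfies `h = 1` on `U`, in the sense that it belongs to the closure in `Ẇ(M)` of the functions
`φ ∈ C^∞_c(M)` with `φ = 1` on `U`. (In particular `h = 1` almost everywhere on `U`. For open sets
with irregular boundary this last property alone would not determine `h`.) -/
def IsEquilibriumPotential (n : ℕ) {M : Type*} [MetricSpace M]
    [ChartedSpace (EuclideanSpace ℝ (Fin n)) M] [IsManifold (𝓡 n) ∞ M]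
    [MeasurableSpace M] [RiemannianBundle (fun x : M => TangentSpace (𝓡 n) x)]
    (μ : Measure M) (U : Set M) (h : M → ℝ) : Prop :=
  ∃ θ : CovectorField n M, MemHomClosure μ (admissible n U) h θ ∧ formEnergy μ θ = capacity n μ U

end Forms

section Heat

variable {n : ℕ} {M : Type*} [MetricSpace M] [ChartedSpace (EuclideanSpace ℝ (Fin n)) M]
  [IsManifold (𝓡 n) ∞ M] [MeasurableSpace M] [RiemannianBundle (fun x : M => TangentSpace (𝓡 n) x)]

/-- `u` is in the closure `W^{1,2}_0(M)` of `C^∞_c(M)` for the norm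
`(‖φ‖²_{L²} + ‖dφ‖²_{L²})^{1/2}`, and `du = θ`. -/
def HasSobolevDifferential (μ : Measure M) (u : M → ℝ) (θ : CovectorField n M) : Prop :=
  AEMeasurable u μ ∧ IsMeasurableForm μ θ ∧
  ∃ φ : ℕ → M → ℝ, (∀ k, φ k ∈ testFunctions n M) ∧
    Tendsto (fun k => formEnergy μ (differential n (φ k) - θ)) atTop (𝓝 0) ∧
    Tendsto (fun k => ∫⁻ x, ‖φ k x - u x‖ₑ ^ 2 ∂μ) atTop (𝓝 0)

/-- `u` is in the domain of the self-adjoint Laplacian `Δ` (nonnegative sign convention) and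
`Δu = w ∈ L²`: `u` is in `W^{1,2}_0(M)`, and `∫ ⟨du, dφ⟩ dμ = ∫ w φ dμ` for `φ ∈ C^∞_c(M)`. -/
def HasLaplacian (n : ℕ) {M : Type*} [MetricSpace M]
    [ChartedSpace (EuclideanSpace ℝ (Fin n)) M] [IsManifold (𝓡 n) ∞ M]
    [MeasurableSpace M] [RiemannianBundle (fun x : M => TangentSpace (𝓡 n) x)]
    (μ : Measure M) (u w : M → ℝ) : Prop :=
  MemLp w 2 μ ∧ ∃ θ : CovectorField n M, HasSobolevDifferential μ u θ ∧
    ∀ φ ∈ testFunctions n M,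
      ∫ x, covectorInner (θ x) (differential n φ x) ∂μ = ∫ x, w x * φ x ∂μ

/-- `u t = e^{-tΔ} f` for `t > 0`, where `f ∈ L²`: the unique solution of the abstract Cauchy
problem `u' = -Δu` on `(0,∞)`, `u(0+) = f`, with derivative and limit taken in `L²`. -/
def IsHeatFlow (n : ℕ) {M : Type*} [MetricSpace M]
    [ChartedSpace (EuclideanSpace ℝ (Fin n)) M] [IsManifold (𝓡 n) ∞ M]
    [MeasurableSpace M] [RiemannianBundle (fun x : M => TangentSpace (𝓡 n) x)]
    (μ : Measure M) (f : M → ℝ) (u : ℝ → M → ℝ) : Prop :=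
  (∀ t : ℝ, 0 < t → ∃ w : M → ℝ, HasLaplacian n μ (u t) w ∧
    Tendsto (fun s : ℝ => ∫⁻ x, ‖(u (t + s) x - u t x) / s + w x‖ₑ ^ 2 ∂μ) (𝓝[≠] 0) (𝓝 0)) ∧
  Tendsto (fun t : ℝ => ∫⁻ x, ‖u t x - f x‖ₑ ^ 2 ∂μ) (𝓝[>] 0) (𝓝 0)

/-- `P(t,x,y)` is the heat kernel: the positive continuous (hence smooth) function on
`(0,∞) × M × M` with `(e^{-tΔ} f)(x) = ∫ P(t,x,y) f(y) dμ(y)` for all `f ∈ L²` with compact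
support. -/
def IsHeatKernel (n : ℕ) {M : Type*} [MetricSpace M]
    [ChartedSpace (EuclideanSpace ℝ (Fin n)) M] [IsManifold (𝓡 n) ∞ M]
    [MeasurableSpace M] [RiemannianBundle (fun x : M => TangentSpace (𝓡 n) x)]
    (μ : Measure M) (P : ℝ → M → M → ℝ) : Prop :=
  ContinuousOn (fun p : ℝ × M × M => P p.1 p.2.1 p.2.2) (Ioi 0 ×ˢ univ) ∧
  (∀ t : ℝ, 0 < t → ∀ x y, 0 < P t x y) ∧
  ∀ f : M → ℝ, MemLp f 2 μ → HasCompactSupport f →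
    IsHeatFlow n μ f (fun t x => ∫ y, P t x y * f y ∂μ)

/-- The Green kernel `G(x,y) = ∫_0^∞ P(t,x,y) dt ∈ [0,∞]`. -/
def greenKernel {M : Type*} (P : ℝ → M → M → ℝ) (x y : M) : ℝ≥0∞ :=
  ∫⁻ t in Ioi (0 : ℝ), ENNReal.ofReal (P t x y)

end Heat

end WeightedManifold

end

/-!
The idea is one integration by parts. Let `H` be a function with `H(0) = 0`, constant on `[1, ∞)`,
and let `F` be the primitive of `(H')²` vanishing at `0`. Then
`∫ |dH(u)|² dμ = ∫ ⟨du, dF(u)⟩ dμ`, and the right side only sees the Laplacian of `u` and the bound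
`F ≤ F(1)`. For `H(s) = s ^ τ` on `[0, 1]` one gets `F(1) = ∫₀¹ τ² s ^ (2τ - 2) ds = τ² / (2τ - 1)`,
finite exactly if `τ > 1 / 2`. The lemma `exists_powerProfile` provides smooth `H i → s ^ τ` whose
`F i 1` converge to this value.

Everything is done at the level of test functions, where the chain rule is elementary, and passes to
limits through the predicate `Approximable`: `u` is an `L²_loc` limit of test functions with
energies asymptotically at most `E`. Such a `u` lies in the homogeneous Sobolev space and has energy
at most `E` (`Approximable.exists_hasHomDifferential`), and the property survives bounded
almost everywhere limits (`Approximable.of_tendsto_ae`). Square integrable `1`-forms are handled as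
elements of `L²(μ; ℝⁿ)`, by means of a measurable orthonormal frame of the tangent bundle.

*Equilibrium potentials.* Let `φ_k` be a minimizing sequence for `cap(U)`, converging to `h`. The
limit `dh` is orthogonal to the differentials of test functions vanishing on `U`, such as
`F(φ_k) - F(1) φ_k`, so `∫ |dH(φ_k)|²` tends to `F(1) cap(U)`
(`IsEquilibriumPotential.approximable_comp`). To let `H → s ^ τ` one needs `0 ≤ h ≤ 1`. Clamping
`φ_k` to `[0, 1]` does not raise its energy, so the difference between `φ_k` and its clamping has
energy tending to `0`; non-parabolicity then forces it to tend to `0`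
(`IsEquilibriumPotential.ae_mem_Icc`). This uses `ae_eq_zero_of_tendsto`: a limit of test functions
with energies tending to `0` is locally constant, hence constant, and a nonzero constant would make
the manifold parabolic.

*Green functions.* The function `v = ∫_a^b e^{-tΔ} f dt` satisfies `Δ v = e^{-aΔ} f - e^{-bΔ} f`. If
`f ≥ 0`, then `∫ |dH(v)|² = ∫ F(v) Δ v ≤ F(1) ∫ e^{-aΔ} f ≤ F(1) ∫ f`, the last step being dual to
the sub-Markov property of the heat semigroup (`IsFormFlow.ae_le_one`, `IsHeatKernel.inner_le`). Let
`f` tend to the Dirac mass at `o`, then `a → 0` and `b → ∞`, and finally `H → s ^ τ`. No spectral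
theorem is needed: `Δ` is self-adjoint by the Riesz representation theorem applied to the resolvent
equation (`formLaplacian_of_forall_inner`), and the semigroup is symmetric by differentiating
`s ↦ ⟨e^{-sΔ} f, e^{-(t-s)Δ} g⟩` (`IsFormFlow.inner_eq`).
-/

set_option linter.unusedSectionVars false

noncomputable section

namespace WeightedManifold

/-! ### Charts and the measure -/

variable {n : ℕ} {M : Type*} [MetricSpace M] [ChartedSpace (EuclideanSpace ℝ (Fin n)) M]
  [RiemannianBundle (fun x : M => TangentSpace (𝓡 n) x)]

/-- The distance is finite and is the Riemannian one, so any two points are joined by a curve. -/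
theorem preconnectedSpace [IsRiemannianManifold (𝓡 n) M] : PreconnectedSpace M := by
  refine ⟨isPreconnected_of_forall_pair fun x _ y _ => ?_⟩
  have h : Manifold.riemannianEDist (𝓡 n) x y < ⊤ := by
    rw [← IsRiemannianManifold.out (I := 𝓡 n) x y]
    exact edist_lt_top x y
  obtain ⟨γ, h0, h1, hγ, -⟩ := Manifold.exists_lt_of_riemannianEDist_lt h
  exact ⟨γ '' Icc 0 1, subset_univ _, ⟨0, by simp, h0⟩, ⟨1, by simp, h1⟩,
    isPreconnected_Icc.image _ hγ.continuousOn⟩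

theorem isHermitian_gramMatrix (e : OpenPartialHomeomorph M (EuclideanSpace ℝ (Fin n)))
    (z : EuclideanSpace ℝ (Fin n)) : (gramMatrix e z).IsHermitian := by
  ext i j
  simp [gramMatrix, real_inner_comm]

/-- The quadratic form of the Gram matrix is the square of the Riemannian norm of the vector with
coordinates `v`. -/
theorem dotProduct_gramMatrix_mulVec (e : OpenPartialHomeomorph M (EuclideanSpace ℝ (Fin n)))
    (z : EuclideanSpace ℝ (Fin n)) (v : EuclideanSpace ℝ (Fin n)) :
    (v : Fin n → ℝ) ⬝ᵥ (gramMatrix e z).mulVec v =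
      norm (E := TangentSpace (𝓡 n) (e.symm z)) (mfderiv (𝓡 n) (𝓡 n) e.symm z v) ^ 2 := by
  let L : EuclideanSpace ℝ (Fin n) →L[ℝ] TangentSpace (𝓡 n) (e.symm z) :=
    mfderiv (𝓡 n) (𝓡 n) e.symm z
  change _ = ‖L v‖ ^ 2
  have hv : L v = ∑ i, v i • L (EuclideanSpace.single i 1) := by
    conv_lhs => rw [← (EuclideanSpace.basisFun (Fin n) ℝ).sum_repr v]
    simp
  rw [← real_inner_self_eq_norm_sq, hv, sum_inner]
  simp only [inner_sum, dotProduct, Matrix.mulVec, Finset.mul_sum]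
  refine Finset.sum_congr rfl fun i _ => Finset.sum_congr rfl fun j _ => ?_
  rw [real_inner_smul_left, real_inner_smul_right, mul_comm _ (v.ofLp j)]
  rfl

theorem _root_.Matrix.IsHermitian.pow_le_det {A : Matrix (Fin n) (Fin n) ℝ} (hA : A.IsHermitian)
    {c : ℝ} (hc : 0 ≤ c) (h : ∀ v : Fin n → ℝ, c * (v ⬝ᵥ v) ≤ v ⬝ᵥ A.mulVec v) :
    c ^ n ≤ A.det := by
  rw [hA.det_eq_prod_eigenvalues]
  have : ∀ i, c ≤ hA.eigenvalues i := fun i => by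
    have h1 := h (hA.eigenvectorBasis i)
    have h2 : (hA.eigenvectorBasis i : Fin n → ℝ) ⬝ᵥ hA.eigenvectorBasis i = 1 := by
      have := hA.eigenvectorBasis.norm_eq_one i
      rw [EuclideanSpace.norm_eq, Real.sqrt_eq_one] at this
      simpa [dotProduct, sq] using this
    rw [hA.eigenvalues_eq]
    simpa [h2] using h1
  calc c ^ n = ∏ _i : Fin n, c := by simp
    _ ≤ _ := by
      simpa using Finset.prod_le_prod (s := Finset.univ) (fun _ _ => hc) fun i _ => this i

theorem _root_.Matrix.IsHermitian.det_le_pow {A : Matrix (Fin n) (Fin n) ℝ} (hA : A.IsHermitian)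
    {C : ℝ} (h0 : ∀ v : Fin n → ℝ, 0 ≤ v ⬝ᵥ A.mulVec v)
    (h : ∀ v : Fin n → ℝ, v ⬝ᵥ A.mulVec v ≤ C * (v ⬝ᵥ v)) :
    A.det ≤ C ^ n := by
  rw [hA.det_eq_prod_eigenvalues]
  have : ∀ i, 0 ≤ hA.eigenvalues i ∧ hA.eigenvalues i ≤ C := fun i => by
    have h1 := h (hA.eigenvectorBasis i)
    have h2 : (hA.eigenvectorBasis i : Fin n → ℝ) ⬝ᵥ hA.eigenvectorBasis i = 1 := by
      have := hA.eigenvectorBasis.norm_eq_one i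
      rw [EuclideanSpace.norm_eq, Real.sqrt_eq_one] at this
      simpa [dotProduct, sq] using this
    rw [hA.eigenvalues_eq]
    exact ⟨by simpa using h0 (hA.eigenvectorBasis i), by simpa [h2] using h1⟩
  calc _ ≤ ∏ _i : Fin n, C := by
        simpa using Finset.prod_le_prod (s := Finset.univ) (fun i _ => (this i).1)
          fun i _ => (this i).2
    _ = C ^ n := by simp

variable [IsManifold (𝓡 n) ∞ M] [IsContMDiffRiemannianBundle (𝓡 n) ∞ (EuclideanSpace ℝ (Fin n))
  (fun x : M => TangentSpace (𝓡 n) x)]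

/-- A smooth metric is continuous; instance search does not find this by itself, the order of
smoothness being an explicit parameter. -/
instance continuousRiemannianBundle : IsContinuousRiemannianBundle (EuclideanSpace ℝ (Fin n))
    (fun x : M => TangentSpace (𝓡 n) x) := by
  obtain ⟨g, hg, h⟩ := IsContMDiffRiemannianBundle.exists_contMDiff (IB := 𝓡 n) (n := ∞)
    (F := EuclideanSpace ℝ (Fin n)) (E := (fun x : M => TangentSpace (𝓡 n) x))
  exact ⟨g, hg.continuous, h⟩

/-- Near `x₀`, the preferred chart at `x₀` and its inverse stretch vectors at most by a constant
factor. -/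
theorem exists_chart_bounds (x₀ : M) :
    ∃ N : Set M, IsOpen N ∧ x₀ ∈ N ∧ N ⊆ (chartAt (EuclideanSpace ℝ (Fin n)) x₀).source ∧
      ∃ C : ℝ, 0 < C ∧ ∀ y ∈ N,
        (∀ ξ : TangentSpace (𝓡 n) y, norm (E := EuclideanSpace ℝ (Fin n))
          (mfderiv (𝓡 n) (𝓡 n) (chartAt (EuclideanSpace ℝ (Fin n)) x₀) y ξ) ≤ C * ‖ξ‖) ∧
        ∀ v : EuclideanSpace ℝ (Fin n),
          norm (E := TangentSpace (𝓡 n) ((chartAt (EuclideanSpace ℝ (Fin n)) x₀).symm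
            (chartAt (EuclideanSpace ℝ (Fin n)) x₀ y)))
          (mfderiv (𝓡 n) (𝓡 n) (chartAt (EuclideanSpace ℝ (Fin n)) x₀).symm
            (chartAt (EuclideanSpace ℝ (Fin n)) x₀ y) v) ≤ C * ‖v‖ := by
  obtain ⟨C₁, hC₁, h₁⟩ := eventually_norm_mfderiv_extChartAt_lt (𝓡 n) x₀
  obtain ⟨C₂, hC₂, h₂⟩ := eventually_norm_mfderivWithin_symm_extChartAt_comp_lt (𝓡 n) x₀
  obtain ⟨N, hN, hNo, hx⟩ := eventually_nhds_iff.1 (h₁.and (h₂.and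
    (chart_source_mem_nhds (EuclideanSpace ℝ (Fin n)) x₀)))
  refine ⟨N, hNo, hx, fun y hy => (hN y hy).2.2, max C₁ C₂, lt_max_of_lt_left hC₁, fun y hy =>
    ⟨fun ξ => ?_, fun v => ?_⟩⟩
  · let L : TangentSpace (𝓡 n) y →L[ℝ] EuclideanSpace ℝ (Fin n) :=
      mfderiv (𝓡 n) (𝓡 n) (chartAt (EuclideanSpace ℝ (Fin n)) x₀) y
    have h : ‖L‖ < C₁ := (hN y hy).1
    refine (L.le_of_opNorm_le h.le ξ).trans ?_
    gcongr
    exact le_max_left _ _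
  · have h := (hN y hy).2.1
    rw [ModelWithCorners.range_eq_univ, mfderivWithin_univ] at h
    let L : EuclideanSpace ℝ (Fin n) →L[ℝ]
        TangentSpace (𝓡 n) ((chartAt (EuclideanSpace ℝ (Fin n)) x₀).symm
            (chartAt (EuclideanSpace ℝ (Fin n)) x₀ y)) :=
      mfderiv (𝓡 n) (𝓡 n) (chartAt (EuclideanSpace ℝ (Fin n)) x₀).symm
            (chartAt (EuclideanSpace ℝ (Fin n)) x₀ y)
    have h' : ‖L‖ < C₂ := h
    refine (L.le_of_opNorm_le h'.le v).trans ?_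
    gcongr
    exact le_max_right _ _

variable [MeasurableSpace M]

/-- An open neighbourhood `N` of `x₀`, inside the domain of the preferred chart at `x₀`, on which
the inverse of the chart stretches vectors at most by the factor `C`, and the measure `μ` is
comparable up to the factor `C` with the Lebesgue measure of the chart. -/
structure IsAdaptedNhd (n : ℕ) {M : Type*} [MetricSpace M]
    [ChartedSpace (EuclideanSpace ℝ (Fin n)) M]
    [RiemannianBundle (fun x : M => TangentSpace (𝓡 n) x)] [MeasurableSpace M]
    (μ : Measure M) (x₀ : M) (N : Set M) (C : ℝ) : Prop where
  isOpen : IsOpen N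
  mem : x₀ ∈ N
  subset : N ⊆ (chartAt (EuclideanSpace ℝ (Fin n)) x₀).source
  pos : 0 < C
  norm_symm_le : ∀ y ∈ N, ∀ v : EuclideanSpace ℝ (Fin n),
    norm (E := TangentSpace (𝓡 n) ((chartAt (EuclideanSpace ℝ (Fin n)) x₀).symm
        (chartAt (EuclideanSpace ℝ (Fin n)) x₀ y)))
      (mfderiv (𝓡 n) (𝓡 n) (chartAt (EuclideanSpace ℝ (Fin n)) x₀).symm
        (chartAt (EuclideanSpace ℝ (Fin n)) x₀ y) v) ≤ C * ‖v‖
  volume_le : ∀ A, MeasurableSet A → A ⊆ N →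
    volume (chartAt (EuclideanSpace ℝ (Fin n)) x₀ '' A) ≤ ENNReal.ofReal C * μ A
  le_volume : ∀ A, MeasurableSet A → A ⊆ N →
    μ A ≤ ENNReal.ofReal C * volume (chartAt (EuclideanSpace ℝ (Fin n)) x₀ '' A)

/-- If a chart and its inverse stretch vectors at most by the factor `C`, the eigenvalues of the
Gram matrix lie between `C⁻²` and `C²`, and its determinant between their `n`-th powers. -/
theorem det_gramMatrix_bounds {x₀ : M} {C : ℝ} (hC : 0 < C) {y : M}
    (hy : y ∈ (chartAt (EuclideanSpace ℝ (Fin n)) x₀).source)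
    (h₁ : ∀ ξ : TangentSpace (𝓡 n) y, norm (E := EuclideanSpace ℝ (Fin n))
      (mfderiv (𝓡 n) (𝓡 n) (chartAt (EuclideanSpace ℝ (Fin n)) x₀) y ξ) ≤ C * ‖ξ‖)
    (h₂ : ∀ v : EuclideanSpace ℝ (Fin n),
      norm (E := TangentSpace (𝓡 n) ((chartAt (EuclideanSpace ℝ (Fin n)) x₀).symm
          (chartAt (EuclideanSpace ℝ (Fin n)) x₀ y)))
        (mfderiv (𝓡 n) (𝓡 n) (chartAt (EuclideanSpace ℝ (Fin n)) x₀).symm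
          (chartAt (EuclideanSpace ℝ (Fin n)) x₀ y) v) ≤ C * ‖v‖) :
    ((C ^ 2)⁻¹) ^ n ≤ (gramMatrix (chartAt (EuclideanSpace ℝ (Fin n)) x₀)
        (chartAt (EuclideanSpace ℝ (Fin n)) x₀ y)).det ∧
    (gramMatrix (chartAt (EuclideanSpace ℝ (Fin n)) x₀)
        (chartAt (EuclideanSpace ℝ (Fin n)) x₀ y)).det ≤ (C ^ 2) ^ n := by
  set e := chartAt (EuclideanSpace ℝ (Fin n)) x₀
  have hG := isHermitian_gramMatrix (M := M) e (e y)
  have hsq : ∀ v : EuclideanSpace ℝ (Fin n), (v : Fin n → ℝ) ⬝ᵥ v = ‖v‖ ^ 2 := fun v => by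
    rw [EuclideanSpace.norm_sq_eq]
    simp [dotProduct, sq]
  have key := fun v => dotProduct_gramMatrix_mulVec (M := M) e (e y) v
  constructor
  · refine hG.pow_le_det (by positivity) fun v => ?_
    have h := key (WithLp.toLp 2 v)
    have hs := hsq (WithLp.toLp 2 v)
    simp only at h hs
    rw [h, hs, inv_mul_le_iff₀ (by positivity), ← mul_pow]
    refine pow_le_pow_left₀ (norm_nonneg _) ?_ 2
    have he : e.symm (e y) = y := e.left_inv hy
    have hcomp : ∀ w : EuclideanSpace ℝ (Fin n), (mfderiv (𝓡 n) (𝓡 n) e (e.symm (e y))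
        (mfderiv (𝓡 n) (𝓡 n) e.symm (e y) w)) = w := by
      intro w
      have hd : e.MDifferentiable (𝓡 n) (𝓡 n) := mdifferentiable_chart x₀
      exact congrArg (fun L => L w) (hd.comp_symm_deriv (e.map_source hy))
    have h1' : ∀ ξ : TangentSpace (𝓡 n) (e.symm (e y)), norm (E := EuclideanSpace ℝ (Fin n))
      (mfderiv (𝓡 n) (𝓡 n) e (e.symm (e y)) ξ) ≤ C * ‖ξ‖ := by
      rw [he]; exact h₁
    have := h1' (mfderiv (𝓡 n) (𝓡 n) e.symm (e y) (WithLp.toLp 2 v))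
    rwa [hcomp] at this
  · refine hG.det_le_pow (fun v => ?_) fun v => ?_
    · have h := key (WithLp.toLp 2 v)
      simp only at h
      rw [h]; positivity
    · have h := key (WithLp.toLp 2 v)
      have hs := hsq (WithLp.toLp 2 v)
      simp only at h hs
      rw [h, hs, ← mul_pow]
      exact pow_le_pow_left₀ (norm_nonneg _) (h₂ _) 2

variable [BorelSpace M]

open Classical in
theorem measurableSet_image_of_subset_source {X Y : Type*} [TopologicalSpace X]
    [MeasurableSpace X] [BorelSpace X] [TopologicalSpace Y] [MeasurableSpace Y] [BorelSpace Y]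
    (e : OpenPartialHomeomorph X Y) {A : Set X} (hA : MeasurableSet A) (hAs : A ⊆ e.source) :
    MeasurableSet (e '' A) := by
  rcases A.eq_empty_or_nonempty with rfl | ⟨x₀, -⟩
  · simp
  rw [e.image_eq_target_inter_inv_preimage hAs]
  have := (e.continuousOn_symm.measurable_piecewise (g := fun _ => x₀) continuousOn_const
    e.open_target.measurableSet) hA
  convert e.open_target.measurableSet.inter this using 1
  ext z
  by_cases hz : z ∈ e.target <;> simp [hz]

/-- The density of `μ` in the chart is `e^f √(det g_{ij})`, which is bounded above and away from
`0` near `x₀`. -/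
theorem exists_isAdaptedNhd {μ : Measure M} (hμ : IsWeightedVolume n μ) (x₀ : M) :
    ∃ N C, IsAdaptedNhd n μ x₀ N C := by
  obtain ⟨vol, f, hvol, hf, rfl⟩ := hμ
  obtain ⟨N, hNo, hx, hNs, C, hC, hN⟩ := exists_chart_bounds (n := n) x₀
  set e := chartAt (EuclideanSpace ℝ (Fin n)) x₀ with he
  have hfx : IsOpen (f ⁻¹' Ioo (f x₀ - 1) (f x₀ + 1)) := isOpen_Ioo.preimage hf.continuous
  set N' := N ∩ f ⁻¹' Ioo (f x₀ - 1) (f x₀ + 1) with hN'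
  -- the density of `μ` in the chart lies between `a` and `b`
  set a : ℝ := Real.sqrt (((C ^ 2)⁻¹) ^ n) * Real.exp (f x₀ - 1) with ha
  set b : ℝ := Real.sqrt ((C ^ 2) ^ n) * Real.exp (f x₀ + 1) with hb
  have ha0 : 0 < a := by positivity
  have hb0 : 0 < b := by positivity
  have hdet : ∀ z ∈ e '' N', ((C ^ 2)⁻¹) ^ n ≤ (gramMatrix e z).det ∧
      (gramMatrix e z).det ≤ (C ^ 2) ^ n := by
    rintro _ ⟨y, hy, rfl⟩
    exact det_gramMatrix_bounds hC (hNs hy.1) (hN y hy.1).1 (hN y hy.1).2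
  have hvolA : ∀ A, MeasurableSet A → A ⊆ N' →
      vol A = ∫⁻ z in e '' A, ENNReal.ofReal (Real.sqrt (gramMatrix e z).det) := fun A hA hAN =>
    hvol e (IsManifold.chart_mem_maximalAtlas x₀) A hA (hAN.trans (inter_subset_left.trans hNs))
  have hmeas : ∀ A, MeasurableSet A → A ⊆ N' → MeasurableSet (e '' A) := fun A hA hAN => by
    exact measurableSet_image_of_subset_source e hA (hAN.trans (inter_subset_left.trans hNs))
  refine ⟨N', max C (max a⁻¹ b), hNo.inter hfx, ⟨hx, by simp⟩, inter_subset_left.trans hNs,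
    lt_max_of_lt_left hC, fun y hy v => ((hN y hy.1).2 v).trans ?_, fun A hA hAN => ?_,
    fun A hA hAN => ?_⟩
  · gcongr; exact le_max_left _ _
  · have h1 : ENNReal.ofReal a * volume (e '' A) ≤
        (vol.withDensity fun x => ENNReal.ofReal (Real.exp (f x))) A := by
      rw [withDensity_apply _ hA, ha, ENNReal.ofReal_mul (by positivity)]
      calc _ = ENNReal.ofReal (Real.exp (f x₀ - 1)) *
            ∫⁻ z in e '' A, ENNReal.ofReal (Real.sqrt (((C ^ 2)⁻¹) ^ n)) := by
              rw [setLIntegral_const]; ring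
        _ ≤ ENNReal.ofReal (Real.exp (f x₀ - 1)) * vol A := by
              rw [hvolA A hA hAN]
              gcongr 1
              refine setLIntegral_mono' (hmeas A hA hAN) fun z hz => ?_
              exact ENNReal.ofReal_le_ofReal (Real.sqrt_le_sqrt (hdet z (image_mono hAN hz)).1)
        _ = ∫⁻ x in A, ENNReal.ofReal (Real.exp (f x₀ - 1)) ∂vol := by
              rw [setLIntegral_const]
        _ ≤ _ := by
              refine setLIntegral_mono' hA fun x hx => ?_
              exact ENNReal.ofReal_le_ofReal (Real.exp_le_exp.2 (hAN hx).2.1.le)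
    calc volume (e '' A) = ENNReal.ofReal a⁻¹ * (ENNReal.ofReal a * volume (e '' A)) := by
          rw [← mul_assoc, ← ENNReal.ofReal_mul (by positivity), inv_mul_cancel₀ ha0.ne']
          simp
      _ ≤ _ := by
          gcongr
          exact (le_max_left _ _).trans (le_max_right _ _)
  · have h1 : (vol.withDensity fun x => ENNReal.ofReal (Real.exp (f x))) A ≤
        ENNReal.ofReal b * volume (e '' A) := by
      rw [withDensity_apply _ hA, hb, ENNReal.ofReal_mul (by positivity)]
      calc _ ≤ ∫⁻ x in A, ENNReal.ofReal (Real.exp (f x₀ + 1)) ∂vol := by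
              refine setLIntegral_mono' hA fun x hx => ?_
              exact ENNReal.ofReal_le_ofReal (Real.exp_le_exp.2 (hAN hx).2.2.le)
        _ = ENNReal.ofReal (Real.exp (f x₀ + 1)) * vol A := by
              rw [setLIntegral_const]
        _ ≤ ENNReal.ofReal (Real.exp (f x₀ + 1)) *
            ∫⁻ z in e '' A, ENNReal.ofReal (Real.sqrt ((C ^ 2) ^ n)) := by
              rw [hvolA A hA hAN]
              gcongr 1
              refine setLIntegral_mono' (hmeas A hA hAN) fun z hz => ?_
              exact ENNReal.ofReal_le_ofReal (Real.sqrt_le_sqrt (hdet z (image_mono hAN hz)).2)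
        _ = _ := by
              rw [setLIntegral_const]; ring
    refine h1.trans ?_
    gcongr
    exact (le_max_right _ _).trans (le_max_right _ _)

theorem isLocallyFiniteMeasure {μ : Measure M} (hμ : IsWeightedVolume n μ) :
    IsLocallyFiniteMeasure μ := by
  refine ⟨fun x₀ => ?_⟩
  obtain ⟨N, C, h⟩ := exists_isAdaptedNhd hμ x₀
  set e := chartAt (EuclideanSpace ℝ (Fin n)) x₀
  set B := Metric.ball (e x₀) 1
  have hB : IsOpen (e.source ∩ e ⁻¹' B) := e.isOpen_inter_preimage Metric.isOpen_ball
  refine ⟨N ∩ (e.source ∩ e ⁻¹' B), (h.isOpen.inter hB).mem_nhds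
    ⟨h.mem, mem_chart_source _ _, by simp [B]⟩, ?_⟩
  refine (h.le_volume _ (h.isOpen.inter hB).measurableSet inter_subset_left).trans_lt ?_
  refine ENNReal.mul_lt_top (by simp) ((measure_mono ?_).trans_lt
    (measure_ball_lt_top (x := e x₀) (r := 1)))
  rintro _ ⟨y, hy, rfl⟩
  exact hy.2.2

theorem isOpenPosMeasure {μ : Measure M} (hμ : IsWeightedVolume n μ) :
    μ.IsOpenPosMeasure := by
  refine ⟨fun V hV ⟨x₀, hx₀⟩ h0 => ?_⟩
  obtain ⟨N, C, h⟩ := exists_isAdaptedNhd hμ x₀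
  have hVN := hV.inter h.isOpen
  have h1 := h.volume_le (V ∩ N) hVN.measurableSet inter_subset_right
  rw [measure_mono_null inter_subset_left h0, mul_zero] at h1
  have h2 := (chartAt (EuclideanSpace ℝ (Fin n)) x₀).isOpen_image_of_subset_source hVN
    (inter_subset_right.trans h.subset)
  exact (h2.measure_pos volume ⟨_, mem_image_of_mem _ ⟨hx₀, h.mem⟩⟩).ne' (le_zero_iff.1 h1)

/-! ### Measurable orthonormal frames and coordinates of `1`-forms -/

variable [SecondCountableTopology M]

section GramSchmidt

variable {X : Type*} [MeasurableSpace X] {ν : Measure X} {V : X → Type*}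
  [∀ x, NormedAddCommGroup (V x)] [∀ x, InnerProductSpace ℝ (V x)] {ι : Type*} [Fintype ι]
  [LinearOrder ι] [LocallyFiniteOrderBot ι] [WellFoundedLT ι]

theorem inner_gramSchmidt_self {V : Type*} [NormedAddCommGroup V] [InnerProductSpace ℝ V]
    (f : ι → V) (i : ι) :
    ‖InnerProductSpace.gramSchmidt ℝ f i‖ ^ 2 =
      inner ℝ (InnerProductSpace.gramSchmidt ℝ f i) (f i) := by
  conv_rhs => rw [InnerProductSpace.gramSchmidt_def'' ℝ f i]
  rw [inner_add_right, inner_sum, real_inner_self_eq_norm_sq, Finset.sum_eq_zero, add_zero]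
  intro j hj
  rw [real_inner_smul_right, InnerProductSpace.gramSchmidt_orthogonal ℝ f
    (Finset.mem_Iio.1 hj).ne', mul_zero]

/-- The Gram–Schmidt process preserves measurability, for fields of vectors in spaces depending on
the point: what is preserved is the measurability of the values of a given field of linear forms.
-/
theorem aemeasurable_apply_gramSchmidt {f : ∀ x, ι → V x}
    (hf : ∀ i j, AEMeasurable (fun x => inner ℝ (f x i) (f x j)) ν)
    {l : ∀ x, V x →ₗ[ℝ] ℝ} (hl : ∀ i, AEMeasurable (fun x => l x (f x i)) ν) (i : ι) :
    AEMeasurable (fun x => l x (InnerProductSpace.gramSchmidt ℝ (f x) i)) ν := by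
  have key : ∀ i, (∀ j, AEMeasurable
        (fun x => inner ℝ (InnerProductSpace.gramSchmidt ℝ (f x) i) (f x j)) ν) ∧
      AEMeasurable (fun x => l x (InnerProductSpace.gramSchmidt ℝ (f x) i)) ν := by
    intro i
    induction i using WellFoundedLT.induction with
    | ind i ih =>
      have h : ∀ x, InnerProductSpace.gramSchmidt ℝ (f x) i = f x i - ∑ k ∈ Finset.Iio i,
          (inner ℝ (InnerProductSpace.gramSchmidt ℝ (f x) k) (f x i) /
            inner ℝ (InnerProductSpace.gramSchmidt ℝ (f x) k) (f x k)) •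
            InnerProductSpace.gramSchmidt ℝ (f x) k := fun x => by
        rw [eq_sub_iff_add_eq]
        simp only [← inner_gramSchmidt_self]
        exact (InnerProductSpace.gramSchmidt_def'' ℝ (f x) i).symm
      constructor
      · intro j
        simp_rw [h, inner_sub_left, sum_inner, real_inner_smul_left]
        refine (hf i j).sub (Finset.aemeasurable_fun_sum _ fun k hk => ?_)
        have := (ih k (Finset.mem_Iio.1 hk)).1
        exact ((this i).div (this k)).mul (this j)
      · simp_rw [h, map_sub, map_sum, map_smul, smul_eq_mul]
        refine (hl i).sub (Finset.aemeasurable_fun_sum _ fun k hk => ?_)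
        have := ih k (Finset.mem_Iio.1 hk)
        exact ((this.1 i).div (this.1 k)).mul this.2
  exact (key i).2

theorem aemeasurable_apply_gramSchmidtNormed {f : ∀ x, ι → V x}
    (hf : ∀ i j, AEMeasurable (fun x => inner ℝ (f x i) (f x j)) ν)
    {l : ∀ x, V x →ₗ[ℝ] ℝ} (hl : ∀ i, AEMeasurable (fun x => l x (f x i)) ν) (i : ι) :
    AEMeasurable (fun x => l x (InnerProductSpace.gramSchmidtNormed ℝ (f x) i)) ν := by
  have h : AEMeasurable (fun x => ‖InnerProductSpace.gramSchmidt ℝ (f x) i‖ ^ 2) ν := by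
    simp_rw [inner_gramSchmidt_self, real_inner_comm]
    exact aemeasurable_apply_gramSchmidt (l := fun x => (innerₛₗ ℝ (f x i))) hf
      (fun j => hf i j) i
  have h' : AEMeasurable (fun x => ‖InnerProductSpace.gramSchmidt ℝ (f x) i‖) ν := by
    simpa using h.sqrt
  simp only [InnerProductSpace.gramSchmidtNormed, map_smul, smul_eq_mul]
  exact h'.inv.mul (aemeasurable_apply_gramSchmidt hf hl i)

theorem exists_orthonormalBasis_eq_gramSchmidtNormed {V : Type*} [NormedAddCommGroup V]
    [InnerProductSpace ℝ V] [FiniteDimensional ℝ V] (h : Module.finrank ℝ V = Fintype.card ι)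
    {f : ι → V} (hf : LinearIndependent ℝ f) : ∃ b : OrthonormalBasis ι ℝ V,
      ∀ i, b i = InnerProductSpace.gramSchmidtNormed ℝ f i := by
  refine ⟨InnerProductSpace.gramSchmidtOrthonormalBasis h f, fun i =>
    InnerProductSpace.gramSchmidtOrthonormalBasis_apply _ fun h0 => ?_⟩
  have := InnerProductSpace.gramSchmidtNormed_unit_length i hf
  rw [h0, norm_zero] at this
  exact zero_ne_one this

end GramSchmidt

/-- Smooth vector fields on all of `M` which are linearly independent near a given point. -/
theorem exists_smooth_fields_linearIndependent (x₀ : M) :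
    ∃ X : Fin n → (x : M) → TangentSpace (𝓡 n) x,
      (∀ i, ContMDiff (𝓡 n) (𝓡 n).tangent ∞
        (fun x => (⟨x, X i x⟩ : TangentBundle (𝓡 n) M))) ∧
      ∃ N ∈ 𝓝 x₀, ∀ y ∈ N, LinearIndependent ℝ (fun i => X i y) := by
  let e := trivializationAt (EuclideanSpace ℝ (Fin n)) (TangentSpace (𝓡 n) : M → Type _) x₀
  let b := (EuclideanSpace.basisFun (Fin n) ℝ).toBasis
  obtain ⟨ρ⟩ : Nonempty (SmoothBumpFunction (𝓡 n) x₀) := inferInstance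
  have hfr := e.isLocalFrameOn_localFrame_baseSet (𝓡 n) ∞ b
  refine ⟨fun i => (ρ : M → ℝ) • e.localFrame b i, fun i => ?_, ?_⟩
  · refine ContMDiffOn.smul_section_of_tsupport (u := e.baseSet) ρ.contMDiff.contMDiffOn
      e.open_baseSet ?_ (hfr.contMDiffOn i)
    exact ρ.tsupport_subset_chartAt_source
  · have h2 : e.baseSet ∈ 𝓝 x₀ := e.open_baseSet.mem_nhds (mem_baseSet_trivializationAt _ _ _)
    refine ⟨_, inter_mem ρ.eventuallyEq_one h2, fun y hy => ?_⟩
    have := hfr.linearIndependent hy.2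
    have h1 : ρ y = 1 := hy.1
    simpa [h1] using this

theorem finrank_tangentSpace (x : M) :
    Module.finrank ℝ (TangentSpace (𝓡 n) x) = Fintype.card (Fin n) :=
  finrank_euclideanSpace (𝕜 := ℝ) (ι := Fin n)

instance finiteDimensional_tangentSpace (x : M) : FiniteDimensional ℝ (TangentSpace (𝓡 n) x) :=
  inferInstanceAs (FiniteDimensional ℝ (EuclideanSpace ℝ (Fin n)))

/-- A function glued from countably many measurable ones along a measurable choice of the index is
measurable. -/
theorem _root_.AEMeasurable.comp_measurable_index {X Y : Type*} [MeasurableSpace X]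
    [MeasurableSpace Y] {ν : Measure X} {g : ℕ → X → Y} (hg : ∀ m, AEMeasurable (g m) ν)
    {k : X → ℕ} (hk : Measurable k) : AEMeasurable (fun x => g (k x) x) ν := by
  refine ⟨fun x => (hg (k x)).mk _ x, ?_, ?_⟩
  · exact (measurable_from_prod_countable_right (f := fun p : ℕ × X => (hg p.1).mk _ p.2)
      fun m => (hg m).measurable_mk).comp (hk.prodMk measurable_id)
  · filter_upwards [ae_all_iff.2 fun m => (hg m).ae_eq_mk] with x hx
    exact hx (k x)

/-- The `1`-form `⟨X, ·⟩` dual to a smooth vector field is measurable. -/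
theorem isMeasurableForm_inner (μ : Measure M) {X : (x : M) → TangentSpace (𝓡 n) x}
    (hX : ContMDiff (𝓡 n) (𝓡 n).tangent ∞ (fun x => (⟨x, X x⟩ : TangentBundle (𝓡 n) M))) :
    IsMeasurableForm μ (fun x => innerSL ℝ (X x)) := by
  intro Y hY
  have : Continuous fun x => inner ℝ (X x) (Y x) :=
    Continuous.inner_bundle (F := EuclideanSpace ℝ (Fin n)) hX.continuous hY.continuous
  exact this.measurable.aemeasurable

variable (n M) in
/-- A global, possibly discontinuous, frame of the tangent bundle: countably many local frames are
patched by taking at each point the first one which is independent there. -/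
theorem exists_measurable_frame [Nonempty M] :
    ∃ f : (x : M) → Fin n → TangentSpace (𝓡 n) x, (∀ x, LinearIndependent ℝ (f x)) ∧
      (∀ (μ : Measure M) i j, AEMeasurable (fun x => inner ℝ (f x i) (f x j)) μ) ∧
      ∀ (μ : Measure M) (θ : CovectorField n M), IsMeasurableForm μ θ →
        ∀ i, AEMeasurable (fun x => θ x (f x i)) μ := by
  choose X hX N hN hXN using exists_smooth_fields_linearIndependent (n := n) (M := M)
  obtain ⟨s, hs, hsu⟩ := TopologicalSpace.countable_cover_nhds (f := fun x => interior (N x))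
    fun x => interior_mem_nhds.2 (hN x)
  have hsne : s.Nonempty := by
    by_contra h
    rw [Set.not_nonempty_iff_eq_empty] at h
    rw [h, biUnion_empty] at hsu
    exact empty_ne_univ hsu
  obtain ⟨c, rfl⟩ := hs.exists_eq_range hsne
  have hcov : ∀ x, ∃ m, x ∈ interior (N (c m)) := fun x => by
    have : x ∈ ⋃ y ∈ range c, interior (N y) := hsu ▸ mem_univ x
    simpa using this
  classical
  -- the first index of the countable cover whose member contains the point
  let k : M → ℕ := fun x => Nat.find (hcov x)
  have hk : Measurable k := measurable_find hcov fun m => isOpen_interior.measurableSet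
  refine ⟨fun x i => X (c (k x)) i x, fun x => hXN _ x (interior_subset (Nat.find_spec (hcov x))),
    fun μ i j => AEMeasurable.comp_measurable_index
      (g := fun m x => inner ℝ (X (c m) i x) (X (c m) j x))
      (fun m => isMeasurableForm_inner μ (hX (c m) i) _ (hX (c m) j)) hk,
    fun μ θ hθ i => AEMeasurable.comp_measurable_index (g := fun m x => θ x (X (c m) i x))
      (fun m => hθ _ (hX (c m) i)) hk⟩

variable (n M) in
/-- Gram–Schmidt applied to a measurable frame gives a measurable orthonormal frame. -/
theorem exists_measurable_orthonormal_frame :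
    ∃ E : (x : M) → OrthonormalBasis (Fin n) ℝ (TangentSpace (𝓡 n) x),
      ∀ (μ : Measure M) (θ : CovectorField n M), IsMeasurableForm μ θ →
        ∀ i, AEMeasurable (fun x => θ x (E x i)) μ := by
  rcases isEmpty_or_nonempty M with hM | hM
  · exact ⟨fun x => isEmptyElim x, fun μ θ _ i => by
      rw [Measure.eq_zero_of_isEmpty μ]; exact aemeasurable_zero_measure⟩
  obtain ⟨f, hf, h1, h2⟩ := exists_measurable_frame n M
  have hfin : ∀ x : M, Module.finrank ℝ (TangentSpace (𝓡 n) x) = Fintype.card (Fin n) :=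
    fun x => finrank_tangentSpace x
  choose b hb using fun x => exists_orthonormalBasis_eq_gramSchmidtNormed (hfin x) (hf x)
  have h3 : ∀ (μ : Measure M) (θ : CovectorField n M), IsMeasurableForm μ θ →
      ∀ i, AEMeasurable (fun x => θ x (InnerProductSpace.gramSchmidtNormed ℝ (f x) i)) μ :=
    fun μ θ hθ i => aemeasurable_apply_gramSchmidtNormed
      (l := fun x => (θ x : TangentSpace (𝓡 n) x →ₗ[ℝ] ℝ)) (h1 μ) (h2 μ θ hθ) i
  exact ⟨b, fun μ θ hθ i => (h3 μ θ hθ i).congr (Eventually.of_forall fun x =>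
    congrArg (θ x) (hb x i).symm)⟩

variable (n M) in
/-- A measurable orthonormal frame of the tangent bundle: along it, every measurable `1`-form has
measurable coefficients. It is in general discontinuous. -/
def frame : (x : M) → OrthonormalBasis (Fin n) ℝ (TangentSpace (𝓡 n) x) :=
  (exists_measurable_orthonormal_frame n M).choose

/-- The coefficients of a `1`-form along the orthonormal frame `frame n M`. -/
def coords (θ : CovectorField n M) (x : M) : EuclideanSpace ℝ (Fin n) :=
  WithLp.toLp 2 fun i => θ x (frame n M x i)

/-- The `1`-form with given coefficients along the orthonormal frame `frame n M`. -/
def ofCoords (η : M → EuclideanSpace ℝ (Fin n)) : CovectorField n M :=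
  fun x => ∑ i, η x i • (innerSL ℝ (frame n M x i) : TangentSpace (𝓡 n) x →L[ℝ] ℝ)

theorem coords_add (α β : CovectorField n M) (x : M) :
    coords (α + β) x = coords α x + coords β x := rfl

theorem coords_sub (α β : CovectorField n M) (x : M) :
    coords (α - β) x = coords α x - coords β x := rfl

theorem coords_smul (c : M → ℝ) (α : CovectorField n M) (x : M) :
    coords (fun x => c x • α x) x = c x • coords α x := rfl

theorem coords_ofCoords (η : M → EuclideanSpace ℝ (Fin n)) : coords (ofCoords η) = η := by
  funext x
  ext i
  have h : ∀ j, inner ℝ (frame n M x j) (frame n M x i) = if j = i then (1 : ℝ) else 0 :=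
    fun j => (frame n M x).inner_eq_ite j i
  simp [coords, ofCoords, h]

theorem norm_toLp_apply_orthonormalBasis {V : Type*} [NormedAddCommGroup V]
    [InnerProductSpace ℝ V] [CompleteSpace V] (b : OrthonormalBasis (Fin n) ℝ V) (l : V →L[ℝ] ℝ) :
    ‖(WithLp.toLp 2 fun i => l (b i) : EuclideanSpace ℝ (Fin n))‖ = ‖l‖ := by
  obtain ⟨v, rfl⟩ := (InnerProductSpace.toDual ℝ V).surjective l
  rw [LinearIsometryEquiv.norm_map, ← b.repr.norm_map v]
  congr 1
  ext i
  simp [b.repr_apply_apply, real_inner_comm]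

theorem norm_coords (θ : CovectorField n M) (x : M) : ‖coords θ x‖ = ‖θ x‖ := by
  have : CompleteSpace (TangentSpace (𝓡 n) x) := FiniteDimensional.complete ℝ _
  exact norm_toLp_apply_orthonormalBasis (frame n M x) (θ x)

theorem enorm_coords (θ : CovectorField n M) (x : M) : ‖coords θ x‖ₑ = ‖θ x‖ₑ := by
  rw [← ofReal_norm, norm_coords]
  exact ofReal_norm (θ x)

/-- Along an orthonormal frame, the scalar product of covectors defined by polarization becomes the
Euclidean one. -/
theorem inner_coords (α β : CovectorField n M) (x : M) :
    inner ℝ (coords α x) (coords β x) = covectorInner (α x) (β x) := by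
  have h1 := norm_add_sq_real (coords α x) (coords β x)
  have h2 := norm_sub_sq_real (coords α x) (coords β x)
  rw [← coords_add, norm_coords] at h1
  rw [← coords_sub, norm_coords] at h2
  rw [covectorInner, eq_div_iff four_ne_zero]
  change _ = ‖(α + β) x‖ ^ 2 - ‖(α - β) x‖ ^ 2
  rw [h1, h2]
  ring

theorem _root_.MeasureTheory.aemeasurable_euclideanSpace {X : Type*} [MeasurableSpace X]
    {ν : Measure X} {f : X → EuclideanSpace ℝ (Fin n)} (h : ∀ i, AEMeasurable (fun x => f x i) ν) :
    AEMeasurable f ν :=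
  (WithLp.measurable_toLp 2 (Fin n → ℝ)).comp_aemeasurable (aemeasurable_pi_iff.2 h)

theorem IsMeasurableForm.aemeasurable_coords {μ : Measure M} {θ : CovectorField n M}
    (h : IsMeasurableForm μ θ) : AEMeasurable (coords θ) μ :=
  aemeasurable_euclideanSpace fun i =>
    (exists_measurable_orthonormal_frame n M).choose_spec μ θ h i

/-- Every measurable family of coefficients defines a measurable `1`-form. -/
theorem isMeasurableForm_ofCoords {μ : Measure M} {η : M → EuclideanSpace ℝ (Fin n)}
    (h : AEMeasurable η μ) : IsMeasurableForm μ (ofCoords η) := by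
  intro X hX
  have h1 := (isMeasurableForm_inner μ hX).aemeasurable_coords
  simp only [ofCoords, sum_apply, smul_apply, smul_eq_mul]
  refine Finset.aemeasurable_fun_sum _ fun i _ => AEMeasurable.mul ?_ ?_
  · exact (EuclideanSpace.proj i : EuclideanSpace ℝ (Fin n) →L[ℝ] ℝ).measurable.comp_aemeasurable h
  · have := (EuclideanSpace.proj i :
      EuclideanSpace ℝ (Fin n) →L[ℝ] ℝ).measurable.comp_aemeasurable h1
    refine this.congr (Eventually.of_forall fun x => ?_)
    exact real_inner_comm (frame n M x i) (X x)

theorem formEnergy_eq (μ : Measure M) (θ : CovectorField n M) :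
    formEnergy μ θ = ∫⁻ x, ‖coords θ x‖ₑ ^ 2 ∂μ := by
  simp only [formEnergy, enorm_coords]

/-! ### Test functions and the chain rule -/

/-- The chain rule `d(F ∘ φ) = F'(φ) dφ`. -/
theorem differential_comp_real {φ : M → ℝ} {x : M} {F : ℝ → ℝ} {F' : ℝ}
    (hF : HasDerivAt F F' (φ x)) (hφ : MDifferentiableAt (𝓡 n) 𝓘(ℝ, ℝ) φ x) :
    differential n (F ∘ φ) x = F' • differential n φ x := by
  have h := HasMFDerivAt.comp (I := 𝓡 n) (I' := 𝓘(ℝ, ℝ)) (I'' := 𝓘(ℝ, ℝ)) x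
    hF.hasFDerivAt.hasMFDerivAt hφ.hasMFDerivAt
  refine h.mfderiv.trans ?_
  ext ξ
  exact mul_comm (differential n φ x ξ) F'

theorem differential_add {φ ψ : M → ℝ} (hφ : MDifferentiable (𝓡 n) 𝓘(ℝ, ℝ) φ)
    (hψ : MDifferentiable (𝓡 n) 𝓘(ℝ, ℝ) ψ) :
    differential n (φ + ψ) = differential n φ + differential n ψ := by
  funext x
  exact mfderiv_add (hφ x) (hψ x)

theorem differential_const_smul {φ : M → ℝ} (c : ℝ) (hφ : MDifferentiable (𝓡 n) 𝓘(ℝ, ℝ) φ) :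
    differential n (c • φ) = fun x => c • differential n φ x := by
  funext x
  exact const_smul_mfderiv (hφ x) c

theorem differential_mul {φ ψ : M → ℝ} (hφ : MDifferentiable (𝓡 n) 𝓘(ℝ, ℝ) φ)
    (hψ : MDifferentiable (𝓡 n) 𝓘(ℝ, ℝ) ψ) (x : M) :
    differential n (φ * ψ) x = φ x • differential n ψ x + ψ x • differential n φ x := by
  exact ((hφ x).hasMFDerivAt.mul (hψ x).hasMFDerivAt).mfderiv

theorem isMeasurableForm_differential (μ : Measure M) {φ : M → ℝ}
    (hφ : ContMDiff (𝓡 n) 𝓘(ℝ, ℝ) ∞ φ) : IsMeasurableForm μ (differential n φ) := by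
  intro X hX
  have h1 : Continuous (tangentMap (𝓡 n) 𝓘(ℝ, ℝ) φ) := hφ.continuous_tangentMap (by simp)
  have h2 := (tangentBundleModelSpaceHomeomorph 𝓘(ℝ, ℝ)).continuous.comp (h1.comp hX.continuous)
  have h3 : Continuous fun x => ((tangentBundleModelSpaceHomeomorph 𝓘(ℝ, ℝ))
    (tangentMap (𝓡 n) 𝓘(ℝ, ℝ) φ ⟨x, X x⟩)).2 := continuous_snd.comp h2
  exact h3.measurable.aemeasurable

theorem contDiffOn_comp_chart_symm {φ : M → ℝ} (hφ : ContMDiff (𝓡 n) 𝓘(ℝ, ℝ) ∞ φ) (x₀ : M) :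
    ContDiffOn ℝ ∞ (φ ∘ (chartAt (EuclideanSpace ℝ (Fin n)) x₀).symm)
      (chartAt (EuclideanSpace ℝ (Fin n)) x₀).target := by
  rw [← contMDiffOn_iff_contDiffOn]
  exact hφ.comp_contMDiffOn (contMDiffOn_chart_symm (I := 𝓡 n))

theorem fderiv_comp_chart_symm {φ : M → ℝ} (hφ : ContMDiff (𝓡 n) 𝓘(ℝ, ℝ) ∞ φ) (x₀ : M)
    {z : EuclideanSpace ℝ (Fin n)} (hz : z ∈ (chartAt (EuclideanSpace ℝ (Fin n)) x₀).target)
    (v : EuclideanSpace ℝ (Fin n)) :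
    fderiv ℝ (φ ∘ (chartAt (EuclideanSpace ℝ (Fin n)) x₀).symm) z v =
      differential n φ ((chartAt (EuclideanSpace ℝ (Fin n)) x₀).symm z)
        (mfderiv (𝓡 n) (𝓡 n) (chartAt (EuclideanSpace ℝ (Fin n)) x₀).symm z v) := by
  have hd := (mdifferentiable_chart (I := 𝓡 n) x₀).mdifferentiableAt_symm hz
  have h := HasMFDerivAt.comp (I := 𝓡 n) (I' := 𝓡 n) (I'' := 𝓘(ℝ, ℝ)) z
    ((hφ.mdifferentiable (by simp)) _).hasMFDerivAt hd.hasMFDerivAt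
  have h2 := h.mfderiv
  rw [mfderiv_eq_fderiv] at h2
  exact congrArg (fun L => L v) h2

theorem differential_apply_eq_fderiv {φ : M → ℝ} (hφ : ContMDiff (𝓡 n) 𝓘(ℝ, ℝ) ∞ φ) (x₀ : M)
    {y : M} (hy : y ∈ (chartAt (EuclideanSpace ℝ (Fin n)) x₀).source)
    (ξ : TangentSpace (𝓡 n) y) :
    differential n φ y ξ = fderiv ℝ (φ ∘ (chartAt (EuclideanSpace ℝ (Fin n)) x₀).symm)
      (chartAt (EuclideanSpace ℝ (Fin n)) x₀ y)
        (mfderiv (𝓡 n) (𝓡 n) (chartAt (EuclideanSpace ℝ (Fin n)) x₀) y ξ) := by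
  set e := chartAt (EuclideanSpace ℝ (Fin n)) x₀
  have hd := (mdifferentiable_chart (I := 𝓡 n) x₀).mdifferentiableAt hy
  have hg : DifferentiableAt ℝ (φ ∘ e.symm) (e y) :=
    ((contDiffOn_comp_chart_symm hφ x₀).contDiffAt
      (e.open_target.mem_nhds (e.map_source hy))).differentiableAt (by simp)
  have h := HasMFDerivAt.comp (I := 𝓡 n) (I' := 𝓡 n) (I'' := 𝓘(ℝ, ℝ)) y
    hg.hasFDerivAt.hasMFDerivAt hd.hasMFDerivAt
  have h2 : φ =ᶠ[𝓝 y] (φ ∘ e.symm) ∘ e := by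
    filter_upwards [e.open_source.mem_nhds hy] with x hx
    simp [e.left_inv hx]
  exact congrArg (fun L => L ξ) (h2.mfderiv_eq.trans h.mfderiv)

theorem eventually_norm_differential_le {φ : M → ℝ} (hφ : ContMDiff (𝓡 n) 𝓘(ℝ, ℝ) ∞ φ) (x₀ : M) :
    ∃ C : ℝ, ∀ᶠ y in 𝓝 x₀, ‖differential n φ y‖ ≤ C := by
  obtain ⟨N, hNo, hx, hNs, C, hC, hN⟩ := exists_chart_bounds (n := n) x₀
  set e := chartAt (EuclideanSpace ℝ (Fin n)) x₀
  have h1 : ContinuousAt (fun y => ‖fderiv ℝ (φ ∘ e.symm) (e y)‖) x₀ := by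
    have h2 := ((contDiffOn_comp_chart_symm hφ x₀).contDiffAt (e.open_target.mem_nhds
      (e.map_source (mem_chart_source _ x₀)))).continuousAt_fderiv (by simp)
    exact (ContinuousAt.comp h2 (e.continuousAt (mem_chart_source _ x₀))).norm
  set A := ‖fderiv ℝ (φ ∘ e.symm) (e x₀)‖ + 1
  refine ⟨A * C, ?_⟩
  filter_upwards [h1.eventually_lt_const (lt_add_one _), hNo.mem_nhds hx] with y hy hyN
  refine ContinuousLinearMap.opNorm_le_bound _ (by positivity) fun ξ => ?_
  rw [differential_apply_eq_fderiv hφ x₀ (hNs hyN)]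
  calc _ ≤ ‖fderiv ℝ (φ ∘ e.symm) (e y)‖ * norm (E := EuclideanSpace ℝ (Fin n))
          (mfderiv (𝓡 n) (𝓡 n) e y ξ) := ContinuousLinearMap.le_opNorm _ _
    _ ≤ A * (C * ‖ξ‖) := mul_le_mul hy.le ((hN y hyN).1 ξ)
          (norm_nonneg (E := EuclideanSpace ℝ (Fin n)) _) (by positivity)
    _ = _ := by ring

theorem norm_differential_le_of_isCompact {φ : M → ℝ} (hφ : ContMDiff (𝓡 n) 𝓘(ℝ, ℝ) ∞ φ)
    {K : Set M} (hK : IsCompact K) : ∃ C : ℝ, ∀ y ∈ K, ‖differential n φ y‖ ≤ C := by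
  refine hK.induction_on (p := fun S => ∃ C : ℝ, ∀ y ∈ S, ‖differential n φ y‖ ≤ C)
    ⟨0, by simp⟩ (fun s t hst ⟨C, hC⟩ => ⟨C, fun y hy => hC y (hst hy)⟩)
    (fun s t ⟨C, hC⟩ ⟨D, hD⟩ => ⟨max C D, fun y hy => hy.elim
      (fun h => (hC y h).trans (le_max_left _ _)) fun h => (hD y h).trans (le_max_right _ _)⟩)
    fun x _ => ?_
  obtain ⟨C, hC⟩ := eventually_norm_differential_le hφ x
  exact ⟨_, mem_nhdsWithin_of_mem_nhds hC, C, fun y hy => hy⟩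

theorem differential_eq_zero_of_notMem_tsupport {φ : M → ℝ} {x : M} (hx : x ∉ tsupport φ) :
    differential n φ x = 0 := by
  have h : φ =ᶠ[𝓝 x] fun _ => (0 : ℝ) := notMem_tsupport_iff_eventuallyEq.1 hx
  exact h.mfderiv_eq.trans (mfderiv_const (c := (0 : ℝ)))

variable (n M) in
/-- `C^∞_c(M)` as a vector subspace of the space of all functions. -/
def testSubmodule : Submodule ℝ (M → ℝ) where
  carrier := testFunctions n M
  add_mem' hφ hψ := ⟨hφ.1.add hψ.1, hφ.2.add hψ.2⟩
  zero_mem' := ⟨contMDiff_const, HasCompactSupport.zero⟩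
  smul_mem' c _ hφ := ⟨(contDiff_const_smul (𝕜 := ℝ) (F := ℝ) (n := ∞) c).contMDiff.comp hφ.1,
    hφ.2.smul_left (f := fun _ => c)⟩

variable (n M) in
/-- The vector space `C^∞_c(M)`. -/
abbrev Test : Type _ := testSubmodule n M

theorem Test.contMDiff (φ : Test n M) : ContMDiff (𝓡 n) 𝓘(ℝ, ℝ) ∞ (φ : M → ℝ) := φ.2.1

theorem Test.mdifferentiable (φ : Test n M) : MDifferentiable (𝓡 n) 𝓘(ℝ, ℝ) (φ : M → ℝ) :=
  φ.contMDiff.mdifferentiable (by simp)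

theorem Test.continuous (φ : Test n M) : Continuous (φ : M → ℝ) := φ.contMDiff.continuous

theorem Test.hasCompactSupport (φ : Test n M) : HasCompactSupport (φ : M → ℝ) := φ.2.2

/-- The composition `F ∘ φ` of a test function with a smooth function vanishing at the origin. -/
def Test.comp (φ : Test n M) (F : ℝ → ℝ) (hF : ContDiff ℝ ∞ F) (h0 : F 0 = 0) : Test n M :=
  ⟨F ∘ φ, hF.contMDiff.comp φ.contMDiff, φ.hasCompactSupport.comp_left h0⟩

theorem Test.coe_comp (φ : Test n M) (F : ℝ → ℝ) (hF : ContDiff ℝ ∞ F) (h0 : F 0 = 0) :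
    (φ.comp F hF h0 : M → ℝ) = F ∘ φ := rfl

variable (μ : Measure M) [IsFiniteMeasureOnCompacts μ]

theorem Test.memLp (φ : Test n M) : MemLp (φ : M → ℝ) 2 μ :=
  φ.continuous.memLp_of_hasCompactSupport φ.hasCompactSupport

theorem Test.memLp_coords (φ : Test n M) : MemLp (coords (differential n (φ : M → ℝ))) 2 μ := by
  have hK := φ.hasCompactSupport.isCompact
  obtain ⟨C, hC⟩ := norm_differential_le_of_isCompact φ.contMDiff hK
  have hm : AEStronglyMeasurable (coords (differential n (φ : M → ℝ))) μ :=
    (isMeasurableForm_differential μ φ.contMDiff).aemeasurable_coords.aestronglyMeasurable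
  have h1 : MemLp (coords (differential n (φ : M → ℝ))) 2 (μ.restrict (tsupport (φ : M → ℝ))) := by
    have : IsFiniteMeasure (μ.restrict (tsupport (φ : M → ℝ))) :=
      ⟨by simpa using hK.measure_lt_top⟩
    refine MemLp.of_bound hm.restrict C ?_
    filter_upwards [ae_restrict_mem hK.measurableSet] with x hx
    rw [norm_coords]
    exact hC x hx
  rw [← memLp_indicator_iff_restrict hK.measurableSet] at h1
  convert h1 using 1
  funext x
  by_cases hx : x ∈ tsupport (φ : M → ℝ)
  · simp [hx]
  · rw [Set.indicator_of_notMem hx, ← norm_eq_zero, norm_coords,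
      differential_eq_zero_of_notMem_tsupport hx]
    exact norm_zero (E := TangentSpace (𝓡 n) x →L[ℝ] ℝ)

/-- The class of a test function in `L²(μ)`. -/
def Test.toL2 : Test n M →ₗ[ℝ] Lp ℝ 2 μ where
  toFun φ := (φ.memLp μ).toLp _
  map_add' φ ψ := (φ.memLp μ).toLp_add (ψ.memLp μ)
  map_smul' c φ := (φ.memLp μ).toLp_const_smul c

/-- The differential of a test function, as an element of the space `L²(μ; ℝⁿ)` to which the
square integrable `1`-forms are identified by the orthonormal frame `frame n M`. -/
def Test.d : Test n M →ₗ[ℝ] Lp (EuclideanSpace ℝ (Fin n)) 2 μ where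
  toFun φ := (φ.memLp_coords μ).toLp _
  map_add' φ ψ := by
    rw [← MemLp.toLp_add]
    congr 1
    funext x
    exact congrArg (fun θ => coords θ x) (differential_add φ.mdifferentiable ψ.mdifferentiable)
  map_smul' c φ := by
    rw [RingHom.id_apply, ← MemLp.toLp_const_smul]
    congr 1
    funext x
    exact congrArg (fun θ => coords θ x) (differential_const_smul c φ.mdifferentiable)

theorem Test.coeFn_toL2 (φ : Test n M) : φ.toL2 μ =ᵐ[μ] φ := (φ.memLp μ).coeFn_toLp

theorem Test.coeFn_d (φ : Test n M) : φ.d μ =ᵐ[μ] coords (differential n (φ : M → ℝ)) :=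
  (φ.memLp_coords μ).coeFn_toLp

theorem Test.coeFn_d_comp (φ : Test n M) {F : ℝ → ℝ} (hF : ContDiff ℝ ∞ F) (h0 : F 0 = 0) :
    (φ.comp F hF h0).d μ =ᵐ[μ] fun x => deriv F ((φ : M → ℝ) x) • φ.d μ x := by
  filter_upwards [(φ.comp F hF h0).coeFn_d μ, φ.coeFn_d μ] with x h1 h2
  rw [h1, h2]
  exact congrArg (fun l : TangentSpace (𝓡 n) x →L[ℝ] ℝ =>
    (WithLp.toLp 2 fun i => l (frame n M x i) : EuclideanSpace ℝ (Fin n)))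
    (differential_comp_real (hF.differentiable (by simp) _).hasDerivAt (φ.mdifferentiable x))

theorem Test.norm_d_comp_le (φ : Test n M) {F : ℝ → ℝ} (hF : ContDiff ℝ ∞ F) (h0 : F 0 = 0)
    {C : ℝ} (hC : ∀ s, |deriv F s| ≤ C) : ‖(φ.comp F hF h0).d μ‖ ≤ C * ‖φ.d μ‖ := by
  refine Lp.norm_le_mul_norm_of_ae_le_mul ?_
  filter_upwards [φ.coeFn_d_comp μ hF h0] with x hx
  rw [hx, norm_smul]
  exact mul_le_mul_of_nonneg_right (hC _) (norm_nonneg _)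

/-- The energy identity: pairing `dφ` with `d(F ∘ φ)` gives the energy of `G ∘ φ` if
`F' = G' ^ 2`. -/
theorem Test.inner_d_comp_eq (φ : Test n M) {F G : ℝ → ℝ} (hF : ContDiff ℝ ∞ F) (h0 : F 0 = 0)
    (hG : ContDiff ℝ ∞ G) (hG0 : G 0 = 0) (h : ∀ s, deriv F s = deriv G s ^ 2) :
    inner ℝ (φ.d μ) ((φ.comp F hF h0).d μ) = ‖(φ.comp G hG hG0).d μ‖ ^ 2 := by
  rw [← real_inner_self_eq_norm_sq, L2.inner_def, L2.inner_def]
  refine integral_congr_ae ?_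
  filter_upwards [φ.coeFn_d_comp μ hF h0, φ.coeFn_d_comp μ hG hG0] with x h1 h2
  rw [h1, h2, h, real_inner_smul_right, real_inner_smul_right, real_inner_smul_left]
  ring

/-- The form `⟨dφ, d(F ∘ φ)⟩ = F'(φ) |dφ|²` is nonnegative if `F` is increasing. This is the source
of the sub-Markov property. -/
theorem Test.inner_d_comp_nonneg (φ : Test n M) {F : ℝ → ℝ} (hF : ContDiff ℝ ∞ F) (h0 : F 0 = 0)
    (h : ∀ s, 0 ≤ deriv F s) : 0 ≤ inner ℝ (φ.d μ) ((φ.comp F hF h0).d μ) := by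
  rw [L2.inner_def]
  refine integral_nonneg_of_ae ?_
  filter_upwards [φ.coeFn_d_comp μ hF h0] with x h1
  rw [h1, real_inner_smul_right]
  exact mul_nonneg (h _) real_inner_self_nonneg

/-- If `0 ≤ F' ≤ 1`, replacing `φ` by `F ∘ φ` lowers the energy by at least the energy of the
difference. -/
theorem Test.norm_d_sub_comp_sq_add_le (φ : Test n M) {F : ℝ → ℝ} (hF : ContDiff ℝ ∞ F)
    (h0 : F 0 = 0) (h : ∀ s, 0 ≤ deriv F s) (h1 : ∀ s, deriv F s ≤ 1) :
    ‖φ.d μ - (φ.comp F hF h0).d μ‖ ^ 2 + ‖(φ.comp F hF h0).d μ‖ ^ 2 ≤ ‖φ.d μ‖ ^ 2 := by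
  have key : 0 ≤ inner ℝ ((φ.comp F hF h0).d μ) (φ.d μ - (φ.comp F hF h0).d μ) := by
    rw [L2.inner_def]
    refine integral_nonneg_of_ae ?_
    filter_upwards [φ.coeFn_d_comp μ hF h0, Lp.coeFn_sub (φ.d μ) ((φ.comp F hF h0).d μ)]
      with x h2 h3
    have h4 : φ.d μ x - deriv F ((φ : M → ℝ) x) • φ.d μ x =
        (1 - deriv F ((φ : M → ℝ) x)) • φ.d μ x := by rw [sub_smul, one_smul]
    rw [h3, Pi.sub_apply, h2, h4, real_inner_smul_right, real_inner_smul_left]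
    exact mul_nonneg (sub_nonneg.2 (h1 _)) (mul_nonneg (h _) real_inner_self_nonneg)
  have h5 := norm_add_sq_real ((φ.comp F hF h0).d μ) (φ.d μ - (φ.comp F hF h0).d μ)
  rw [add_sub_cancel] at h5
  linarith

theorem lintegral_enorm_sq_eq_eLpNorm_sq {X E : Type*} [MeasurableSpace X] [NormedAddCommGroup E]
    (ν : Measure X) (f : X → E) : ∫⁻ x, ‖f x‖ₑ ^ 2 ∂ν = eLpNorm f 2 ν ^ 2 := by
  rw [eLpNorm_eq_lintegral_rpow_enorm_toReal (by simp) (by simp), ← ENNReal.rpow_natCast,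
    ← ENNReal.rpow_mul]
  simp

theorem lintegral_enorm_sq_eq_ofReal {X E : Type*} [MeasurableSpace X] [NormedAddCommGroup E]
    {ν : Measure X} (f : Lp E 2 ν) : ∫⁻ x, ‖f x‖ₑ ^ 2 ∂ν = ENNReal.ofReal (‖f‖ ^ 2) := by
  rw [lintegral_enorm_sq_eq_eLpNorm_sq, ENNReal.ofReal_pow (norm_nonneg _), Lp.norm_def,
    ENNReal.ofReal_toReal (Lp.eLpNorm_ne_top f)]

theorem Test.formEnergy_eq (φ : Test n M) :
    formEnergy μ (differential n (φ : M → ℝ)) = ENNReal.ofReal (‖φ.d μ‖ ^ 2) := by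
  rw [WeightedManifold.formEnergy_eq, ← lintegral_enorm_sq_eq_ofReal]
  refine lintegral_congr_ae ?_
  filter_upwards [φ.coeFn_d μ] with x hx
  rw [hx]

/-! ### Closedness of the homogeneous Sobolev space -/

/-- Almost minimizers of the norm on a decreasing sequence of midpoint convex sets form a Cauchy
sequence, by the parallelogram identity. -/
theorem exists_tendsto_of_midpoint_convex {V H : Type*} [AddCommGroup V] [Module ℝ V]
    [NormedAddCommGroup H] [InnerProductSpace ℝ H] [CompleteSpace H] (d : V →ₗ[ℝ] H)
    {A : ℕ → Set V} (hA : Antitone A) (hmid : ∀ m, ∀ φ ∈ A m, ∀ ψ ∈ A m,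
      (1 / 2 : ℝ) • (φ + ψ) ∈ A m) {E : ℝ}
    (hE : ∀ m, ∀ ε > 0, ∃ φ ∈ A m, ‖d φ‖ ^ 2 ≤ E + ε) :
    ∃ φ : ℕ → V, (∀ m, φ m ∈ A m) ∧ ∃ h : H, Tendsto (fun m => d (φ m)) atTop (𝓝 h) ∧
      ‖h‖ ^ 2 ≤ E := by
  set S : ℕ → Set ℝ := fun m => (fun φ => ‖d φ‖ ^ 2) '' A m with hS
  set I : ℕ → ℝ := fun m => sInf (S m) with hI
  have hbdd : ∀ m, BddBelow (S m) := fun m => ⟨0, by rintro _ ⟨φ, -, rfl⟩; positivity⟩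
  have hne : ∀ m, (S m).Nonempty := fun m => by
    obtain ⟨φ, hφ, -⟩ := hE m 1 one_pos
    exact ⟨_, φ, hφ, rfl⟩
  have hle : ∀ m, ∀ φ ∈ A m, I m ≤ ‖d φ‖ ^ 2 := fun m φ hφ => csInf_le (hbdd m) ⟨φ, hφ, rfl⟩
  have hIE : ∀ m, I m ≤ E := fun m => le_of_forall_pos_le_add fun ε hε => by
    obtain ⟨φ, hφ, h⟩ := hE m ε hε
    exact (hle m φ hφ).trans h
  have hmono : Monotone I := fun m l hml => csInf_le_csInf (hbdd m) (hne l) (image_mono (hA hml))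
  have hex : ∀ m : ℕ, ∃ φ ∈ A m, ‖d φ‖ ^ 2 < I m + 1 / ((m : ℝ) + 1) := fun m => by
    obtain ⟨_, ⟨φ, hφ, rfl⟩, h⟩ := exists_lt_of_csInf_lt (hne m)
      (lt_add_of_pos_right (I m) (Nat.one_div_pos_of_nat (n := m) (α := ℝ)))
    exact ⟨φ, hφ, h⟩
  choose φ hφA hφ using hex
  obtain ⟨L, hL⟩ : ∃ L, Tendsto I atTop (𝓝 L) :=
    ⟨_, tendsto_atTop_ciSup hmono ⟨E, by rintro _ ⟨m, rfl⟩; exact hIE m⟩⟩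
  have hIL : ∀ m, I m ≤ L := fun m => hmono.ge_of_tendsto hL m
  -- `b m` bounds the squared distances to later terms: by the parallelogram identity and the
  -- midpoint convexity of `A m`, they are at most `2 (‖d φ_m‖² + ‖d φ_l‖²) - 4 I m`.
  set b : ℕ → ℝ := fun m => 2 * (L - I m) + 4 * (1 / ((m : ℝ) + 1)) with hb
  have hb0 : Tendsto b atTop (𝓝 0) := by
    have := ((tendsto_const_nhds (x := L)).sub hL).const_mul 2 |>.add
      ((tendsto_one_div_add_atTop_nhds_zero_nat (𝕜 := ℝ)).const_mul 4)
    simpa [hb] using this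
  have hdist : ∀ m l, m ≤ l → ‖d (φ m) - d (φ l)‖ ^ 2 ≤ b m := fun m l hml => by
    have h1 := hle m _ (hmid m _ (hφA m) _ (hA hml (hφA l)))
    rw [map_smul, map_add, norm_smul, mul_pow] at h1
    norm_num at h1
    have h2 := parallelogram_law_with_norm ℝ (d (φ m)) (d (φ l))
    have h3 := hφ m
    have h4 := hφ l
    have h5 : 1 / ((l : ℝ) + 1) ≤ 1 / ((m : ℝ) + 1) := Nat.one_div_le_one_div hml
    have h6 := hIL l
    simp only [hb]
    nlinarith
  have hanti : ∀ m l, m ≤ l → b l ≤ b m := fun m l hml => by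
    have h5 : 1 / ((l : ℝ) + 1) ≤ 1 / ((m : ℝ) + 1) := Nat.one_div_le_one_div hml
    have := hmono hml
    simp only [hb]
    linarith
  have hcauchy : CauchySeq fun m => d (φ m) := by
    refine cauchySeq_of_le_tendsto_0 (fun m => √(b m)) (fun p q N hp hq => ?_) ?_
    · rw [dist_eq_norm]
      refine Real.le_sqrt_of_sq_le ?_
      rcases le_total p q with h | h
      · exact (hdist p q h).trans (hanti N p hp)
      · rw [norm_sub_rev]
        exact (hdist q p h).trans (hanti N q hq)
    · simpa using hb0.sqrt
  obtain ⟨h, hh⟩ := cauchySeq_tendsto_of_complete hcauchy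
  refine ⟨φ, hφA, h, hh, ?_⟩
  refine le_of_tendsto_of_tendsto (hh.norm.pow 2)
    ((tendsto_const_nhds (x := E)).add (tendsto_one_div_add_atTop_nhds_zero_nat (𝕜 := ℝ)))
    (Eventually.of_forall fun m => ?_) |>.trans (by simp)
  exact (hφ m).le.trans (add_le_add_left (hIE m) _)

theorem Test.formEnergy_sub_ofCoords (φ : Test n M) (η : Lp (EuclideanSpace ℝ (Fin n)) 2 μ) :
    formEnergy μ (differential n (φ : M → ℝ) - ofCoords η) =
      ENNReal.ofReal (‖φ.d μ - η‖ ^ 2) := by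
  rw [WeightedManifold.formEnergy_eq, ← lintegral_enorm_sq_eq_ofReal]
  refine lintegral_congr_ae ?_
  filter_upwards [φ.coeFn_d μ, Lp.coeFn_sub (φ.d μ) η] with x hx h2
  rw [h2, Pi.sub_apply, hx, coords_sub, coords_ofCoords]

/-- `u` is a limit in `L²_loc` of test functions whose energies are asymptotically at most `E`. -/
def Approximable (n : ℕ) {M : Type*} [MetricSpace M]
    [ChartedSpace (EuclideanSpace ℝ (Fin n)) M]
    [IsManifold (𝓡 n) ∞ M] [RiemannianBundle (fun x : M => TangentSpace (𝓡 n) x)]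
    [IsContMDiffRiemannianBundle (𝓡 n) ∞ (EuclideanSpace ℝ (Fin n))
      (fun x : M => TangentSpace (𝓡 n) x)]
    [SecondCountableTopology M] [MeasurableSpace M] [BorelSpace M]
    (μ : Measure M) [IsFiniteMeasureOnCompacts μ] (u : M → ℝ) (E : ℝ) : Prop :=
  ∀ K : Set M, IsCompact K → ∀ ε : ℝ, 0 < ε → ∃ φ : Test n M,
    ∫⁻ x in K, ‖(φ : M → ℝ) x - u x‖ₑ ^ 2 ∂μ ≤ ENNReal.ofReal ε ∧ ‖φ.d μ‖ ^ 2 ≤ E + ε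

/-- Convexity of the squared distance to `c`. -/
theorem enorm_half_sub_sq_le (a b c : ℝ) :
    ‖(1 / 2 : ℝ) * (a + b) - c‖ₑ ^ 2 ≤ 2⁻¹ * (‖a - c‖ₑ ^ 2 + ‖b - c‖ₑ ^ 2) := by
  have h : ∀ t : ℝ, ‖t‖ₑ ^ 2 = ENNReal.ofReal (t ^ 2) := fun t => by
    rw [← ofReal_norm, ← ENNReal.ofReal_pow (norm_nonneg _), Real.norm_eq_abs, sq_abs]
  rw [h, h, h, ← ENNReal.ofReal_add (by positivity) (by positivity)]
  have : (2⁻¹ : ℝ≥0∞) = ENNReal.ofReal 2⁻¹ := by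
    rw [ENNReal.ofReal_inv_of_pos two_pos]; simp
  rw [this, ← ENNReal.ofReal_mul (by norm_num)]
  refine ENNReal.ofReal_le_ofReal ?_
  nlinarith [sq_nonneg (a - b)]

/-- The homogeneous Sobolev space is closed under `L²_loc` limits with bounded energy, and the
energy is lower semicontinuous. Weak compactness is replaced by midpoint convexity: the test
functions close to `u` on a large compact set form a midpoint convex set, and almost minimizers of
the energy on these sets have strongly converging differentials. -/
theorem Approximable.exists_hasHomDifferential {u : M → ℝ} {E : ℝ} (hu : AEMeasurable u μ)
    (h : Approximable n μ u E) :
    ∃ θ : CovectorField n M, HasHomDifferential μ u θ ∧ formEnergy μ θ ≤ ENNReal.ofReal E := by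
  have : LocallyCompactSpace M := ChartedSpace.locallyCompactSpace (EuclideanSpace ℝ (Fin n)) M
  let K : CompactExhaustion M := default
  let A : ℕ → Set (Test n M) := fun m =>
    {φ | ∫⁻ x in K m, ‖(φ : M → ℝ) x - u x‖ₑ ^ 2 ∂μ ≤ ENNReal.ofReal (1 / ((m : ℝ) + 1))}
  have hA : Antitone A := fun m l hml φ hφ =>
    (lintegral_mono_set (K.subset hml)).trans (le_trans hφ
      (ENNReal.ofReal_le_ofReal (Nat.one_div_le_one_div hml)))
  have hmid : ∀ m, ∀ φ ∈ A m, ∀ ψ ∈ A m, (1 / 2 : ℝ) • (φ + ψ) ∈ A m := by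
    intro m φ hφ ψ hψ
    have hm : AEMeasurable (fun x => ‖(φ : M → ℝ) x - u x‖ₑ ^ 2) (μ.restrict (K m)) :=
      ((φ.continuous.measurable.aemeasurable.sub hu.restrict).enorm.pow_const 2)
    calc ∫⁻ x in K m, ‖(1 / 2 : ℝ) * ((φ : M → ℝ) x + (ψ : M → ℝ) x) - u x‖ₑ ^ 2 ∂μ
        ≤ ∫⁻ x in K m, 2⁻¹ * (‖(φ : M → ℝ) x - u x‖ₑ ^ 2 + ‖(ψ : M → ℝ) x - u x‖ₑ ^ 2) ∂μ :=
          lintegral_mono fun x => enorm_half_sub_sq_le _ _ _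
      _ = 2⁻¹ * (∫⁻ x in K m, ‖(φ : M → ℝ) x - u x‖ₑ ^ 2 ∂μ +
            ∫⁻ x in K m, ‖(ψ : M → ℝ) x - u x‖ₑ ^ 2 ∂μ) := by
          rw [lintegral_const_mul' _ _ (by simp), lintegral_add_left' hm]
      _ ≤ 2⁻¹ * (ENNReal.ofReal (1 / ((m : ℝ) + 1)) + ENNReal.ofReal (1 / ((m : ℝ) + 1))) := by
          gcongr
          · exact hφ
          · exact hψ
      _ = _ := by
          rw [← two_mul, ← mul_assoc, ENNReal.inv_mul_cancel (by simp) (by simp), one_mul]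
  obtain ⟨φ, hφ, η, hη, hηE⟩ := exists_tendsto_of_midpoint_convex (Test.d μ) hA hmid (E := E) (by
    intro m ε hε
    have hm : 0 < 1 / ((m : ℝ) + 1) := Nat.one_div_pos_of_nat
    obtain ⟨φ, h1, h2⟩ := h (K m) (K.isCompact m) (min ε (1 / ((m : ℝ) + 1))) (lt_min hε hm)
    exact ⟨φ, h1.trans (ENNReal.ofReal_le_ofReal (min_le_right _ _)),
      h2.trans (by gcongr; exact min_le_left _ _)⟩)
  refine ⟨ofCoords η, ⟨hu, isMeasurableForm_ofCoords (Lp.aestronglyMeasurable η).aemeasurable,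
    fun k => φ k, fun k => (φ k).2, ?_, fun C hC => ?_⟩, ?_⟩
  · simp_rw [Test.formEnergy_sub_ofCoords μ]
    have := ((hη.sub_const η).norm.pow 2)
    simp only [sub_self, norm_zero] at this
    simpa using ENNReal.tendsto_ofReal this
  · obtain ⟨m, hm⟩ := K.exists_superset_of_isCompact hC
    have h0 : Tendsto (fun k : ℕ => ENNReal.ofReal (1 / ((k : ℝ) + 1))) atTop (𝓝 0) := by
      simpa using ENNReal.tendsto_ofReal (tendsto_one_div_add_atTop_nhds_zero_nat (𝕜 := ℝ))
    refine tendsto_of_tendsto_of_tendsto_of_le_of_le' tendsto_const_nhds h0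
      (Eventually.of_forall fun _ => zero_le) ?_
    filter_upwards [eventually_ge_atTop m] with k hk
    exact (lintegral_mono_set (hm.trans (K.subset hk))).trans (hφ k)
  · rw [formEnergy_eq, coords_ofCoords, lintegral_enorm_sq_eq_ofReal]
    exact ENNReal.ofReal_le_ofReal hηE

/-! ### Smooth approximations of `s ^ τ` -/

section Profile

/-- A smooth approximation of the indicator function of `(-1, 1)`, supported in `[-1, 1]`. -/
def cutoff (i : ℕ) : ContDiffBump (0 : ℝ) where
  rIn := 1 - 1 / ((i : ℝ) + 2)
  rOut := 1
  rIn_pos := by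
    have : 1 / ((i : ℝ) + 2) < 1 := by
      rw [div_lt_one (by positivity)]
      have : (0 : ℝ) ≤ i := i.cast_nonneg
      linarith
    linarith
  rIn_lt_rOut := by
    have : 0 < 1 / ((i : ℝ) + 2) := by positivity
    linarith

theorem tendsto_cutoff {t : ℝ} (ht : t ∈ Ioo (0 : ℝ) 1) :
    ∀ᶠ i in atTop, cutoff i t = 1 := by
  have h : Tendsto (fun i : ℕ => 1 - 1 / ((i : ℝ) + 2)) atTop (𝓝 (1 - 0)) := by
    refine tendsto_const_nhds.sub ?_
    have := (tendsto_one_div_add_atTop_nhds_zero_nat (𝕜 := ℝ)).comp (tendsto_add_atTop_nat 1)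
    refine this.congr fun i => ?_
    simp only [Function.comp_apply, Nat.cast_add, Nat.cast_one]
    ring_nf
  rw [sub_zero] at h
  filter_upwards [h.eventually_const_lt ht.2] with i hi
  refine (cutoff i).one_of_mem_closedBall ?_
  simp only [Metric.mem_closedBall, dist_zero_right, Real.norm_eq_abs, abs_of_pos ht.1]
  exact hi.le

theorem cutoff_eq_zero {i : ℕ} {t : ℝ} (ht : 1 ≤ t) : cutoff i t = 0 := by
  refine (cutoff i).zero_of_le_dist ?_
  simp only [dist_zero_right, Real.norm_eq_abs]
  exact ht.trans (le_abs_self t)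

/-- A smooth positive approximation of `t ↦ |t| ^ a`. -/
def regPow (a : ℝ) (i : ℕ) (t : ℝ) : ℝ := (t ^ 2 + (1 / ((i : ℝ) + 1)) ^ 2) ^ (a / 2)

theorem regPow_base_pos (i : ℕ) (t : ℝ) : 0 < t ^ 2 + (1 / ((i : ℝ) + 1)) ^ 2 := by positivity

theorem regPow_pos (a : ℝ) (i : ℕ) (t : ℝ) : 0 < regPow a i t :=
  Real.rpow_pos_of_pos (regPow_base_pos i t) _

theorem contDiff_regPow (a : ℝ) (i : ℕ) : ContDiff ℝ ∞ (regPow a i) :=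
  ContDiff.rpow_const_of_ne (by fun_prop) fun t => (regPow_base_pos i t).ne'

theorem regPow_sq (a : ℝ) (i : ℕ) (t : ℝ) : regPow a i t ^ 2 = regPow (2 * a) i t := by
  rw [regPow, regPow, ← Real.rpow_natCast, ← Real.rpow_mul (regPow_base_pos i t).le]
  congr 1
  push_cast
  ring

theorem tendsto_regPow (a : ℝ) {t : ℝ} (ht : 0 < t) :
    Tendsto (fun i => regPow a i t) atTop (𝓝 (t ^ a)) := by
  have h : Tendsto (fun i : ℕ => t ^ 2 + (1 / ((i : ℝ) + 1)) ^ 2) atTop (𝓝 (t ^ 2 + 0 ^ 2)) :=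
    tendsto_const_nhds.add ((tendsto_one_div_add_atTop_nhds_zero_nat (𝕜 := ℝ)).pow 2)
  have h2 := h.rpow_const (p := a / 2) (Or.inl (by positivity))
  have h3 : (t ^ 2 + 0 ^ 2) ^ (a / 2) = t ^ a := by
    rw [zero_pow two_ne_zero, add_zero, ← Real.rpow_natCast, ← Real.rpow_mul ht.le]
    congr 1
    push_cast
    ring
  rwa [h3] at h2

/-- A bound independent of the regularization parameter, integrable on `(0, 1]` if `-1 < a`. -/
theorem regPow_le (a : ℝ) (i : ℕ) {t : ℝ} (ht : 0 < t) (ht1 : t ≤ 1) :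
    regPow a i t ≤ t ^ a + 2 ^ (a / 2) := by
  have h1 : t ^ a = (t ^ 2) ^ (a / 2) := by
    rw [← Real.rpow_natCast, ← Real.rpow_mul ht.le]
    congr 1
    push_cast
    ring
  have h2 : 0 < t ^ a := Real.rpow_pos_of_pos ht _
  have h3 : (0 : ℝ) < 2 ^ (a / 2) := by positivity
  rcases le_total 0 a with ha | ha
  · have : regPow a i t ≤ 2 ^ (a / 2) := by
      refine Real.rpow_le_rpow (regPow_base_pos i t).le ?_ (by positivity)
      have h4 : 1 / ((i : ℝ) + 1) ≤ 1 := by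
        rw [div_le_one (by positivity)]
        linarith [(i.cast_nonneg : (0 : ℝ) ≤ i)]
      have h5 : 0 ≤ 1 / ((i : ℝ) + 1) := by positivity
      nlinarith
    linarith
  · have : regPow a i t ≤ t ^ a := by
      rw [h1]
      refine Real.rpow_le_rpow_of_nonpos (by positivity) ?_ (by linarith)
      have : 0 ≤ (1 / ((i : ℝ) + 1)) ^ 2 := by positivity
      linarith
    linarith

/-- The primitives of the regularized and truncated powers converge to those of the power, as the
exponent `a > -1` makes it integrable at the origin. -/
theorem tendsto_integral_regPow {a : ℝ} (ha : -1 < a) (k : ℕ) {s : ℝ}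
    (hs : 0 ≤ s) (hs1 : s ≤ 1) :
    Tendsto (fun i => ∫ t in (0 : ℝ)..s, regPow a i t * cutoff i t ^ k) atTop
      (𝓝 (s ^ (a + 1) / (a + 1))) := by
  have h1 : ∫ t in (0 : ℝ)..s, t ^ a = s ^ (a + 1) / (a + 1) := by
    rw [integral_rpow (Or.inl ha), Real.zero_rpow (by linarith), sub_zero]
  rw [← h1]
  have hI : IntervalIntegrable (fun t : ℝ => t ^ a + 2 ^ (a / 2)) volume 0 s :=
    (intervalIntegral.intervalIntegrable_rpow' ha).add intervalIntegrable_const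
  refine intervalIntegral.tendsto_integral_filter_of_dominated_convergence _
    (Eventually.of_forall fun i => ?_) (Eventually.of_forall fun i => ?_) hI ?_
  · exact ((contDiff_regPow a i).continuous.mul
      ((cutoff i).continuous.pow k)).aestronglyMeasurable
  · refine Eventually.of_forall fun t ht => ?_
    rw [uIoc_of_le hs] at ht
    rw [Real.norm_of_nonneg (mul_nonneg (regPow_pos a i t).le (pow_nonneg (cutoff i).nonneg k))]
    calc _ ≤ regPow a i t * 1 := by
          gcongr
          · exact (regPow_pos a i t).le
          · exact pow_le_one₀ (cutoff i).nonneg (cutoff i).le_one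
      _ ≤ _ := by
          rw [mul_one]
          exact regPow_le a i ht.1 (ht.2.trans hs1)
  · have : ∀ᵐ t : ℝ, t ≠ 1 := by simp [ae_iff, measure_singleton]
    filter_upwards [this] with t ht1 ht
    rw [uIoc_of_le hs] at ht
    have ht' : t ∈ Ioo (0 : ℝ) 1 := ⟨ht.1, lt_of_le_of_ne (ht.2.trans hs1) ht1⟩
    refine (tendsto_regPow a ht.1).congr' ?_
    filter_upwards [tendsto_cutoff ht'] with i hi
    rw [hi, one_pow, mul_one]

theorem contDiff_integral {f : ℝ → ℝ} (hf : ContDiff ℝ ∞ f) :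
    ContDiff ℝ ∞ (fun s => ∫ t in (0 : ℝ)..s, f t) ∧
      deriv (fun s => ∫ t in (0 : ℝ)..s, f t) = f := by
  have h : ∀ s, HasDerivAt (fun s => ∫ t in (0 : ℝ)..s, f t) (f s) s := fun s =>
    hf.continuous.integral_hasStrictDerivAt 0 s |>.hasDerivAt
  have hd : deriv (fun s => ∫ t in (0 : ℝ)..s, f t) = f := funext fun s => (h s).deriv
  exact ⟨contDiff_infty_iff_deriv.2 ⟨fun s => (h s).differentiableAt, by rw [hd]; exact hf⟩, hd⟩

/-- Smooth functions `H i` converging to `s ^ τ` on `[0, 1]` and constant on `[1, ∞)`, together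
with the primitives `F i` of `(H i)' ^ 2`. The bound `1 / 2 < τ` makes the square of the derivative
of `s ^ τ` integrable near the origin, so that `F i 1` converges to
`∫₀¹ (τ s ^ (τ - 1)) ^ 2 ds = τ ^ 2 / (2 τ - 1)`. -/
theorem exists_powerProfile {τ : ℝ} (hτ : 1 / 2 < τ) :
    ∃ H F : ℕ → ℝ → ℝ,
      (∀ i, ContDiff ℝ ∞ (H i) ∧ H i 0 = 0) ∧ (∀ i, ContDiff ℝ ∞ (F i) ∧ F i 0 = 0) ∧
      (∀ i s, deriv (F i) s = deriv (H i) s ^ 2) ∧ (∀ i s, 0 ≤ deriv (H i) s) ∧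
      (∀ i, ∃ C, ∀ s, |deriv (H i) s| ≤ C) ∧
      (∀ i s, 1 ≤ s → H i s = H i 1 ∧ F i s = F i 1) ∧
      Tendsto (fun i => F i 1) atTop (𝓝 (τ ^ 2 / (2 * τ - 1))) ∧
      ∀ s, 0 ≤ s → s ≤ 1 → Tendsto (fun i => H i s) atTop (𝓝 (s ^ τ)) := by
  have hτ0 : 0 < τ := by linarith
  -- a smooth approximation of the derivative of `s ^ τ` on `(0, 1)`, vanishing beyond `1`
  let ψ : ℕ → ℝ → ℝ := fun i t => τ * (regPow (τ - 1) i t * cutoff i t)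
  have hψ : ∀ i, ContDiff ℝ ∞ (ψ i) := fun i =>
    contDiff_const.mul ((contDiff_regPow _ i).mul (cutoff i).contDiff)
  have hψ2 : ∀ i t, ψ i t ^ 2 = τ ^ 2 * (regPow (2 * (τ - 1)) i t * cutoff i t ^ 2) := fun i t => by
    rw [← regPow_sq]; ring
  have hψ0 : ∀ i t, 0 ≤ ψ i t := fun i t =>
    mul_nonneg hτ0.le (mul_nonneg (regPow_pos _ _ _).le (cutoff i).nonneg)
  have hψ1 : ∀ i t, 1 ≤ t → ψ i t = 0 := fun i t ht => by simp [ψ, cutoff_eq_zero ht]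
  have hsq : ∀ i, ContDiff ℝ ∞ (fun t => ψ i t ^ 2) := fun i => (hψ i).pow 2
  have hconst : ∀ f : ℝ → ℝ, Continuous f → (∀ t, 1 ≤ t → f t = 0) → ∀ s, 1 ≤ s →
      ∫ t in (0 : ℝ)..s, f t = ∫ t in (0 : ℝ)..1, f t := fun f hf h s hs => by
    rw [← intervalIntegral.integral_add_adjacent_intervals (hf.intervalIntegrable 0 1)
      (hf.intervalIntegrable 1 s), add_eq_left]
    refine (intervalIntegral.integral_congr fun t ht => ?_).trans intervalIntegral.integral_zero
    rw [uIcc_of_le hs] at ht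
    exact h t ht.1
  refine ⟨fun i s => ∫ t in (0 : ℝ)..s, ψ i t, fun i s => ∫ t in (0 : ℝ)..s, ψ i t ^ 2,
    fun i => ⟨(contDiff_integral (hψ i)).1, by simp⟩,
    fun i => ⟨(contDiff_integral (hsq i)).1, by simp⟩, fun i s => ?_, fun i s => ?_, fun i => ?_,
    fun i s hs => ⟨?_, ?_⟩, ?_, fun s hs hs1 => ?_⟩
  · rw [(contDiff_integral (hψ i)).2, (contDiff_integral (hsq i)).2]
  · rw [(contDiff_integral (hψ i)).2]
    exact hψ0 i s
  · rw [(contDiff_integral (hψ i)).2]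
    have hc : HasCompactSupport (ψ i) :=
      ((cutoff i).hasCompactSupport.mul_left (f := regPow (τ - 1) i)).mul_left (f := fun _ => τ)
    exact (hψ i).continuous.bounded_above_of_compact_support hc
  · exact hconst _ (hψ i).continuous (hψ1 i) s hs
  · exact hconst _ (hsq i).continuous (fun t ht => by rw [hψ1 i t ht, zero_pow two_ne_zero]) s hs
  · simp_rw [hψ2, intervalIntegral.integral_const_mul]
    have := (tendsto_integral_regPow (a := 2 * (τ - 1)) (by linarith) 2 zero_le_one
      le_rfl).const_mul (τ ^ 2)
    convert this using 2
    rw [Real.one_rpow]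
    ring_nf
  · simp_rw [ψ, intervalIntegral.integral_const_mul]
    have := (tendsto_integral_regPow (a := τ - 1) (by linarith) 1 hs hs1).const_mul τ
    simp only [pow_one, sub_add_cancel] at this
    rwa [mul_div_cancel₀ _ hτ0.ne'] at this

end Profile

/-! ### Functions on Euclidean balls with vanishing derivative -/

section Euclidean

variable {E : Type*} [NormedAddCommGroup E] [NormedSpace ℝ E] [FiniteDimensional ℝ E]
  [MeasurableSpace E] [BorelSpace E] {ν : Measure E} [ν.IsAddHaarMeasure]

/-- Translating the ball of radius `r` by less than `r` keeps it in the ball of radius `2 r`. -/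
theorem setLIntegral_ball_add_le (g : E → ℝ≥0∞) {z₀ z : E} {r : ℝ} (hz : ‖z‖ < r) :
    ∫⁻ x in Metric.ball z₀ r, g (x + z) ∂ν ≤ ∫⁻ x in Metric.ball z₀ (2 * r), g x ∂ν := by
  rw [← lintegral_indicator measurableSet_ball, ← lintegral_indicator measurableSet_ball]
  refine (lintegral_mono fun x => ?_).trans_eq
    (lintegral_add_right_eq_self ((Metric.ball z₀ (2 * r)).indicator g) z)
  by_cases hx : x ∈ Metric.ball z₀ r
  · have hxz : x + z ∈ Metric.ball z₀ (2 * r) := by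
      rw [mem_ball_iff_norm] at hx ⊢
      calc ‖x + z - z₀‖ = ‖(x - z₀) + z‖ := by congr 1; abel
        _ ≤ ‖x - z₀‖ + ‖z‖ := norm_add_le _ _
        _ < 2 * r := by linarith
    rw [indicator_of_mem hx, indicator_of_mem hxz]
  · rw [indicator_of_notMem hx]
    exact zero_le

/-- The `L¹` distance of a `C¹` function to its translate by `z` is at most `‖z‖` times the
`L¹` norm of its derivative. -/
theorem lintegral_enorm_translate_sub_le {w : E → ℝ} {z₀ z : E} {r : ℝ} (hz : ‖z‖ < r)
    (hw : ContDiffOn ℝ 1 w (Metric.ball z₀ (2 * r))) :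
    ∫⁻ x in Metric.ball z₀ r, ‖w (x + z) - w x‖ₑ ∂ν ≤
      ‖z‖ₑ * ∫⁻ x in Metric.ball z₀ (2 * r), ‖fderiv ℝ w x‖ₑ ∂ν := by
  have hmem : ∀ x ∈ Metric.ball z₀ r, ∀ t ∈ Icc (0 : ℝ) 1,
      x + t • z ∈ Metric.ball z₀ (2 * r) := fun x hx t ht => by
    rw [mem_ball_iff_norm] at hx ⊢
    calc ‖x + t • z - z₀‖ = ‖(x - z₀) + t • z‖ := by congr 1; abel
      _ ≤ ‖x - z₀‖ + ‖t • z‖ := norm_add_le _ _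
      _ ≤ ‖x - z₀‖ + 1 * ‖z‖ := by
          rw [norm_smul, Real.norm_of_nonneg ht.1]
          gcongr
          exact ht.2
      _ < 2 * r := by linarith
  have hder : ∀ x ∈ Metric.ball z₀ r, ‖w (x + z) - w x‖ₑ ≤
      ∫⁻ t in Icc (0 : ℝ) 1, ‖z‖ₑ * ‖fderiv ℝ w (x + t • z)‖ₑ := fun x hx => by
    have hg : ContDiffOn ℝ 1 (fun t : ℝ => w (x + t • z)) (Icc 0 1) :=
      hw.comp (by fun_prop) fun t ht => hmem x hx t ht
    have h1 := enorm_sub_le_lintegral_deriv_of_contDiffOn_Icc hg zero_le_one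
    simp only [one_smul, zero_smul, add_zero] at h1
    refine h1.trans (setLIntegral_mono' measurableSet_Icc fun t ht => ?_)
    have h2 : HasDerivAt (fun t : ℝ => x + t • z) z t := by
      simpa using ((hasDerivAt_id t).smul_const z).const_add x
    have h3 : HasFDerivAt w (fderiv ℝ w (x + t • z)) (x + t • z) :=
      ((hw.contDiffAt (Metric.isOpen_ball.mem_nhds (hmem x hx t ht))).differentiableAt
        one_ne_zero).hasFDerivAt
    have h4 := (h3.comp_hasDerivAt t h2).deriv
    simp only [Function.comp_def] at h4
    rw [h4, mul_comm]
    exact ContinuousLinearMap.le_opENorm _ _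
  have hmeas : Measurable (Function.uncurry fun (x : E) (t : ℝ) =>
      ‖z‖ₑ * ‖fderiv ℝ w (x + t • z)‖ₑ) := by
    have h1 : Measurable fun p : E × ℝ => p.1 + p.2 • z := by fun_prop
    exact (((measurable_fderiv ℝ w).comp h1).enorm).const_mul _
  calc ∫⁻ x in Metric.ball z₀ r, ‖w (x + z) - w x‖ₑ ∂ν
      ≤ ∫⁻ x in Metric.ball z₀ r, (∫⁻ t in Icc (0 : ℝ) 1,
          ‖z‖ₑ * ‖fderiv ℝ w (x + t • z)‖ₑ) ∂ν := setLIntegral_mono' measurableSet_ball hder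
    _ = ∫⁻ t in Icc (0 : ℝ) 1, ∫⁻ x in Metric.ball z₀ r,
          ‖z‖ₑ * ‖fderiv ℝ w (x + t • z)‖ₑ ∂ν := lintegral_lintegral_swap hmeas.aemeasurable
    _ ≤ ∫⁻ t in Icc (0 : ℝ) 1, ‖z‖ₑ * ∫⁻ x in Metric.ball z₀ (2 * r), ‖fderiv ℝ w x‖ₑ ∂ν := by
          refine setLIntegral_mono' measurableSet_Icc fun t ht => ?_
          rw [lintegral_const_mul' _ _ (by simp)]
          gcongr 1
          refine setLIntegral_ball_add_le (fun x => ‖fderiv ℝ w x‖ₑ) ?_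
          rw [norm_smul, Real.norm_of_nonneg ht.1]
          exact (mul_le_of_le_one_left (norm_nonneg _) ht.2).trans_lt hz
    _ = _ := by simp

/-- An `L¹` limit of `C¹` functions whose derivatives tend to `0` in `L¹` is almost everywhere
equal to a constant, on a smaller ball. -/
theorem ae_eq_const_of_tendsto_fderiv {w : ℕ → E → ℝ} {v : E → ℝ} {z₀ : E} {r : ℝ} (hr : 0 < r)
    (hw : ∀ k, ContDiffOn ℝ 1 (w k) (Metric.ball z₀ (2 * r))) (hwm : ∀ k, Measurable (w k))
    (hv : Measurable v)
    (hd : Tendsto (fun k => ∫⁻ x in Metric.ball z₀ (2 * r), ‖fderiv ℝ (w k) x‖ₑ ∂ν) atTop (𝓝 0))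
    (hwv : Tendsto (fun k => ∫⁻ x in Metric.ball z₀ (2 * r), ‖w k x - v x‖ₑ ∂ν) atTop (𝓝 0)) :
    ∃ c : ℝ, ∀ᵐ y ∂ν.restrict (Metric.ball z₀ (r / 2)), v y = c := by
  have htr : ∀ z : E, ‖z‖ < r → ∫⁻ x in Metric.ball z₀ r, ‖v (x + z) - v x‖ₑ ∂ν = 0 := by
    intro z hz
    have hle : ∀ k, ∫⁻ x in Metric.ball z₀ r, ‖v (x + z) - v x‖ₑ ∂ν ≤
        (∫⁻ x in Metric.ball z₀ (2 * r), ‖w k x - v x‖ₑ ∂ν +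
          ‖z‖ₑ * ∫⁻ x in Metric.ball z₀ (2 * r), ‖fderiv ℝ (w k) x‖ₑ ∂ν) +
          ∫⁻ x in Metric.ball z₀ (2 * r), ‖w k x - v x‖ₑ ∂ν := fun k => by
      have hm1 : Measurable fun x => ‖w k (x + z) - v (x + z)‖ₑ :=
        (((hwm k).sub hv).enorm).comp (measurable_id.add_const z)
      have hm2 : Measurable fun x => ‖w k (x + z) - w k x‖ₑ :=
        (((hwm k).comp (measurable_id.add_const z)).sub (hwm k)).enorm
      calc ∫⁻ x in Metric.ball z₀ r, ‖v (x + z) - v x‖ₑ ∂ν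
          ≤ ∫⁻ x in Metric.ball z₀ r, (‖w k (x + z) - v (x + z)‖ₑ + ‖w k (x + z) - w k x‖ₑ +
              ‖w k x - v x‖ₑ) ∂ν := by
            refine lintegral_mono fun x => ?_
            have : v (x + z) - v x = -(w k (x + z) - v (x + z)) + (w k (x + z) - w k x) +
              (w k x - v x) := by ring
            rw [this]
            refine (enorm_add_le _ _).trans ?_
            gcongr
            refine (enorm_add_le _ _).trans ?_
            rw [enorm_neg]
        _ ≤ _ := by
            have hm12 : Measurable fun x =>
              ‖w k (x + z) - v (x + z)‖ₑ + ‖w k (x + z) - w k x‖ₑ := hm1.add hm2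
            rw [lintegral_add_left hm12, lintegral_add_left hm1]
            gcongr ?_ + ?_ + ?_
            · exact setLIntegral_ball_add_le (fun x => ‖w k x - v x‖ₑ) hz
            · exact lintegral_enorm_translate_sub_le hz (hw k)
            · refine lintegral_mono_set (Metric.ball_subset_ball (by linarith))
    have hlim := (hwv.add (ENNReal.Tendsto.const_mul hd (Or.inr (enorm_ne_top (x := z))))).add hwv
    rw [mul_zero, add_zero, add_zero] at hlim
    exact le_antisymm (ge_of_tendsto' hlim hle) zero_le
  -- Integrating over `z` first and exchanging the order of integration, almost every `x` satisfies
  -- `v (x + z) = v x` for almost every small `z`; one such `x` gives the constant `v x`.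
  have hmeas : Measurable (Function.uncurry fun (x z : E) => ‖v (x + z) - v x‖ₑ) :=
    ((hv.comp (measurable_fst.add measurable_snd)).sub (hv.comp measurable_fst)).enorm
  have hzero : ∫⁻ x in Metric.ball z₀ r, ∫⁻ z in Metric.ball 0 r, ‖v (x + z) - v x‖ₑ ∂ν ∂ν = 0 := by
    rw [lintegral_lintegral_swap hmeas.aemeasurable]
    refine (setLIntegral_congr_fun measurableSet_ball fun z hz => ?_).trans lintegral_zero
    exact htr z (by simpa using hz)
  rw [lintegral_eq_zero_iff hmeas.lintegral_prod_right] at hzero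
  have hzero' : ∀ᵐ x ∂ν.restrict (Metric.ball z₀ (r / 2)),
      ∫⁻ z in Metric.ball 0 r, ‖v (x + z) - v x‖ₑ ∂ν = 0 :=
    ae_restrict_of_ae_restrict_of_subset (Metric.ball_subset_ball (by linarith)) hzero
  have hne : (ae (ν.restrict (Metric.ball z₀ (r / 2)))).NeBot := by
    rw [ae_neBot, Ne, Measure.restrict_eq_zero]
    exact (Metric.measure_ball_pos ν z₀ (by linarith)).ne'
  obtain ⟨x, hx, hxb⟩ := (hzero'.and (ae_restrict_mem measurableSet_ball)).exists
  refine ⟨v x, ?_⟩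
  have hmx : Measurable fun z => ‖v (x + z) - v x‖ₑ :=
    ((hv.comp (measurable_const.add measurable_id)).sub_const _).enorm
  have h2 : ∫⁻ y in Metric.ball z₀ (r / 2), ‖v y - v x‖ₑ ∂ν = 0 := by
    refine le_antisymm ?_ zero_le
    rw [← hx, ← lintegral_indicator measurableSet_ball, ← lintegral_indicator measurableSet_ball,
      ← lintegral_add_left_eq_self _ x]
    refine lintegral_mono fun z => ?_
    by_cases hz : x + z ∈ Metric.ball z₀ (r / 2)
    · have hz' : z ∈ Metric.ball (0 : E) r := by
        rw [mem_ball_zero_iff]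
        rw [mem_ball_iff_norm] at hz hxb
        calc ‖z‖ = ‖(x + z - z₀) - (x - z₀)‖ := by congr 1; abel
          _ ≤ ‖x + z - z₀‖ + ‖x - z₀‖ := norm_sub_le _ _
          _ < r := by linarith
      rw [indicator_of_mem hz, indicator_of_mem hz']
    · rw [indicator_of_notMem hz]
      exact zero_le
  rw [lintegral_eq_zero_iff (hv.sub_const _).enorm] at h2
  filter_upwards [h2] with y hy
  simpa [sub_eq_zero] using hy

end Euclidean

/-! ### Local constancy of limits with vanishing energy -/

/-- The Cauchy–Schwarz inequality against the constant `1`. -/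
theorem setLIntegral_enorm_le_sqrt {X F : Type*} [MeasurableSpace X] [NormedAddCommGroup F]
    (ν : Measure X) {f : X → F} (hf : AEStronglyMeasurable f ν) (S : Set X) :
    ∫⁻ x in S, ‖f x‖ₑ ∂ν ≤ (∫⁻ x in S, ‖f x‖ₑ ^ 2 ∂ν) ^ (1 / 2 : ℝ) * ν S ^ (1 / 2 : ℝ) := by
  have h := ENNReal.lintegral_mul_le_Lp_mul_Lq (ν.restrict S) Real.HolderConjugate.two_two
    hf.restrict.enorm (aemeasurable_const (b := (1 : ℝ≥0∞)))
  simpa using h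

section Transfer

variable {μ}

/-- Integrals over a small Euclidean ball are controlled by integrals over the corresponding set
of the manifold. The map `s` is any measurable map agreeing with the inverse of the chart. -/
theorem IsAdaptedNhd.lintegral_comp_le {x₀ : M} {N : Set M} {C : ℝ} (hN : IsAdaptedNhd n μ x₀ N C)
    {B : Set (EuclideanSpace ℝ (Fin n))} (hB : MeasurableSet B)
    (hBN : B ⊆ chartAt (EuclideanSpace ℝ (Fin n)) x₀ '' N)
    {s : EuclideanSpace ℝ (Fin n) → M} (hs : Measurable s)
    (hse : EqOn s (chartAt (EuclideanSpace ℝ (Fin n)) x₀).symm B)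
    {f : M → ℝ≥0∞} (hf : AEMeasurable f μ) :
    ∫⁻ z in B, f (s z) ≤ ENNReal.ofReal C *
      ∫⁻ x in (chartAt (EuclideanSpace ℝ (Fin n)) x₀).symm '' B, f x ∂μ := by
  set e := chartAt (EuclideanSpace ℝ (Fin n)) x₀ with he
  have hsN : ∀ z ∈ B, s z ∈ N ∧ e (s z) = z := by
    intro z hz
    obtain ⟨y, hy, rfl⟩ := hBN hz
    rw [hse hz, e.left_inv (hN.subset hy)]
    exact ⟨hy, rfl⟩
  have hle : (volume.restrict B).map s ≤ ENNReal.ofReal C • μ.restrict (e.symm '' B) := by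
    refine Measure.le_iff.2 fun A hA => ?_
    rw [Measure.map_apply hs hA, Measure.restrict_apply (hs hA), Measure.smul_apply,
      smul_eq_mul]
    have hBt : B ⊆ e.target := fun z hz => by
      obtain ⟨y, hy, rfl⟩ := hBN hz
      exact e.map_source (hN.subset hy)
    have hSm : MeasurableSet (e.symm '' B) :=
      measurableSet_image_of_subset_source e.symm hB hBt
    have hset : s ⁻¹' A ∩ B = e '' (A ∩ e.symm '' B) := by
      ext z
      constructor
      · rintro ⟨hzA, hz⟩
        exact ⟨s z, ⟨hzA, z, hz, (hse hz).symm⟩, (hsN z hz).2⟩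
      · rintro ⟨-, ⟨hyA, z, hz, rfl⟩, rfl⟩
        rw [e.right_inv (hBt hz)]
        exact ⟨by rwa [mem_preimage, hse hz], hz⟩
    rw [hset, Measure.restrict_apply hA]
    refine hN.volume_le _ (hA.inter hSm) ?_
    rintro - ⟨-, z, hz, rfl⟩
    rw [← hse hz]
    exact (hsN z hz).1
  have hac : (volume.restrict B).map s ≪ μ :=
    (Measure.absolutelyContinuous_of_le_smul hle).trans Measure.absolutelyContinuous_restrict
  calc ∫⁻ z in B, f (s z) = ∫⁻ x, f x ∂((volume.restrict B).map s) :=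
        (lintegral_map' (hf.mono_ac hac) hs.aemeasurable).symm
    _ ≤ ∫⁻ x, f x ∂(ENNReal.ofReal C • μ.restrict (e.symm '' B)) := lintegral_mono' hle le_rfl
    _ = _ := by rw [lintegral_smul_measure, smul_eq_mul]

/-- An `L²_loc` limit of test functions with energies tending to `0` is almost everywhere constant
near each point: read in the chart, the functions and their derivatives converge in `L¹` of a ball.
-/
theorem IsAdaptedNhd.exists_ae_eq_const {x₀ : M} {N : Set M} {C : ℝ}
    (hN : IsAdaptedNhd n μ x₀ N C) {φ : ℕ → Test n M} {v : M → ℝ} (hv : AEMeasurable v μ)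
    (hd : Tendsto (fun k => ‖(φ k).d μ‖) atTop (𝓝 0))
    (hL : ∀ K : Set M, IsCompact K →
      Tendsto (fun k => ∫⁻ x in K, ‖(φ k : M → ℝ) x - v x‖ₑ ^ 2 ∂μ) atTop (𝓝 0)) :
    ∃ V : Set M, IsOpen V ∧ x₀ ∈ V ∧ ∃ c : ℝ, ∀ᵐ x ∂μ.restrict V, v x = c := by
  classical
  set e := chartAt (EuclideanSpace ℝ (Fin n)) x₀ with he
  have hopen : IsOpen (e '' N) := e.isOpen_image_of_subset_source hN.isOpen hN.subset
  obtain ⟨r', hr', hball⟩ := Metric.nhds_basis_closedBall.mem_iff.1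
    (hopen.mem_nhds (mem_image_of_mem e hN.mem))
  obtain ⟨r, rfl⟩ : ∃ r, r' = 2 * r := ⟨r' / 2, by ring⟩
  have hr : 0 < r := by linarith
  set B := Metric.ball (e x₀) (2 * r) with hB
  have hBN : B ⊆ e '' N := Metric.ball_subset_closedBall.trans hball
  have hNt : e '' N ⊆ e.target := by
    rintro - ⟨y, hy, rfl⟩
    exact e.map_source (hN.subset hy)
  set K := e.symm '' Metric.closedBall (e x₀) (2 * r) with hK
  have hKc : IsCompact K := (isCompact_closedBall _ _).image_of_continuousOn
    (e.continuousOn_symm.mono (hball.trans hNt))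
  have hSK : e.symm '' B ⊆ K := image_mono Metric.ball_subset_closedBall
  -- `e.symm` is only known to be measurable on the target of the chart, so it is extended by a
  -- constant.
  set s : EuclideanSpace ℝ (Fin n) → M := e.target.piecewise e.symm fun _ => x₀ with hs
  have hsm : Measurable s := e.continuousOn_symm.measurable_piecewise continuousOn_const
    e.open_target.measurableSet
  have hse : EqOn s e.symm e.target := fun z hz => piecewise_eq_of_mem _ _ _ hz
  have hseB : EqOn s e.symm B := hse.mono (hBN.trans hNt)
  have hKtop : μ K ≠ (⊤ : ℝ≥0∞) := hKc.measure_lt_top.ne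
  have hsqrt : ∀ {a : ℕ → ℝ≥0∞}, Tendsto a atTop (𝓝 0) →
      Tendsto (fun k => a k ^ (1 / 2 : ℝ) * μ K ^ (1 / 2 : ℝ)) atTop (𝓝 0) := by
    intro a ha
    have h1 := ENNReal.Tendsto.mul_const (b := μ K ^ (1 / 2 : ℝ))
      (((ENNReal.continuous_rpow_const (y := 1 / 2)).tendsto 0).comp ha)
      (Or.inr (ENNReal.rpow_ne_top_of_nonneg (by norm_num) hKtop))
    simpa using h1
  have hmul : ∀ {a : ℕ → ℝ≥0∞} {c : ℝ≥0∞}, c ≠ (⊤ : ℝ≥0∞) → Tendsto a atTop (𝓝 0) →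
      Tendsto (fun k => c * a k) atTop (𝓝 0) := fun hc ha => by
    simpa using ENNReal.Tendsto.const_mul ha (Or.inr hc)
  -- the derivatives in the chart tend to `0` in `L¹` of the ball
  have hT1 : Tendsto (fun k => ∫⁻ z in B, ‖fderiv ℝ ((φ k : M → ℝ) ∘ s) z‖ₑ) atTop (𝓝 0) := by
    have hle : ∀ k, ∫⁻ z in B, ‖fderiv ℝ ((φ k : M → ℝ) ∘ s) z‖ₑ ≤
        ENNReal.ofReal C * (ENNReal.ofReal C *
          ((∫⁻ x, ‖(φ k).d μ x‖ₑ ^ 2 ∂μ) ^ (1 / 2 : ℝ) * μ K ^ (1 / 2 : ℝ))) := by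
      intro k
      have hm : AEMeasurable (fun x => ‖coords (differential n (φ k : M → ℝ)) x‖ₑ) μ :=
        (isMeasurableForm_differential μ (φ k).contMDiff).aemeasurable_coords.enorm
      calc ∫⁻ z in B, ‖fderiv ℝ ((φ k : M → ℝ) ∘ s) z‖ₑ
          ≤ ∫⁻ z in B, ENNReal.ofReal C * ‖coords (differential n (φ k : M → ℝ)) (s z)‖ₑ := by
            refine setLIntegral_mono' measurableSet_ball fun z hz => ?_
            have hzt : z ∈ e.target := hNt (hBN hz)
            have heq : (φ k : M → ℝ) ∘ s =ᶠ[𝓝 z] (φ k : M → ℝ) ∘ e.symm := by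
              filter_upwards [e.open_target.mem_nhds hzt] with y hy
              exact congrArg (φ k : M → ℝ) (hse hy)
            rw [heq.fderiv_eq, hse hzt, enorm_coords, ← ofReal_norm, ← ofReal_norm,
              ← ENNReal.ofReal_mul hN.pos.le]
            refine ENNReal.ofReal_le_ofReal ?_
            refine ContinuousLinearMap.opNorm_le_bound _ (by have := hN.pos; positivity)
              fun w => ?_
            obtain ⟨y, hy, rfl⟩ := hBN hz
            have h1 : fderiv ℝ ((φ k : M → ℝ) ∘ e.symm) (e y) w =
              differential n (φ k : M → ℝ) (e.symm (e y)) (mfderiv (𝓡 n) (𝓡 n) e.symm (e y) w) :=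
                fderiv_comp_chart_symm (φ k).contMDiff x₀ hzt w
            have h2 : norm (E := TangentSpace (𝓡 n) (e.symm (e y)))
              (mfderiv (𝓡 n) (𝓡 n) e.symm (e y) w) ≤ C * ‖w‖ := hN.norm_symm_le y hy w
            rw [h1]
            let L : TangentSpace (𝓡 n) (e.symm (e y)) →L[ℝ] ℝ :=
              differential n (φ k : M → ℝ) (e.symm (e y))
            calc ‖L (mfderiv (𝓡 n) (𝓡 n) e.symm (e y) w)‖ ≤ ‖L‖ * norm
                  (E := TangentSpace (𝓡 n) (e.symm (e y)))
                  (mfderiv (𝓡 n) (𝓡 n) e.symm (e y) w) := L.le_opNorm _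
              _ ≤ ‖L‖ * (C * ‖w‖) := mul_le_mul_of_nonneg_left h2 (norm_nonneg L)
              _ = C * ‖L‖ * ‖w‖ := by ring
        _ = ENNReal.ofReal C *
              ∫⁻ z in B, ‖coords (differential n (φ k : M → ℝ)) (s z)‖ₑ :=
            lintegral_const_mul' _ _ ENNReal.ofReal_ne_top
        _ ≤ _ := by
            gcongr
            refine (hN.lintegral_comp_le measurableSet_ball hBN hsm hseB hm).trans ?_
            gcongr
            refine (lintegral_mono_set hSK).trans ?_
            refine (setLIntegral_enorm_le_sqrt μ
              (isMeasurableForm_differential μ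
                (φ k).contMDiff).aemeasurable_coords.aestronglyMeasurable K).trans ?_
            gcongr ?_ ^ _ * _
            refine (setLIntegral_le_lintegral _ _).trans_eq (lintegral_congr_ae ?_)
            filter_upwards [(φ k).coeFn_d μ] with x hx
            rw [hx]
    refine tendsto_of_tendsto_of_tendsto_of_le_of_le tendsto_const_nhds
      (hmul ENNReal.ofReal_ne_top (hmul ENNReal.ofReal_ne_top (hsqrt ?_)))
      (fun k => zero_le) hle
    simp_rw [lintegral_enorm_sq_eq_ofReal]
    simpa using ENNReal.tendsto_ofReal (hd.pow 2)
  -- the functions read in the chart converge in `L¹` of the ball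
  have hT2 : Tendsto (fun k => ∫⁻ z in B, ‖((φ k : M → ℝ) ∘ s) z - (hv.mk v ∘ s) z‖ₑ) atTop
      (𝓝 0) := by
    have hle : ∀ k, ∫⁻ z in B, ‖((φ k : M → ℝ) ∘ s) z - (hv.mk v ∘ s) z‖ₑ ≤
        ENNReal.ofReal C * ((∫⁻ x in K, ‖(φ k : M → ℝ) x - v x‖ₑ ^ 2 ∂μ) ^ (1 / 2 : ℝ) *
          μ K ^ (1 / 2 : ℝ)) := by
      intro k
      have hm : AEMeasurable (fun x => (φ k : M → ℝ) x - hv.mk v x) μ :=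
        ((φ k).continuous.measurable.sub hv.measurable_mk).aemeasurable
      refine (hN.lintegral_comp_le measurableSet_ball hBN hsm hseB hm.enorm).trans ?_
      gcongr
      refine (lintegral_mono_set hSK).trans ?_
      refine (setLIntegral_enorm_le_sqrt μ hm.aestronglyMeasurable K).trans ?_
      gcongr ?_ ^ _ * _
      refine (lintegral_congr_ae ?_).le
      filter_upwards [ae_restrict_of_ae hv.ae_eq_mk] with x hx
      rw [hx]
    exact tendsto_of_tendsto_of_tendsto_of_le_of_le tendsto_const_nhds
      (hmul ENNReal.ofReal_ne_top (hsqrt (hL K hKc))) (fun k => zero_le) hle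
  obtain ⟨c, hc⟩ := ae_eq_const_of_tendsto_fderiv (ν := volume) (w := fun k => (φ k : M → ℝ) ∘ s)
    (v := hv.mk v ∘ s) (z₀ := e x₀) hr
    (fun k => ((contDiffOn_comp_chart_symm (φ k).contMDiff x₀).mono (hBN.trans hNt)).of_le
      (by norm_cast) |>.congr fun z hz => congrArg (φ k : M → ℝ) (hseB hz))
    (fun k => (φ k).continuous.measurable.comp hsm) (hv.measurable_mk.comp hsm) hT1 hT2
  refine ⟨e.symm '' Metric.ball (e x₀) (r / 2),
    e.symm.isOpen_image_of_subset_source Metric.isOpen_ball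
      ((Metric.ball_subset_ball (by linarith)).trans (hBN.trans hNt)),
    ⟨e x₀, Metric.mem_ball_self (by linarith), e.left_inv (mem_chart_source _ x₀)⟩, c, ?_⟩
  have hVo : IsOpen (e.symm '' Metric.ball (e x₀) (r / 2)) :=
    e.symm.isOpen_image_of_subset_source Metric.isOpen_ball
      ((Metric.ball_subset_ball (by linarith)).trans (hBN.trans hNt))
  suffices h : ∀ᵐ x ∂μ.restrict (e.symm '' Metric.ball (e x₀) (r / 2)), hv.mk v x = c by
    filter_upwards [h, ae_restrict_of_ae hv.ae_eq_mk] with x hx h2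
    rw [h2, hx]
  have hVm := hVo.measurableSet
  have hb2 : Metric.ball (e x₀) (r / 2) ⊆ B := Metric.ball_subset_ball (by linarith)
  have hAm : MeasurableSet (hv.mk v ⁻¹' {c}ᶜ) :=
    hv.measurable_mk (measurableSet_singleton c).compl
  have hset : {x | ¬ hv.mk v x = c} = hv.mk v ⁻¹' {c}ᶜ := rfl
  rw [ae_iff, hset, Measure.restrict_apply hAm]
  refine le_antisymm ((hN.le_volume _ (hAm.inter hVm) ?_).trans ?_) zero_le
  · rintro - ⟨-, z, hz, rfl⟩
    obtain ⟨y, hy, rfl⟩ := hBN (hb2 hz)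
    rwa [e.left_inv (hN.subset hy)]
  · rw [ae_iff, Measure.restrict_apply] at hc
    · have hsub : e '' (hv.mk v ⁻¹' {c}ᶜ ∩ e.symm '' Metric.ball (e x₀) (r / 2)) ⊆
          {z | ¬ (hv.mk v ∘ s) z = c} ∩ Metric.ball (e x₀) (r / 2) := by
        rintro - ⟨-, ⟨hx, z, hz, rfl⟩, rfl⟩
        have hzt : z ∈ e.target := hNt (hBN (hb2 hz))
        rw [e.right_inv hzt]
        refine ⟨?_, hz⟩
        rw [mem_ofPred_eq, Function.comp_apply, hse hzt]
        exact hx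
      rw [measure_mono_null hsub hc, mul_zero]
    · exact (hv.measurable_mk.comp hsm) (measurableSet_singleton c).compl

end Transfer

/-! ### Uniqueness of limits on non-parabolic manifolds -/

theorem abs_sub_le_of_abs_deriv_le {F : ℝ → ℝ} (hF : Differentiable ℝ F) {C : ℝ}
    (hC : ∀ s, |deriv F s| ≤ C) (a b : ℝ) : |F b - F a| ≤ C * |b - a| :=
  convex_univ.norm_image_sub_le_of_norm_deriv_le (fun s _ => hF s) (fun s _ => hC s)
    (mem_univ a) (mem_univ b)

theorem exists_abs_deriv_smoothTransition_le : ∃ C, ∀ s, |deriv Real.smoothTransition s| ≤ C := by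
  have hF : ContDiff ℝ 1 Real.smoothTransition := Real.smoothTransition.contDiff (n := 1)
  refine HasCompactSupport.exists_bound_of_continuous (f := deriv Real.smoothTransition)
    (HasCompactSupport.intro (isCompact_Icc (a := (0 : ℝ)) (b := 1)) fun s hs => ?_)
    (hF.continuous_deriv le_rfl)
  rcases lt_or_ge s 0 with h | h
  · have : Real.smoothTransition =ᶠ[𝓝 s] fun _ => 0 := by
      filter_upwards [Iio_mem_nhds h] with t ht
      exact Real.smoothTransition.zero_of_nonpos (le_of_lt ht)
    rw [this.deriv_eq, deriv_const]
  · have h1 : 1 < s := by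
      by_contra h2
      exact hs ⟨h, not_lt.1 h2⟩
    have : Real.smoothTransition =ᶠ[𝓝 s] fun _ => 1 := by
      filter_upwards [Ioi_mem_nhds h1] with t ht
      exact Real.smoothTransition.one_of_one_le (le_of_lt ht)
    rw [this.deriv_eq, deriv_const]

variable (n) in
theorem Test.exists_cutoff {K : Set M} (hK : IsCompact K) :
    ∃ ρ : Test n M, (∀ x ∈ K, (ρ : M → ℝ) x = 1) ∧ ∀ x, (ρ : M → ℝ) x ∈ Icc (0 : ℝ) 1 := by
  have : LocallyCompactSpace M := ChartedSpace.locallyCompactSpace (EuclideanSpace ℝ (Fin n)) M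
  obtain ⟨K', hK', hKK'⟩ := exists_compact_superset hK
  obtain ⟨f, hf1, hf0, hf⟩ := exists_contMDiffMap_one_nhds_of_subset_interior (𝓡 n) (n := (⊤ : ℕ∞))
    hK.isClosed hKK'
  exact ⟨⟨f, f.contMDiff, HasCompactSupport.intro hK' hf0⟩,
    fun x hx => hf1.self_of_nhdsSet x hx, hf⟩

section Constancy

variable {μ}

theorem add_sq_le_two_mul (a b : ℝ≥0∞) : (a + b) ^ 2 ≤ 2 * (a ^ 2 + b ^ 2) := by
  have h := ENNReal.rpow_add_le_mul_rpow_add_rpow a b (one_le_two (α := ℝ))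
  norm_num at h
  exact h

/-- On a connected space, a function which is almost everywhere constant near each point is
almost everywhere constant. -/
theorem exists_ae_eq_const_of_locally {X : Type*} [TopologicalSpace X] [PreconnectedSpace X]
    [SecondCountableTopology X] [MeasurableSpace X] [OpensMeasurableSpace X] {ν : Measure X}
    [ν.IsOpenPosMeasure] {v : X → ℝ}
    (h : ∀ x₀, ∃ V : Set X, IsOpen V ∧ x₀ ∈ V ∧ ∃ c : ℝ, ∀ᵐ x ∂ν.restrict V, v x = c) :
    ∃ c : ℝ, ∀ᵐ x ∂ν, v x = c := by
  choose V hVo hxV c hc using h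
  have hloc : IsLocallyConstant c := by
    refine (IsLocallyConstant.iff_exists_open c).2 fun x => ⟨V x, hVo x, hxV x, fun y hy => ?_⟩
    have hpos : ν (V x ∩ V y) ≠ 0 :=
      (((hVo x).inter (hVo y)).measure_pos ν ⟨y, hy, hxV y⟩).ne'
    have : (ae (ν.restrict (V x ∩ V y))).NeBot := by
      rwa [ae_neBot, Ne, Measure.restrict_eq_zero]
    obtain ⟨z, hz1, hz2⟩ := ((ae_restrict_of_ae_restrict_of_subset inter_subset_left (hc x)).and
      (ae_restrict_of_ae_restrict_of_subset inter_subset_right (hc y))).exists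
    rw [← hz1, ← hz2]
  obtain ⟨a, ha⟩ := hloc.exists_eq_const
  refine ⟨a, ?_⟩
  rw [ae_iff]
  refine measure_null_of_locally_null _ fun x hx => ⟨V x ∩ {x | ¬ v x = a},
    inter_comm _ _ ▸ inter_mem_nhdsWithin _ ((hVo x).mem_nhds (hxV x)), ?_⟩
  have h1 := hc x
  rw [ha, Function.const_apply, ae_iff,
    Measure.restrict_apply₀' (hVo x).measurableSet.nullMeasurableSet] at h1
  rwa [inter_comm]

/-- The interpolation `ρ + (1 - ρ) ψ` between `1` on `{ρ = 1}` and `ψ` outside the support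
of `ρ`. -/
def Test.interp (ρ ψ : Test n M) : Test n M :=
  ⟨ρ + (1 - ρ) * ψ, ρ.contMDiff.add ((contMDiff_const.sub ρ.contMDiff).mul ψ.contMDiff),
    ρ.hasCompactSupport.add ψ.hasCompactSupport.mul_left⟩

theorem Test.interp_apply (ρ ψ : Test n M) (x : M) :
    (ρ.interp ψ : M → ℝ) x = (ρ : M → ℝ) x + (1 - (ρ : M → ℝ) x) * (ψ : M → ℝ) x := rfl

theorem Test.differential_interp (ρ ψ : Test n M) :
    differential n (ρ.interp ψ : M → ℝ) =
      (fun x => (1 - (ψ : M → ℝ) x) • differential n (ρ : M → ℝ) x) +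
        fun x => (1 - (ρ : M → ℝ) x) • differential n (ψ : M → ℝ) x := by
  have h : (ρ.interp ψ : M → ℝ) = ((ρ : M → ℝ) + (ψ : M → ℝ)) +
      (-1 : ℝ) • ((ρ : M → ℝ) * (ψ : M → ℝ)) := by
    funext y
    simp only [Test.interp_apply, Pi.add_apply, Pi.smul_apply, Pi.mul_apply, smul_eq_mul]
    ring
  have h1 : MDifferentiable (𝓡 n) 𝓘(ℝ, ℝ) ((ρ : M → ℝ) + (ψ : M → ℝ)) :=
    (ρ.contMDiff.add ψ.contMDiff).mdifferentiable (by simp)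
  have h2 : MDifferentiable (𝓡 n) 𝓘(ℝ, ℝ) ((ρ : M → ℝ) * (ψ : M → ℝ)) :=
    (ρ.contMDiff.mul ψ.contMDiff).mdifferentiable (by simp)
  have h3 : MDifferentiable (𝓡 n) 𝓘(ℝ, ℝ) ((-1 : ℝ) • ((ρ : M → ℝ) * (ψ : M → ℝ))) :=
    (contMDiff_const (c := (-1 : ℝ)) |>.mul (ρ.contMDiff.mul ψ.contMDiff)).mdifferentiable
      (by simp)
  rw [h, differential_add h1 h3, differential_add ρ.mdifferentiable
    ψ.mdifferentiable, differential_const_smul _ h2]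
  funext x
  simp only [Pi.add_apply]
  rw [differential_mul ρ.mdifferentiable ψ.mdifferentiable]
  module

/-- The energy of the interpolation is small if `ψ` has small energy and is close to `1` in `L²` on
the support of `ρ`. -/
theorem Test.formEnergy_interp_le (ρ ψ : Test n M) {A : ℝ}
    (hρ : ∀ x, (ρ : M → ℝ) x ∈ Icc (0 : ℝ) 1)
    (hA : ∀ x ∈ tsupport (ρ : M → ℝ), ‖differential n (ρ : M → ℝ) x‖ ≤ A) :
    formEnergy μ (differential n (ρ.interp ψ : M → ℝ)) ≤
      2 * (ENNReal.ofReal A ^ 2 * ∫⁻ x in tsupport (ρ : M → ℝ), ‖(ψ : M → ℝ) x - 1‖ₑ ^ 2 ∂μ +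
        formEnergy μ (differential n (ψ : M → ℝ))) := by
  set S := tsupport (ρ : M → ℝ) with hS
  have hpt : ∀ x, ‖coords (differential n (ρ.interp ψ : M → ℝ)) x‖ₑ ^ 2 ≤
      2 * (S.indicator (fun x => ENNReal.ofReal A ^ 2 * ‖(ψ : M → ℝ) x - 1‖ₑ ^ 2) x +
        ‖coords (differential n (ψ : M → ℝ)) x‖ₑ ^ 2) := by
    intro x
    have h0 : ‖coords (differential n (ρ.interp ψ : M → ℝ)) x‖ₑ ≤
        S.indicator (fun x => ENNReal.ofReal A * ‖(ψ : M → ℝ) x - 1‖ₑ) x +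
          ‖coords (differential n (ψ : M → ℝ)) x‖ₑ := by
      rw [Test.differential_interp, coords_add, coords_smul, coords_smul]
      refine (enorm_add_le _ _).trans (add_le_add ?_ ?_)
      · by_cases hx : x ∈ S
        · rw [indicator_of_mem hx, enorm_smul, mul_comm, ← enorm_neg (1 - (ψ : M → ℝ) x), neg_sub]
          gcongr
          rw [← ofReal_norm, norm_coords]
          exact ENNReal.ofReal_le_ofReal (hA x hx)
        · have h0 : differential n (ρ : M → ℝ) x = 0 :=
            differential_eq_zero_of_notMem_tsupport hx
          have h1 : coords (differential n (ρ : M → ℝ)) x = 0 := by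
            ext i
            change differential n (ρ : M → ℝ) x _ = 0
            rw [h0]
            rfl
          rw [indicator_of_notMem hx, h1, smul_zero, enorm_zero]
      · rw [enorm_smul]
        refine mul_le_of_le_one_left zero_le ?_
        rw [← ofReal_norm, ENNReal.ofReal_le_one, Real.norm_eq_abs, abs_le]
        constructor <;> linarith [(hρ x).1, (hρ x).2]
    have h1 : S.indicator (fun x => ENNReal.ofReal A ^ 2 * ‖(ψ : M → ℝ) x - 1‖ₑ ^ 2) x =
        S.indicator (fun x => ENNReal.ofReal A * ‖(ψ : M → ℝ) x - 1‖ₑ) x ^ 2 := by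
      by_cases hx : x ∈ S
      · simp only [indicator_of_mem hx, mul_pow]
      · simp [indicator_of_notMem hx]
    rw [h1]
    exact (pow_le_pow_left' h0 2).trans (add_sq_le_two_mul _ _)
  have hm : Measurable (S.indicator fun x => ENNReal.ofReal A ^ 2 * ‖(ψ : M → ℝ) x - 1‖ₑ ^ 2) :=
    (((ψ.continuous.measurable.sub_const 1).enorm.pow_const 2).const_mul _).indicator
      ρ.hasCompactSupport.measurableSet
  rw [WeightedManifold.formEnergy_eq, WeightedManifold.formEnergy_eq]
  refine (lintegral_mono hpt).trans_eq ?_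
  rw [lintegral_const_mul' _ _ (by simp), lintegral_add_left hm,
    lintegral_indicator ρ.hasCompactSupport.measurableSet, lintegral_const_mul' _ _ (by simp)]

/-- On a non-parabolic manifold, test functions with energies tending to `0` can only tend
to `0` in `L²_loc`. -/
theorem ae_eq_zero_of_tendsto [PreconnectedSpace M] [μ.IsOpenPosMeasure]
    (hμ : IsWeightedVolume n μ) (hM : ¬ IsParabolic n μ)
    {φ : ℕ → Test n M} {v : M → ℝ} (hv : AEMeasurable v μ)
    (hd : Tendsto (fun k => ‖(φ k).d μ‖) atTop (𝓝 0))
    (hL : ∀ K : Set M, IsCompact K →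
      Tendsto (fun k => ∫⁻ x in K, ‖(φ k : M → ℝ) x - v x‖ₑ ^ 2 ∂μ) atTop (𝓝 0)) :
    ∀ᵐ x ∂μ, v x = 0 := by
  obtain ⟨c, hc⟩ := exists_ae_eq_const_of_locally (ν := μ) (v := v) fun x₀ => by
    obtain ⟨N, C, hN⟩ := exists_isAdaptedNhd hμ x₀
    exact hN.exists_ae_eq_const hv hd hL
  rcases eq_or_ne c 0 with rfl | hc0
  · exact hc
  -- If the constant `c` were not `0`, the functions `φ k`, rescaled and clamped to `[0, 1]`, would
  -- tend to `1`; interpolating them with cutoff functions equal to `1` on large compact sets makes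
  -- the convergence locally uniform and contradicts non-parabolicity.
  refine (hM ?_).elim
  have hLC : LocallyCompactSpace M :=
    ChartedSpace.locallyCompactSpace (EuclideanSpace ℝ (Fin n)) M
  obtain ⟨B, hB⟩ := exists_abs_deriv_smoothTransition_le
  have hST : ContDiff ℝ ∞ Real.smoothTransition := Real.smoothTransition.contDiff (n := ⊤)
  have hB0 : 0 ≤ B := (abs_nonneg _).trans (hB 0)
  set F : ℝ → ℝ := fun s => Real.smoothTransition (c⁻¹ * s) with hF
  have hFs : ContDiff ℝ ∞ F := hST.comp (contDiff_const.mul contDiff_id)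
  have hF0 : F 0 = 0 := by simp [hF]
  have hFc : F c = 1 := by simp [hF, inv_mul_cancel₀ hc0]
  have hF' : ∀ s, |deriv F s| ≤ |c⁻¹| * B := by
    intro s
    rw [hF, deriv_comp_mul_left, smul_eq_mul, abs_mul]
    exact mul_le_mul_of_nonneg_left (hB _) (abs_nonneg _)
  set D : ℝ := |c⁻¹| * B with hD
  set ψ : ℕ → Test n M := fun k => (φ k).comp F hFs hF0 with hψ
  let K : CompactExhaustion M := default
  choose ρ hρ1 hρ using fun l => Test.exists_cutoff n (K.isCompact l)
  choose A hA using fun l => norm_differential_le_of_isCompact (ρ l).contMDiff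
    (ρ l).hasCompactSupport.isCompact
  have hψ1 : ∀ S : Set M, IsCompact S →
      Tendsto (fun k => ∫⁻ x in S, ‖(ψ k : M → ℝ) x - 1‖ₑ ^ 2 ∂μ) atTop (𝓝 0) := by
    intro S hS
    have hle : ∀ k, ∫⁻ x in S, ‖(ψ k : M → ℝ) x - 1‖ₑ ^ 2 ∂μ ≤
        ENNReal.ofReal D ^ 2 * ∫⁻ x in S, ‖(φ k : M → ℝ) x - v x‖ₑ ^ 2 ∂μ := by
      intro k
      rw [← lintegral_const_mul' _ _ (by simp)]
      refine lintegral_mono_ae ?_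
      filter_upwards [ae_restrict_of_ae hc] with x hx
      rw [hx, ← mul_pow]
      refine pow_le_pow_left' ?_ 2
      rw [← ofReal_norm, ← ofReal_norm, ← ENNReal.ofReal_mul (by positivity)]
      refine ENNReal.ofReal_le_ofReal ?_
      have := abs_sub_le_of_abs_deriv_le (hFs.differentiable (by simp)) hF' c ((φ k : M → ℝ) x)
      rw [hFc] at this
      exact this
    refine tendsto_of_tendsto_of_tendsto_of_le_of_le tendsto_const_nhds ?_ (fun k => zero_le) hle
    simpa using ENNReal.Tendsto.const_mul (hL S hS) (Or.inr (by simp))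
  have hψd : Tendsto (fun k => formEnergy μ (differential n (ψ k : M → ℝ))) atTop (𝓝 0) := by
    simp_rw [Test.formEnergy_eq]
    have h1 : Tendsto (fun k => ‖(ψ k).d μ‖) atTop (𝓝 0) := by
      refine squeeze_zero (fun k => norm_nonneg _)
        (fun k => (φ k).norm_d_comp_le μ hFs hF0 hF') ?_
      simpa using hd.const_mul D
    simpa using ENNReal.tendsto_ofReal (h1.pow 2)
  have hlim : ∀ l, Tendsto (fun k => formEnergy μ
      (differential n ((ρ l).interp (ψ k) : M → ℝ))) atTop (𝓝 0) := by
    intro l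
    refine tendsto_of_tendsto_of_tendsto_of_le_of_le tendsto_const_nhds ?_ (fun k => zero_le)
      fun k => (ρ l).formEnergy_interp_le (ψ k) (hρ l) (hA l)
    have h1 := ENNReal.Tendsto.const_mul (a := ENNReal.ofReal (A l) ^ 2)
      (hψ1 _ (ρ l).hasCompactSupport.isCompact) (Or.inr (by simp))
    have h2 := ENNReal.Tendsto.const_mul (a := 2) (h1.add hψd) (Or.inr (by simp))
    simpa using h2
  have hex : ∀ l : ℕ, ∃ k, formEnergy μ (differential n ((ρ l).interp (ψ k) : M → ℝ)) ≤
      ((l : ℝ≥0∞) + 1)⁻¹ := fun l =>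
    ((hlim l).eventually_le_const (by simp [pos_iff_ne_zero])).exists
  choose k hk using hex
  refine ⟨fun l => (ρ l).interp (ψ (k l)), fun l => ((ρ l).interp (ψ (k l))).2, fun l x => ?_,
    fun S hS => ?_, ?_⟩
  · simp only [Test.interp_apply]
    have h1 : (ψ (k l) : M → ℝ) x ∈ Icc (0 : ℝ) 1 :=
      ⟨Real.smoothTransition.nonneg _, Real.smoothTransition.le_one _⟩
    have h2 := hρ l x
    constructor
    · nlinarith [h1.1, h1.2, h2.1, h2.2]
    · nlinarith [h1.1, h1.2, h2.1, h2.2]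
  · obtain ⟨l₀, hl₀⟩ := K.exists_superset_of_isCompact hS
    rw [Metric.tendstoUniformlyOn_iff]
    intro ε hε
    filter_upwards [eventually_ge_atTop l₀] with l hl x hx
    rw [Test.interp_apply, hρ1 l x (K.subset hl (hl₀ hx))]
    simpa using hε
  · refine tendsto_of_tendsto_of_tendsto_of_le_of_le tendsto_const_nhds ?_ (fun l => zero_le) hk
    have h1 := (tendsto_add_atTop_iff_nat 1).2 ENNReal.tendsto_inv_nat_nhds_zero
    simpa using h1

end Constancy

/-! ### Powers of equilibrium potentials -/

section Limits

variable {μ}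

/-- A sequence of test functions, converging in `L²_loc` and with energies bounded by a convergent
sequence, gives approximability. -/
theorem Approximable.of_tendsto_tests {φ : ℕ → Test n M} {u : M → ℝ} {a : ℕ → ℝ} {E : ℝ}
    (hφ : ∀ k, ‖(φ k).d μ‖ ^ 2 ≤ a k) (ha : Tendsto a atTop (𝓝 E))
    (hL : ∀ K : Set M, IsCompact K →
      Tendsto (fun k => ∫⁻ x in K, ‖(φ k : M → ℝ) x - u x‖ₑ ^ 2 ∂μ) atTop (𝓝 0)) :
    Approximable n μ u E := by
  intro K hK ε hε
  obtain ⟨k, hk1, hk2⟩ := (((hL K hK).eventually_le_const (ENNReal.ofReal_pos.2 hε)).and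
    (ha.eventually_le_const (show E < E + ε by linarith))).exists
  exact ⟨φ k, hk1, (hφ k).trans hk2⟩

theorem lintegral_enorm_sub_sq_le {X : Type*} [MeasurableSpace X] {ν : Measure X}
    {f g h : X → ℝ} (hf : AEMeasurable (fun x => ‖f x - g x‖ₑ ^ 2) ν) :
    ∫⁻ x, ‖f x - h x‖ₑ ^ 2 ∂ν ≤
      2 * (∫⁻ x, ‖f x - g x‖ₑ ^ 2 ∂ν + ∫⁻ x, ‖g x - h x‖ₑ ^ 2 ∂ν) := by
  rw [← lintegral_add_left' hf, ← lintegral_const_mul' _ _ (by simp)]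
  refine lintegral_mono fun x => ?_
  refine le_trans (pow_le_pow_left' ?_ 2) (add_sq_le_two_mul _ _)
  have : f x - h x = (f x - g x) + (g x - h x) := by ring
  rw [this]
  exact enorm_add_le _ _

/-- Bounded almost everywhere convergence preserves approximability by test functions. -/
theorem Approximable.of_tendsto_ae {u : ℕ → M → ℝ} {v : M → ℝ} {a : ℕ → ℝ} {E B : ℝ}
    (hu : ∀ i, Approximable n μ (u i) (a i)) (ha : Tendsto a atTop (𝓝 E))
    (hm : ∀ i, AEMeasurable (u i) μ) (hB : ∀ i, ∀ᵐ x ∂μ, |u i x| ≤ B)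
    (hlim : ∀ᵐ x ∂μ, Tendsto (fun i => u i x) atTop (𝓝 (v x))) :
    Approximable n μ v E := by
  intro K hK ε hε
  have hv : AEMeasurable v μ := aemeasurable_of_tendsto_metrizable_ae _ hm hlim
  have hvB : ∀ᵐ x ∂μ, |v x| ≤ B := by
    filter_upwards [hlim, ae_all_iff.2 hB] with x h1 h2
    exact le_of_tendsto' h1.abs h2
  have hint : Tendsto (fun i => ∫⁻ x in K, ‖u i x - v x‖ₑ ^ 2 ∂μ) atTop (𝓝 0) := by
    have h := tendsto_lintegral_of_dominated_convergence' (μ := μ.restrict K)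
      (F := fun i x => ‖u i x - v x‖ₑ ^ 2) (f := fun _ => 0)
      (fun _ => ENNReal.ofReal (2 * B) ^ 2)
      (fun i => (((hm i).sub hv).enorm.pow_const 2).restrict)
      (fun i => ae_restrict_of_ae ?_) ?_ (ae_restrict_of_ae ?_)
    · simpa using h
    · filter_upwards [hB i, hvB] with x h1 h2
      refine pow_le_pow_left' ?_ 2
      rw [← ofReal_norm, Real.norm_eq_abs]
      exact ENNReal.ofReal_le_ofReal ((abs_sub _ _).trans (by linarith))
    · rw [lintegral_const]
      exact ENNReal.mul_ne_top (ENNReal.pow_ne_top ENNReal.ofReal_ne_top)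
        (by simpa using hK.measure_lt_top.ne)
    · filter_upwards [hlim] with x hx
      have h1 : Tendsto (fun i => u i x - v x) atTop (𝓝 0) := by
        simpa using hx.sub_const (v x)
      have h2 := (((ENNReal.continuous_pow 2).comp continuous_enorm).tendsto (0 : ℝ)).comp h1
      simpa [Function.comp_def] using h2
  obtain ⟨i, hi1, hi2⟩ := ((hint.eventually_le_const
    (ENNReal.ofReal_pos.2 (show 0 < ε / 4 by linarith))).and
    (ha.eventually_le_const (show E < E + ε / 2 by linarith))).exists
  obtain ⟨φ, hφ1, hφ2⟩ := hu i K hK (ε / 4) (by linarith)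
  refine ⟨φ, ?_, by linarith⟩
  refine (lintegral_enorm_sub_sq_le (g := u i)
    ((φ.continuous.measurable.aemeasurable.sub (hm i)).enorm.pow_const 2).restrict).trans ?_
  calc 2 * (∫⁻ x in K, ‖(φ : M → ℝ) x - u i x‖ₑ ^ 2 ∂μ + ∫⁻ x in K, ‖u i x - v x‖ₑ ^ 2 ∂μ)
      ≤ 2 * (ENNReal.ofReal (ε / 4) + ENNReal.ofReal (ε / 4)) := by gcongr
    _ = ENNReal.ofReal ε := by
        rw [← ENNReal.ofReal_add (by linarith) (by linarith), ← ENNReal.ofReal_ofNat 2,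
          ← ENNReal.ofReal_mul (by norm_num)]
        congr 1
        ring

theorem tendsto_lintegral_comp {X : Type*} [MeasurableSpace X] {ν : Measure X}
    {f : ℕ → X → ℝ} {g : X → ℝ} {F : ℝ → ℝ} {C : ℝ} (hF : ∀ a b, |F b - F a| ≤ C * |b - a|)
    (h : Tendsto (fun k => ∫⁻ x, ‖f k x - g x‖ₑ ^ 2 ∂ν) atTop (𝓝 0)) :
    Tendsto (fun k => ∫⁻ x, ‖F (f k x) - F (g x)‖ₑ ^ 2 ∂ν) atTop (𝓝 0) := by
  have hC : 0 ≤ C := by simpa using (abs_nonneg _).trans (hF 0 1)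
  have hle : ∀ k, ∫⁻ x, ‖F (f k x) - F (g x)‖ₑ ^ 2 ∂ν ≤
      ENNReal.ofReal C ^ 2 * ∫⁻ x, ‖f k x - g x‖ₑ ^ 2 ∂ν := fun k => by
    rw [← lintegral_const_mul' _ _ (by simp)]
    refine lintegral_mono fun x => ?_
    rw [← mul_pow]
    refine pow_le_pow_left' ?_ 2
    rw [← ofReal_norm, ← ofReal_norm, ← ENNReal.ofReal_mul hC]
    exact ENNReal.ofReal_le_ofReal (hF _ _)
  refine tendsto_of_tendsto_of_tendsto_of_le_of_le tendsto_const_nhds ?_ (fun k => zero_le) hle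
  simpa using ENNReal.Tendsto.const_mul h (Or.inr (by simp))

/-- A measurable `1`-form at finite distance from the differential of a test function is square
integrable. -/
theorem memLp_coords_of_formEnergy_sub_lt_top {θ : CovectorField n M} (hθ : IsMeasurableForm μ θ)
    (φ : Test n M) (h : formEnergy μ (differential n (φ : M → ℝ) - θ) < ⊤) :
    MemLp (coords θ) 2 μ := by
  have h1 : MemLp (fun x => coords (differential n (φ : M → ℝ)) x - coords θ x) 2 μ := by
    refine ⟨((φ.memLp_coords μ).1.sub hθ.aemeasurable_coords.aestronglyMeasurable), ?_⟩
    rw [WeightedManifold.formEnergy_eq, lintegral_enorm_sq_eq_eLpNorm_sq] at h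
    exact (ENNReal.pow_lt_top_iff.1 h).resolve_right two_ne_zero
  have h2 := (φ.memLp_coords μ).sub h1
  refine h2.ae_eq (Eventually.of_forall fun x => ?_)
  simp

theorem Test.formEnergy_sub (φ : Test n M) {θ : CovectorField n M} (hθ : MemLp (coords θ) 2 μ) :
    formEnergy μ (differential n (φ : M → ℝ) - θ) =
      ENNReal.ofReal (‖φ.d μ - hθ.toLp (coords θ)‖ ^ 2) := by
  rw [WeightedManifold.formEnergy_eq, ← lintegral_enorm_sq_eq_ofReal]
  refine lintegral_congr_ae ?_
  filter_upwards [φ.coeFn_d μ, Lp.coeFn_sub (φ.d μ) (hθ.toLp (coords θ)), hθ.coeFn_toLp]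
    with x hx h2 h3
  rw [h2, Pi.sub_apply, hx, h3, coords_sub]

/-- Convergence of differentials in the sense of `formEnergy` is convergence in `L²`. -/
theorem exists_tendsto_d {φ : ℕ → Test n M} {θ : CovectorField n M} (hθ : IsMeasurableForm μ θ)
    (h : Tendsto (fun k => formEnergy μ (differential n (φ k : M → ℝ) - θ)) atTop (𝓝 0)) :
    ∃ hL : MemLp (coords θ) 2 μ,
      Tendsto (fun k => (φ k).d μ) atTop (𝓝 (hL.toLp (coords θ))) := by
  obtain ⟨k, hk⟩ := (h.eventually_lt_const (ENNReal.zero_lt_top)).exists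
  have hL := memLp_coords_of_formEnergy_sub_lt_top hθ (φ k) hk
  refine ⟨hL, ?_⟩
  simp_rw [fun k => (φ k).formEnergy_sub hL] at h
  rw [tendsto_iff_norm_sub_tendsto_zero]
  have h1 := (ENNReal.tendsto_toReal ENNReal.zero_ne_top).comp h
  have h2 : Tendsto (fun k => ‖(φ k).d μ - hL.toLp (coords θ)‖ ^ 2) atTop (𝓝 0) := by
    refine h1.congr fun k => ?_
    rw [Function.comp_apply, ENNReal.toReal_ofReal (by positivity)]
  have h3 := h2.sqrt
  simpa using h3

end Limits

/-- A smooth function equal to the identity exactly on `[0,1]`, with derivative in `[0,1]`. -/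
theorem exists_smooth_clamp : ∃ F : ℝ → ℝ, ContDiff ℝ ∞ F ∧ F 0 = 0 ∧ F 1 = 1 ∧
    (∀ s, 0 ≤ deriv F s) ∧ (∀ s, deriv F s ≤ 1) ∧ ∀ s, F s = s → s ∈ Icc (0 : ℝ) 1 := by
  set b : ℝ → ℝ := fun s => (1 - Real.smoothTransition (s - 1)) * (1 - Real.smoothTransition (-s))
    with hb
  have hST : ContDiff ℝ ∞ Real.smoothTransition := Real.smoothTransition.contDiff (n := ⊤)
  have hbs : ContDiff ℝ ∞ b := by
    refine (contDiff_const.sub (hST.comp (contDiff_id.sub contDiff_const))).mul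
      (contDiff_const.sub (hST.comp contDiff_id.neg))
  have hb0 : ∀ s, 0 ≤ b s := fun s =>
    mul_nonneg (sub_nonneg.2 (Real.smoothTransition.le_one _))
      (sub_nonneg.2 (Real.smoothTransition.le_one _))
  have hb1 : ∀ s, b s ≤ 1 := fun s =>
    mul_le_one₀ (by linarith [Real.smoothTransition.nonneg (s - 1)])
      (sub_nonneg.2 (Real.smoothTransition.le_one _))
      (by linarith [Real.smoothTransition.nonneg (-s)])
  have hblt1 : ∀ s, 1 < s → b s < 1 := fun s hs => by
    have h1 := Real.smoothTransition.pos_of_pos (sub_pos.2 hs)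
    have h2 : Real.smoothTransition (-s) = 0 :=
      Real.smoothTransition.zero_of_nonpos (by linarith)
    simp only [hb, h2]
    linarith
  have hblt0 : ∀ s, s < 0 → b s < 1 := fun s hs => by
    have h1 := Real.smoothTransition.pos_of_pos (neg_pos.2 hs)
    have h2 : Real.smoothTransition (s - 1) = 0 :=
      Real.smoothTransition.zero_of_nonpos (by linarith)
    simp only [hb, h2]
    linarith
  obtain ⟨hF, hF'⟩ := contDiff_integral hbs
  set F : ℝ → ℝ := fun s => ∫ t in (0 : ℝ)..s, b t with hFdef
  have hF0 : F 0 = 0 := by simp [hFdef]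
  have hF1 : F 1 = 1 := by
    have : F 1 = ∫ t in (0 : ℝ)..1, (1 : ℝ) := by
      refine intervalIntegral.integral_congr fun t ht => ?_
      rw [uIcc_of_le zero_le_one] at ht
      have h1 : Real.smoothTransition (-t) = 0 :=
        Real.smoothTransition.zero_of_nonpos (by linarith [ht.1])
      have h2 : Real.smoothTransition (t - 1) = 0 :=
        Real.smoothTransition.zero_of_nonpos (by linarith [ht.2])
      simp only [hb, h1, h2]
      norm_num
    rw [this]
    simp
  have hd : ∀ s, deriv (fun s => s - F s) s = 1 - b s := fun s => by
    have h1 : HasDerivAt F (b s) s := by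
      rw [← hF']
      exact (hF.differentiable (by simp) s).hasDerivAt
    exact ((hasDerivAt_id s).sub h1).deriv
  have hc : Continuous fun s => s - F s := continuous_id.sub hF.continuous
  refine ⟨F, hF, hF0, hF1, fun s => hF' ▸ hb0 s, fun s => hF' ▸ hb1 s, fun s hs => ⟨?_, ?_⟩⟩
  · by_contra! hlt
    have hmono : StrictMonoOn (fun s => s - F s) (Iic 0) :=
      strictMonoOn_of_deriv_pos (convex_Iic 0) hc.continuousOn fun t ht => by
        rw [interior_Iic] at ht
        rw [hd]
        linarith [hblt0 t ht]
    have := hmono (mem_Iic.2 hlt.le) (mem_Iic.2 le_rfl) hlt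
    simp only [hF0] at this
    linarith
  · by_contra! hlt
    have hmono : StrictMonoOn (fun s => s - F s) (Ici 1) :=
      strictMonoOn_of_deriv_pos (convex_Ici 1) hc.continuousOn fun t ht => by
        rw [interior_Ici] at ht
        rw [hd]
        linarith [hblt1 t ht]
    have := hmono (mem_Ici.2 le_rfl) (mem_Ici.2 hlt.le) hlt
    simp only [hF1] at this
    linarith

section Equilibrium

variable {μ}

theorem capacity_le {U : Set M} {φ : Test n M} (hφ : ∀ x ∈ U, (φ : M → ℝ) x = 1) :
    capacity n μ U ≤ ENNReal.ofReal (‖φ.d μ‖ ^ 2) := by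
  rw [← φ.formEnergy_eq μ]
  exact iInf₂_le (φ : M → ℝ) ⟨φ.2, hφ⟩

/-- A minimizing sequence of the capacity, with the Euler–Lagrange equation of its limit. -/
theorem IsEquilibriumPotential.exists_minimizing {U : Set M} {h : M → ℝ}
    (hh : IsEquilibriumPotential n μ U h) :
    AEMeasurable h μ ∧ ∃ (φ : ℕ → Test n M) (T : Lp (EuclideanSpace ℝ (Fin n)) 2 μ),
      (∀ k, ∀ x ∈ U, (φ k : M → ℝ) x = 1) ∧ Tendsto (fun k => (φ k).d μ) atTop (𝓝 T) ∧
      (∀ K : Set M, IsCompact K →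
        Tendsto (fun k => ∫⁻ x in K, ‖(φ k : M → ℝ) x - h x‖ₑ ^ 2 ∂μ) atTop (𝓝 0)) ∧
      capacity n μ U = ENNReal.ofReal (‖T‖ ^ 2) ∧
      (∀ ψ : Test n M, (∀ x ∈ U, (ψ : M → ℝ) x = 1) → ‖T‖ ^ 2 ≤ ‖ψ.d μ‖ ^ 2) ∧
      ∀ η : Test n M, (∀ x ∈ U, (η : M → ℝ) x = 0) → inner ℝ T (η.d μ) = 0 := by
  obtain ⟨θ, ⟨hm, hθ, φ', hφ', hd, hL⟩, hcap⟩ := hh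
  set φ : ℕ → Test n M := fun k => ⟨φ' k, (hφ' k).1⟩ with hφ
  have hφ1 : ∀ k, ∀ x ∈ U, (φ k : M → ℝ) x = 1 := fun k => (hφ' k).2
  obtain ⟨hLp, hT⟩ := exists_tendsto_d (φ := φ) hθ hd
  set T := hLp.toLp (coords θ) with hTdef
  have hcapT : capacity n μ U = ENNReal.ofReal (‖T‖ ^ 2) := by
    rw [← hcap, WeightedManifold.formEnergy_eq, ← lintegral_enorm_sq_eq_ofReal]
    refine lintegral_congr_ae ?_
    filter_upwards [hLp.coeFn_toLp] with x hx
    rw [hx]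
  have hmin : ∀ ψ : Test n M, (∀ x ∈ U, (ψ : M → ℝ) x = 1) → ‖T‖ ^ 2 ≤ ‖ψ.d μ‖ ^ 2 :=
    fun ψ hψ => by
      have := capacity_le (μ := μ) hψ
      rwa [hcapT, ENNReal.ofReal_le_ofReal_iff (by positivity)] at this
  refine ⟨hm, φ, T, hφ1, hT, hL, hcapT, hmin, fun η hη => ?_⟩
  -- `T` has minimal norm among the limits `T + t dη`, so this quadratic polynomial in `t` is
  -- nonnegative and its linear coefficient vanishes.
  have hquad : ∀ t : ℝ, 0 ≤ ‖η.d μ‖ ^ 2 * (t * t) + (2 * inner ℝ T (η.d μ)) * t + 0 := by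
    intro t
    have h1 : ∀ k, ‖T‖ ^ 2 ≤ ‖(φ k).d μ + t • η.d μ‖ ^ 2 := fun k => by
      rw [← map_smul, ← map_add]
      refine hmin _ fun x hx => ?_
      change (φ k : M → ℝ) x + t * (η : M → ℝ) x = 1
      rw [hφ1 k x hx, hη x hx, mul_zero, add_zero]
    have h2 : ‖T‖ ^ 2 ≤ ‖T + t • η.d μ‖ ^ 2 :=
      ge_of_tendsto' ((hT.add_const (t • η.d μ)).norm.pow 2) h1
    rw [norm_add_sq_real, real_inner_smul_right, norm_smul, mul_pow, Real.norm_eq_abs,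
      sq_abs] at h2
    nlinarith
  have hdisc := discrim_le_zero hquad
  rw [discrim, mul_zero, sub_zero] at hdisc
  nlinarith [sq_nonneg (inner ℝ T (η.d μ))]

/-- The equilibrium potential takes its values in `[0,1]`: clamping a minimizing sequence to
`[0,1]` does not increase the energy, so the clamped sequence has the same limit. -/
theorem IsEquilibriumPotential.ae_mem_Icc [PreconnectedSpace M] [μ.IsOpenPosMeasure]
    (hμ : IsWeightedVolume n μ) (hM : ¬ IsParabolic n μ) {U : Set M} {h : M → ℝ}
    (hh : IsEquilibriumPotential n μ U h) : ∀ᵐ x ∂μ, h x ∈ Icc (0 : ℝ) 1 := by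
  obtain ⟨hm, φ, T, hφ1, hT, hL, -, hmin, -⟩ := hh.exists_minimizing
  obtain ⟨F, hF, hF0, hF1, hF', hF'1, hFid⟩ := exists_smooth_clamp
  set ψ : ℕ → Test n M := fun k => φ k - (φ k).comp F hF hF0 with hψ
  have hle : ∀ k, ‖(ψ k).d μ‖ ^ 2 ≤ ‖(φ k).d μ‖ ^ 2 - ‖T‖ ^ 2 := fun k => by
    have h1 := (φ k).norm_d_sub_comp_sq_add_le μ hF hF0 hF' hF'1
    have h2 := hmin ((φ k).comp F hF hF0) fun x hx => by
      rw [Test.coe_comp, Function.comp_apply, hφ1 k x hx, hF1]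
    rw [hψ, map_sub]
    linarith
  have hd : Tendsto (fun k => ‖(ψ k).d μ‖) atTop (𝓝 0) := by
    have h1 : Tendsto (fun k => ‖(ψ k).d μ‖ ^ 2) atTop (𝓝 0) := by
      refine squeeze_zero (fun k => by positivity) hle ?_
      have h2 := (hT.norm.pow 2).sub_const (‖T‖ ^ 2)
      rwa [sub_self] at h2
    simpa using h1.sqrt
  have hd1 : ∀ s, |deriv (fun s => s - F s) s| ≤ 1 := fun s => by
    have : deriv (fun s => s - F s) s = 1 - deriv F s :=
      ((hasDerivAt_id s).sub (hF.differentiable (by simp) s).hasDerivAt).deriv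
    rw [this, abs_le]
    constructor <;> linarith [hF' s, hF'1 s]
  have hFd : Differentiable ℝ fun s => s - F s :=
    differentiable_id.sub (hF.differentiable (by simp))
  have hzero := ae_eq_zero_of_tendsto hμ hM (φ := ψ) (v := fun x => h x - F (h x))
    (hm.sub (hF.continuous.measurable.comp_aemeasurable hm)) hd fun K hK =>
      tendsto_lintegral_comp (F := fun s => s - F s) (abs_sub_le_of_abs_deriv_le hFd hd1) (hL K hK)
  filter_upwards [hzero] with x hx
  exact hFid _ (by linarith)

/-- If `F' = (H')²`, then `H(h)` has energy at most `F(1) cap(U)`. Formally `∫ |dH(h)|² = ∫ ⟨dh,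
dF(h)⟩`, and `dF(h)` may be replaced by `F(1) dh`, since `F(h) - F(1) h` vanishes on `U` and is
therefore orthogonal to `dh`. -/
theorem IsEquilibriumPotential.approximable_comp {U : Set M} {h : M → ℝ}
    (hh : IsEquilibriumPotential n μ U h) {H F : ℝ → ℝ} (hH : ContDiff ℝ ∞ H) (hH0 : H 0 = 0)
    (hF : ContDiff ℝ ∞ F) (hF0 : F 0 = 0) (hFH : ∀ s, deriv F s = deriv H s ^ 2) {C : ℝ}
    (hC : ∀ s, |deriv H s| ≤ C) :
    Approximable n μ (fun x => H (h x)) (F 1 * (capacity n μ U).toReal) := by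
  obtain ⟨-, φ, T, hφ1, hT, hL, hcap, -, hEL⟩ := hh.exists_minimizing
  have hC' : ∀ s, |deriv F s| ≤ C ^ 2 := fun s => by
    rw [hFH, abs_of_nonneg (by positivity), ← sq_abs]
    exact pow_le_pow_left₀ (abs_nonneg _) (hC s) 2
  rw [hcap, ENNReal.toReal_ofReal (by positivity)]
  -- `F ∘ φ k - F 1 • φ k` vanishes on `U`, hence is orthogonal to the limit `T`.
  set η : ℕ → Test n M := fun k => (φ k).comp F hF hF0 - F 1 • φ k with hη
  have h1 : ∀ k, ‖((φ k).comp H hH hH0).d μ‖ ^ 2 ≤ F 1 * ‖(φ k).d μ‖ ^ 2 +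
      ‖(φ k).d μ - T‖ * ((C ^ 2 + |F 1|) * ‖(φ k).d μ‖) := by
    intro k
    have h2 : inner ℝ T ((η k).d μ) = 0 := hEL (η k) fun x hx => by
      change F ((φ k : M → ℝ) x) - F 1 * (φ k : M → ℝ) x = 0
      rw [hφ1 k x hx, mul_one, sub_self]
    have h3 : inner ℝ ((φ k).d μ) ((η k).d μ) =
        ‖((φ k).comp H hH hH0).d μ‖ ^ 2 - F 1 * ‖(φ k).d μ‖ ^ 2 := by
      rw [hη, map_sub, map_smul, inner_sub_right, real_inner_smul_right,
        (φ k).inner_d_comp_eq μ hF hF0 hH hH0 hFH, real_inner_self_eq_norm_sq]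
    have h4 : ‖(η k).d μ‖ ≤ (C ^ 2 + |F 1|) * ‖(φ k).d μ‖ := by
      rw [hη, map_sub, map_smul, add_mul]
      refine (norm_sub_le _ _).trans (add_le_add ((φ k).norm_d_comp_le μ hF hF0 hC') ?_)
      rw [norm_smul, Real.norm_eq_abs]
    have h5 : inner ℝ ((φ k).d μ - T) ((η k).d μ) ≤ ‖(φ k).d μ - T‖ * ‖(η k).d μ‖ :=
      real_inner_le_norm _ _
    rw [inner_sub_left, h2, h3, sub_zero] at h5
    linarith [mul_le_mul_of_nonneg_left h4 (norm_nonneg ((φ k).d μ - T))]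
  refine Approximable.of_tendsto_tests h1 ?_ fun K hK => tendsto_lintegral_comp
    (abs_sub_le_of_abs_deriv_le (hH.differentiable (by simp)) hC) (hL K hK)
  have h6 := tendsto_iff_norm_sub_tendsto_zero.1 hT
  have h7 := ((hT.norm.pow 2).const_mul (F 1)).add
    (h6.mul (hT.norm.const_mul (C ^ 2 + |F 1|)))
  simpa using h7

/-- The energies of `H i ∘ h` are at most `F i 1 cap(U)`, and these functions converge boundedly to
`h ^ τ`, because `h` has its values in `[0, 1]`. -/
theorem IsEquilibriumPotential.exists_hasHomDifferential_rpow [PreconnectedSpace M]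
    [μ.IsOpenPosMeasure] (hμ : IsWeightedVolume n μ) (hM : ¬ IsParabolic n μ) {τ : ℝ}
    (hτ : 1 / 2 < τ) {U : Set M} {h : M → ℝ} (hh : IsEquilibriumPotential n μ U h) :
    ∃ θ : CovectorField n M, HasHomDifferential μ (fun x => h x ^ τ) θ ∧
      formEnergy μ θ ≤ ENNReal.ofReal (τ ^ 2 / (2 * τ - 1)) * capacity n μ U := by
  obtain ⟨hm, φ, T, -, -, -, hcap, -, -⟩ := hh.exists_minimizing
  obtain ⟨H, F, hH, hF, hFH, hH', hC, -, hlim, hpow⟩ := exists_powerProfile hτ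
  have hmono : ∀ i, Monotone (H i) := fun i =>
    monotone_of_deriv_nonneg ((hH i).1.differentiable (by simp)) (hH' i)
  obtain ⟨B, hB⟩ : ∃ B, ∀ i, H i 1 ≤ B := by
    obtain ⟨B, hB⟩ := (hpow 1 zero_le_one le_rfl).bddAbove_range
    exact ⟨B, fun i => hB ⟨i, rfl⟩⟩
  have happ : Approximable n μ (fun x => h x ^ τ)
      (τ ^ 2 / (2 * τ - 1) * (capacity n μ U).toReal) := by
    refine Approximable.of_tendsto_ae (u := fun i x => H i (h x)) (B := B)
      (a := fun i => F i 1 * (capacity n μ U).toReal) (fun i => ?_) (hlim.mul_const _)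
      (fun i => (hH i).1.continuous.measurable.comp_aemeasurable hm) (fun i => ?_) ?_
    · obtain ⟨C, hC⟩ := hC i
      exact hh.approximable_comp (hH i).1 (hH i).2 (hF i).1 (hF i).2 (hFH i) hC
    · filter_upwards [hh.ae_mem_Icc hμ hM] with x hx
      rw [abs_of_nonneg ((hH i).2 ▸ hmono i hx.1)]
      exact (hmono i hx.2).trans (hB i)
    · filter_upwards [hh.ae_mem_Icc hμ hM] with x hx
      exact hpow _ hx.1 hx.2
  obtain ⟨θ, hθ, hE⟩ := happ.exists_hasHomDifferential μ (hm.pow_const τ)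
  refine ⟨θ, hθ, hE.trans_eq ?_⟩
  rw [ENNReal.ofReal_mul (div_nonneg (sq_nonneg _) (by linarith)), hcap,
    ENNReal.ofReal_toReal ENNReal.ofReal_ne_top]

end Equilibrium

/-! ### Self-adjoint operators and heat flows of quadratic forms -/

section Form

variable {T V H : Type*} [AddCommGroup T] [Module ℝ T]
  [NormedAddCommGroup V] [InnerProductSpace ℝ V] [CompleteSpace V]
  [NormedAddCommGroup H] [InnerProductSpace ℝ H] [CompleteSpace H]
  (J : T →ₗ[ℝ] V) (D : T →ₗ[ℝ] H)

/-- The closure, for the graph norm, of the operator `J φ ↦ D φ`. -/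
def closedGraph : Submodule ℝ (WithLp 2 (V × H)) :=
  (LinearMap.range ((WithLp.linearEquiv 2 ℝ (V × H)).symm.toLinearMap ∘ₗ
    J.prod D)).topologicalClosure

/-- Membership in the closure of the graph, in terms of sequences. -/
theorem mem_closedGraph_iff {z : WithLp 2 (V × H)} : z ∈ closedGraph J D ↔
    ∃ φ : ℕ → T, Tendsto (fun k => J (φ k)) atTop (𝓝 z.fst) ∧
      Tendsto (fun k => D (φ k)) atTop (𝓝 z.snd) := by
  have hcont : ∀ {f : ℕ → V} {g : ℕ → H}, Tendsto f atTop (𝓝 z.fst) →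
      Tendsto g atTop (𝓝 z.snd) →
      Tendsto (fun k => WithLp.toLp 2 (f k, g k)) atTop (𝓝 z) := fun hf hg =>
    ((WithLp.prod_continuous_toLp 2 V H).tendsto (z.fst, z.snd)).comp (hf.prodMk_nhds hg)
  rw [closedGraph, ← SetLike.mem_coe, Submodule.topologicalClosure_coe, mem_closure_iff_seq_limit]
  constructor
  · rintro ⟨x, hx, hxz⟩
    choose φ hφ using hx
    have h := ((WithLp.prod_continuous_ofLp 2 V H).tendsto z).comp hxz
    have h1 := (continuous_fst.tendsto _).comp h
    have h2 := (continuous_snd.tendsto _).comp h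
    refine ⟨φ, h1.congr fun k => ?_, h2.congr fun k => ?_⟩ <;>
    · simp only [Function.comp_apply, ← hφ]
      rfl
  · rintro ⟨φ, h1, h2⟩
    exact ⟨_, fun k => ⟨φ k, rfl⟩, hcont h1 h2⟩

/-- `Δ u = w` for the self-adjoint operator `Δ` associated with the closure of the quadratic form
`φ ↦ ‖D φ‖²`. -/
def FormLaplacian (u w : V) : Prop :=
  ∃ ζ : H, WithLp.toLp 2 (u, ζ) ∈ closedGraph J D ∧
    ∀ φ : T, inner ℝ ζ (D φ) = inner ℝ w (J φ)

variable {J D}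

/-- The weak equation defining `Δ`, stated for elements `φ ∈ T`, extends to the closed graph. -/
theorem inner_snd_eq_of_mem_closedGraph {w : V} {ζ : H}
    (h : ∀ φ : T, inner ℝ ζ (D φ) = inner ℝ w (J φ)) {z : WithLp 2 (V × H)}
    (hz : z ∈ closedGraph J D) : inner ℝ ζ z.snd = inner ℝ w z.fst := by
  obtain ⟨φ, h1, h2⟩ := (mem_closedGraph_iff J D).1 hz
  refine tendsto_nhds_unique ((tendsto_const_nhds (x := ζ)).inner h2) ?_
  simp_rw [h]
  exact (tendsto_const_nhds (x := w)).inner h1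

/-- The operator is symmetric. -/
theorem FormLaplacian.symm {u w p q : V} (h : FormLaplacian J D u w)
    (h' : FormLaplacian J D p q) : inner ℝ w p = inner ℝ u q := by
  obtain ⟨ζ, hζ, h1⟩ := h
  obtain ⟨ζ', hζ', h2⟩ := h'
  have h3 : inner ℝ ζ ζ' = inner ℝ w p := inner_snd_eq_of_mem_closedGraph h1 hζ'
  have h4 : inner ℝ ζ' ζ = inner ℝ q u := inner_snd_eq_of_mem_closedGraph h2 hζ
  rw [← h3, real_inner_comm, h4, real_inner_comm]

/-- The resolvent equation `p + Δ p = k` is solved by the Riesz representation theorem in the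
graph space. -/
theorem exists_formLaplacian_sub (k : V) : ∃ p : V, FormLaplacian J D p (k - p) := by
  have hcl : IsClosed (closedGraph J D : Set (WithLp 2 (V × H))) :=
    Submodule.isClosed_topologicalClosure _
  have : CompleteSpace (closedGraph J D) := hcl.completeSpace_coe
  let L : closedGraph J D →L[ℝ] ℝ :=
    (innerSL ℝ (WithLp.toLp 2 (k, (0 : H)))).comp (closedGraph J D).subtypeL
  let z := (InnerProductSpace.toDual ℝ (closedGraph J D)).symm L
  have hz : ∀ y : closedGraph J D, inner ℝ z y = L y := fun y =>
    InnerProductSpace.toDual_symm_apply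
  refine ⟨(z : WithLp 2 (V × H)).fst, (z : WithLp 2 (V × H)).snd, z.2, fun φ => ?_⟩
  have hmem : WithLp.toLp 2 (J φ, D φ) ∈ closedGraph J D :=
    (mem_closedGraph_iff J D).2 ⟨fun _ => φ, tendsto_const_nhds, tendsto_const_nhds⟩
  have h := hz ⟨_, hmem⟩
  have h1 : inner ℝ (z : WithLp 2 (V × H)) (WithLp.toLp 2 (J φ, D φ)) =
      inner ℝ (WithLp.toLp 2 (k, (0 : H))) (WithLp.toLp 2 (J φ, D φ)) := h
  rw [WithLp.prod_inner_apply, WithLp.prod_inner_apply] at h1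
  simp only [inner_zero_left, add_zero] at h1
  rw [inner_sub_left]
  have h2 : inner ℝ (z : WithLp 2 (V × H)).fst (J φ) + inner ℝ (z : WithLp 2 (V × H)).snd (D φ) =
    inner ℝ k (J φ) := h1
  linarith

/-- The operator is self-adjoint: everything in the domain of its adjoint is in its domain. -/
theorem formLaplacian_of_forall_inner {v w : V}
    (h : ∀ p q, FormLaplacian J D p q → inner ℝ v q = inner ℝ w p) : FormLaplacian J D v w := by
  -- `p₀ = (1 + Δ)⁻¹ (v + w)` should be `v`; test the difference against `(1 + Δ)⁻¹ (v - p₀)`.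
  obtain ⟨p₀, hp₀⟩ := exists_formLaplacian_sub (J := J) (D := D) (v + w)
  obtain ⟨p₁, hp₁⟩ := exists_formLaplacian_sub (J := J) (D := D) (v - p₀)
  have h1 := h p₁ _ hp₁
  have h2 := hp₀.symm hp₁
  have h3 : inner ℝ (v - p₀) (v - p₀) = (0 : ℝ) := by
    simp only [inner_sub_left, inner_sub_right, inner_add_left] at h1 h2 ⊢
    linarith
  have h4 : v = p₀ := by
    rw [inner_self_eq_zero, sub_eq_zero] at h3
    exact h3
  rw [← h4] at hp₀
  simpa using hp₀

variable (J D) in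
/-- `u' = -Δ u` on `(0,∞)` and `u(0+) = f`. -/
def IsFormFlow (f : V) (u : ℝ → V) : Prop :=
  (∀ t, 0 < t → ∃ w, FormLaplacian J D (u t) w ∧ HasDerivAt u (-w) t) ∧
    Tendsto u (𝓝[>] 0) (𝓝 f)

theorem IsFormFlow.continuousOn {f : V} {u : ℝ → V} (h : IsFormFlow J D f u) :
    ContinuousOn u (Ioi 0) := fun t ht => by
  obtain ⟨w, -, hw⟩ := h.1 t ht
  exact hw.continuousAt.continuousWithinAt

/-- The heat semigroup is symmetric: `⟨e^{-tΔ} f, g⟩ = ⟨f, e^{-tΔ} g⟩`. -/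
theorem IsFormFlow.inner_eq {f g : V} {u v : ℝ → V} (hu : IsFormFlow J D f u)
    (hv : IsFormFlow J D g v) {t : ℝ} (ht : 0 < t) : inner ℝ (u t) g = inner ℝ f (v t) := by
  -- `s ↦ ⟨u s, v (t - s)⟩` is constant on `(0,t)`; compare its limits at the two ends.
  have hder : ∀ s ∈ Ioo 0 t, HasDerivAt (fun s => inner ℝ (u s) (v (t - s))) 0 s := by
    intro s hs
    obtain ⟨w, hw, hdu⟩ := hu.1 s hs.1
    obtain ⟨w', hw', hdv⟩ := hv.1 (t - s) (sub_pos.2 hs.2)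
    have hdv' : HasDerivAt (fun s => v (t - s)) (- -w') s := by
      simpa [Function.comp_def] using hdv.scomp s ((hasDerivAt_id s).const_sub t)
    have h := hdu.inner ℝ hdv'
    rw [neg_neg, inner_neg_left, hw.symm hw', add_neg_cancel] at h
    exact h
  have hconst : ∀ a ∈ Ioo 0 t, ∀ b ∈ Ioo 0 t,
      inner ℝ (u a) (v (t - a)) = inner ℝ (u b) (v (t - b)) := fun a ha b hb =>
    (convex_Ioo 0 t).is_const_of_fderivWithin_eq_zero
      (fun s hs => (hder s hs).differentiableAt.differentiableWithinAt)
      (fun s hs => by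
        rw [fderivWithin_of_isOpen isOpen_Ioo hs]
        have := (hder s hs).hasFDerivAt.fderiv
        rw [this]
        ext
        simp) ha hb
  set c : ℝ := inner ℝ (u (t / 2)) (v (t - t / 2)) with hc
  have hmem : t / 2 ∈ Ioo 0 t := ⟨by linarith, by linarith⟩
  have hut : ContinuousAt u t := (hu.continuousOn.continuousAt (Ioi_mem_nhds ht))
  have hvt : ContinuousAt v t := (hv.continuousOn.continuousAt (Ioi_mem_nhds ht))
  have h1 : Tendsto (fun s => inner ℝ (u s) (v (t - s))) (𝓝[>] 0) (𝓝 (inner ℝ f (v t))) := by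
    refine hu.2.inner ?_
    have h2 : Tendsto (fun s : ℝ => t - s) (𝓝[>] 0) (𝓝 t) := by
      have h3 : Tendsto (fun s : ℝ => t - s) (𝓝 0) (𝓝 (t - 0)) :=
        (continuous_const.sub continuous_id).tendsto 0
      rw [sub_zero] at h3
      exact h3.mono_left nhdsWithin_le_nhds
    exact hvt.tendsto.comp h2
  have h2 : Tendsto (fun s => inner ℝ (u (t - s)) (v s)) (𝓝[>] 0) (𝓝 (inner ℝ (u t) g)) := by
    refine Tendsto.inner ?_ hv.2
    have h2 : Tendsto (fun s : ℝ => t - s) (𝓝[>] 0) (𝓝 t) := by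
      have h3 : Tendsto (fun s : ℝ => t - s) (𝓝 0) (𝓝 (t - 0)) :=
        (continuous_const.sub continuous_id).tendsto 0
      rw [sub_zero] at h3
      exact h3.mono_left nhdsWithin_le_nhds
    exact hut.tendsto.comp h2
  have hI : ∀ᶠ s in 𝓝[>] (0 : ℝ), s ∈ Ioo 0 t := Ioo_mem_nhdsGT ht
  have e1 : inner ℝ f (v t) = c := by
    refine tendsto_nhds_unique h1 (tendsto_const_nhds.congr' ?_)
    filter_upwards [hI] with s hs
    exact hconst _ hmem _ hs
  have e2 : inner ℝ (u t) g = c := by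
    refine tendsto_nhds_unique h2 (tendsto_const_nhds.congr' ?_)
    filter_upwards [hI] with s hs
    have h3 := hconst _ hmem (t - s) ⟨by linarith [hs.2], by linarith [hs.1]⟩
    rw [sub_sub_cancel] at h3
    exact h3
  rw [e1, e2]

/-- `Δ ∫_a^b u = u a - u b` along the heat flow. -/
theorem IsFormFlow.formLaplacian_integral {f : V} {u : ℝ → V} (hu : IsFormFlow J D f u)
    {a b : ℝ} (ha : 0 < a) (hab : a ≤ b) :
    FormLaplacian J D (∫ t in a..b, u t) (u a - u b) := by
  refine formLaplacian_of_forall_inner fun p q hpq => ?_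
  have hsub : Icc a b ⊆ Ioi 0 := fun t ht => ha.trans_le ht.1
  have hci : ContinuousOn u (uIcc a b) := by
    rw [uIcc_of_le hab]
    exact hu.continuousOn.mono hsub
  have hint : IntervalIntegrable u volume a b := hci.intervalIntegrable
  have hder : ∀ t ∈ uIcc a b, HasDerivAt (fun t => -inner ℝ (u t) p) (inner ℝ (u t) q) t := by
    intro t ht
    rw [uIcc_of_le hab] at ht
    obtain ⟨w, hw, hd⟩ := hu.1 t (hsub ht)
    have h := (hd.inner ℝ (hasDerivAt_const t p)).neg
    rw [inner_zero_right, zero_add, inner_neg_left, neg_neg, hw.symm hpq] at h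
    exact h
  have hci2 : ContinuousOn (fun t => inner ℝ (u t) q) (uIcc a b) :=
    hci.inner continuousOn_const
  have h1 := intervalIntegral.integral_eq_sub_of_hasDerivAt hder hci2.intervalIntegrable
  have h2 : ∫ t in a..b, inner ℝ (u t) q = inner ℝ (∫ t in a..b, u t) q := by
    have := ((innerSL ℝ q).intervalIntegral_comp_comm hint)
    simp only [innerSL_apply_apply] at this
    rw [real_inner_comm, ← this]
    simp_rw [real_inner_comm]
  rw [← h2, h1, inner_sub_left]
  ring

end Form

/-! ### Energy estimates and the sub-Markov property -/

/-- A convex function vanishing exactly on `(-∞,1]`, with smooth derivative. -/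
theorem exists_convex_penalty : ∃ Φ F : ℝ → ℝ, ContDiff ℝ ∞ F ∧ F 0 = 0 ∧ (∀ s, 0 ≤ deriv F s) ∧
    (∀ s, |deriv F s| ≤ 1) ∧ (∀ s, HasDerivAt Φ (F s) s) ∧ (∀ s, 0 ≤ Φ s) ∧
    ∀ s, Φ s = 0 ↔ s ≤ 1 := by
  have hST : ContDiff ℝ ∞ Real.smoothTransition := Real.smoothTransition.contDiff (n := ⊤)
  have hb : ContDiff ℝ ∞ fun s => Real.smoothTransition (s - 1) :=
    hST.comp (contDiff_id.sub contDiff_const)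
  -- A primitive vanishes on `(-∞,1]` and is positive on `(1,∞)` if its derivative is so.
  have key : ∀ f : ℝ → ℝ, ContDiff ℝ ∞ f → (∀ s, s ≤ 1 → f s = 0) → (∀ s, 1 < s → 0 < f s) →
      (∀ s, s ≤ 1 → ∫ t in (0 : ℝ)..s, f t = 0) ∧ ∀ s, 1 < s → 0 < ∫ t in (0 : ℝ)..s, f t := by
    intro f hf h0 h1
    have hz : ∀ s, s ≤ 1 → ∫ t in (0 : ℝ)..s, f t = 0 := fun s hs => by
      rw [intervalIntegral.integral_congr (g := fun _ => (0 : ℝ)) fun t ht => h0 t ?_]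
      · simp
      · exact ht.2.trans (max_le zero_le_one hs)
    obtain ⟨hF, hF'⟩ := contDiff_integral hf
    refine ⟨hz, fun s hs => ?_⟩
    have hmono : StrictMonoOn (fun s => ∫ t in (0 : ℝ)..s, f t) (Ici 1) :=
      strictMonoOn_of_deriv_pos (convex_Ici 1) hF.continuous.continuousOn fun t ht => by
        rw [interior_Ici] at ht
        rw [hF']
        exact h1 t ht
    have := hmono (mem_Ici.2 le_rfl) (mem_Ici.2 hs.le) hs
    simpa only [hz 1 le_rfl] using this
  obtain ⟨hF, hF'⟩ := contDiff_integral hb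
  obtain ⟨hF0, hF1⟩ := key _ hb
    (fun s hs => Real.smoothTransition.zero_of_nonpos (by linarith))
    (fun s hs => Real.smoothTransition.pos_of_pos (by linarith))
  set F : ℝ → ℝ := fun s => ∫ t in (0 : ℝ)..s, Real.smoothTransition (t - 1) with hFdef
  obtain ⟨hΦ, hΦ'⟩ := contDiff_integral hF
  obtain ⟨hΦ0, hΦ1⟩ := key F hF hF0 hF1
  refine ⟨fun s => ∫ t in (0 : ℝ)..s, F t, F, hF, hF0 0 zero_le_one, fun s => ?_, fun s => ?_,
    fun s => ?_, fun s => ?_, fun s => ⟨fun h => ?_, hΦ0 s⟩⟩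
  · rw [hF']
    exact Real.smoothTransition.nonneg _
  · rw [hF', abs_of_nonneg (Real.smoothTransition.nonneg _)]
    exact Real.smoothTransition.le_one _
  · have h := (hΦ.differentiable (by simp) s).hasDerivAt
    rwa [hΦ'] at h
  · rcases le_or_gt s 1 with h | h
    · exact (hΦ0 s h).ge
    · exact (hΦ1 s h).le
  · by_contra! hs
    exact (hΦ1 s hs).ne' h

theorem lipschitzWith_of_abs_deriv_le {F : ℝ → ℝ} (hF : Differentiable ℝ F) {C : ℝ}
    (hC : ∀ s, |deriv F s| ≤ C) : LipschitzWith C.toNNReal F :=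
  lipschitzWith_of_nnnorm_deriv_le hF fun s => by
    rw [← NNReal.coe_le_coe, coe_nnnorm, Real.norm_eq_abs]
    exact (hC s).trans (Real.le_coe_toNNReal C)

section Gradient

variable {X : Type*} [MeasurableSpace X] {ν : Measure X}

/-- The second order Taylor estimate, for a function with Lipschitz derivative. -/
theorem abs_sub_sub_mul_le {Φ F : ℝ → ℝ} (hΦ : ∀ s, HasDerivAt Φ (F s) s)
    (hF : LipschitzWith 1 F) (a b : ℝ) : |Φ b - Φ a - F a * (b - a)| ≤ (b - a) ^ 2 := by
  have hd : ∀ s, HasDerivAt (fun s => Φ s - F a * s) (F s - F a) s := fun s =>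
    ((hΦ s).sub ((hasDerivAt_id s).const_mul (F a))).congr_deriv (by rw [mul_one])
  have h := (convex_uIcc a b).norm_image_sub_le_of_norm_hasDerivWithin_le (C := |b - a|)
    (fun s _ => (hd s).hasDerivWithinAt) (fun s hs => ?_) left_mem_uIcc right_mem_uIcc
  · rw [Real.norm_eq_abs, Real.norm_eq_abs, abs_mul_abs_self] at h
    calc |Φ b - Φ a - F a * (b - a)| = |Φ b - F a * b - (Φ a - F a * a)| := by congr 1; ring
      _ ≤ (b - a) ^ 2 := by rw [sq]; exact h
  · have h1 := hF.dist_le_mul s a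
    rw [NNReal.coe_one, one_mul, Real.dist_eq, Real.dist_eq] at h1
    exact h1.trans (abs_sub_left_of_mem_uIcc hs)

theorem integrable_comp_Lp {Φ F : ℝ → ℝ} (hΦ : ∀ s, HasDerivAt Φ (F s) s) (hΦ0 : Φ 0 = 0)
    (hF : LipschitzWith 1 F) (hF0 : F 0 = 0) (v : Lp ℝ 2 ν) : Integrable (fun x => Φ (v x)) ν := by
  have hc : Continuous Φ := continuous_iff_continuousAt.2 fun s => (hΦ s).continuousAt
  refine Integrable.mono' (Lp.memLp v).integrable_sq
    (hc.comp_aestronglyMeasurable (Lp.aestronglyMeasurable v)) (Eventually.of_forall fun x => ?_)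
  have h := abs_sub_sub_mul_le hΦ hF 0 (v x)
  simpa [hΦ0, hF0] using h

/-- The functional `v ↦ ∫ Φ(v)` on `L²` has gradient `Φ'(v)`. -/
theorem hasFDerivAt_integral_comp {Φ F : ℝ → ℝ} (hΦ : ∀ s, HasDerivAt Φ (F s) s) (hΦ0 : Φ 0 = 0)
    (hF : LipschitzWith 1 F) (hF0 : F 0 = 0) (v : Lp ℝ 2 ν) :
    HasFDerivAt (fun v : Lp ℝ 2 ν => ∫ x, Φ (v x) ∂ν) (innerSL ℝ (hF.compLp hF0 v)) v := by
  have hbound : ∀ u : Lp ℝ 2 ν, ‖∫ x, Φ (u x) ∂ν - ∫ x, Φ (v x) ∂ν -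
      innerSL ℝ (hF.compLp hF0 v) (u - v)‖ ≤ ‖u - v‖ ^ 2 := by
    intro u
    have hi := integrable_comp_Lp (ν := ν) hΦ hΦ0 hF hF0
    have hin : Integrable (fun x => inner ℝ (hF.compLp hF0 v x) ((u - v) x)) ν :=
      L2.integrable_inner _ _
    have hi2 : Integrable (fun x => Φ (u x) - Φ (v x)) ν := (hi u).sub (hi v)
    rw [innerSL_apply_apply, L2.inner_def, ← integral_sub (hi u) (hi v), ← integral_sub hi2 hin,
      ← real_inner_self_eq_norm_sq (u - v), L2.inner_def]
    refine norm_integral_le_of_norm_le (L2.integrable_inner (𝕜 := ℝ) (u - v) (u - v)) ?_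
    filter_upwards [hF.coeFn_compLp hF0 v, Lp.coeFn_sub u v] with x h1 h2
    rw [h1, h2, Pi.sub_apply, real_inner_self_eq_norm_sq, Real.norm_eq_abs, Real.norm_eq_abs,
      sq_abs]
    refine le_trans (le_of_eq ?_) (abs_sub_sub_mul_le hΦ hF (v x) (u x))
    congr 1
    simp [mul_comm]
  refine HasFDerivAt.of_isLittleO ?_
  refine Asymptotics.IsBigO.trans_isLittleO (g := fun u => ‖u - v‖ ^ 2)
    (Asymptotics.IsBigO.of_bound 1 (Eventually.of_forall fun u => ?_)) ?_
  · simpa using hbound u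
  · have h1 : Tendsto (fun u : Lp ℝ 2 ν => u - v) (𝓝 v) (𝓝 0) := by
      have h2 : Tendsto (fun u : Lp ℝ 2 ν => u - v) (𝓝 v) (𝓝 (v - v)) :=
        (continuous_id.sub continuous_const).tendsto v
      rwa [sub_self] at h2
    exact (Asymptotics.isLittleO_norm_pow_id one_lt_two).comp_tendsto h1

end Gradient

section Energy

variable {μ}

theorem Test.toL2_comp (φ : Test n M) {F : ℝ → ℝ} (hF : ContDiff ℝ ∞ F) (h0 : F 0 = 0) {C : NNReal}
    (hL : LipschitzWith C F) : (φ.comp F hF h0).toL2 μ = hL.compLp h0 (φ.toL2 μ) := by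
  refine Lp.ext ?_
  filter_upwards [(φ.comp F hF h0).coeFn_toL2 μ, hL.coeFn_compLp h0 (φ.toL2 μ), φ.coeFn_toL2 μ]
    with x h1 h2 h3
  rw [h1, h2, Function.comp_apply, h3]
  rfl

/-- If `Δ v = w`, then `∫ ⟨dv, dF(v)⟩ = ∫ w F(v)`, the left side being understood along test
functions converging to `v`. -/
theorem exists_tendsto_of_formLaplacian {v w : Lp ℝ 2 μ}
    (h : FormLaplacian (Test.toL2 (n := n) (M := M) μ) (Test.d μ) v w) :
    ∃ φ : ℕ → Test n M, Tendsto (fun k => (φ k).toL2 μ) atTop (𝓝 v) ∧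
      ∀ (F : ℝ → ℝ) (hF : ContDiff ℝ ∞ F) (h0 : F 0 = 0) (C : NNReal)
        (hL : LipschitzWith C F),
        Tendsto (fun k => inner ℝ ((φ k).d μ) (((φ k).comp F hF h0).d μ)) atTop
          (𝓝 (inner ℝ w (hL.compLp h0 v))) := by
  obtain ⟨ζ, hmem, hζ⟩ := h
  obtain ⟨φ, h1, h2⟩ := (mem_closedGraph_iff _ _).1 hmem
  refine ⟨φ, h1, fun F hF h0 C hL => ?_⟩
  have hC : ∀ s, |deriv F s| ≤ C := fun s => norm_deriv_le_of_lipschitz hL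
  have h2' : Tendsto (fun k => (φ k).d μ) atTop (𝓝 ζ) := h2
  have h1' : Tendsto (fun k => (φ k).toL2 μ) atTop (𝓝 v) := h1
  have e : ∀ k, inner ℝ ((φ k).d μ) (((φ k).comp F hF h0).d μ) =
      inner ℝ ((φ k).d μ - ζ) (((φ k).comp F hF h0).d μ) +
        inner ℝ w (hL.compLp h0 ((φ k).toL2 μ)) := fun k => by
    rw [inner_sub_left, hζ, Test.toL2_comp _ hF h0 hL]
    ring
  simp_rw [e]
  have h3 : Tendsto (fun k => inner ℝ ((φ k).d μ - ζ) (((φ k).comp F hF h0).d μ)) atTop (𝓝 0) := by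
    refine squeeze_zero_norm (a := fun k => ‖(φ k).d μ - ζ‖ * (C * ‖(φ k).d μ‖)) (fun k => ?_) ?_
    · exact (norm_inner_le_norm _ _).trans
        (mul_le_mul_of_nonneg_left ((φ k).norm_d_comp_le μ hF h0 hC) (norm_nonneg _))
    · have h4 := (tendsto_iff_norm_sub_tendsto_zero.1 h2').mul (h2'.norm.const_mul (C : ℝ))
      rwa [zero_mul] at h4
  have h4 := ((hL.continuous_compLp h0).tendsto v).comp h1'
  have h5 := h3.add ((tendsto_const_nhds (x := w)).inner h4)
  rwa [zero_add] at h5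

/-- If `F` is increasing, then `∫ F(v) Δ v ≥ 0`. -/
theorem inner_compLp_nonneg_of_formLaplacian {v w : Lp ℝ 2 μ}
    (h : FormLaplacian (Test.toL2 (n := n) (M := M) μ) (Test.d μ) v w) {F : ℝ → ℝ}
    (hF : ContDiff ℝ ∞ F) (h0 : F 0 = 0) {C : NNReal} (hL : LipschitzWith C F)
    (hF' : ∀ s, 0 ≤ deriv F s) : 0 ≤ inner ℝ w (hL.compLp h0 v) := by
  obtain ⟨φ, -, hφ⟩ := exists_tendsto_of_formLaplacian h
  exact ge_of_tendsto' (hφ F hF h0 C hL) fun k => (φ k).inner_d_comp_nonneg μ hF h0 hF'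

/-- If `F' = (H')²`, then `H(v)` has energy at most `∫ F(v) Δ v`. -/
theorem approximable_comp_of_formLaplacian {v w : Lp ℝ 2 μ}
    (h : FormLaplacian (Test.toL2 (n := n) (M := M) μ) (Test.d μ) v w) {H F : ℝ → ℝ}
    (hH : ContDiff ℝ ∞ H) (hH0 : H 0 = 0) {B : ℝ} (hB : ∀ s, |deriv H s| ≤ B)
    (hF : ContDiff ℝ ∞ F) (h0 : F 0 = 0) {C : NNReal} (hL : LipschitzWith C F)
    (hFH : ∀ s, deriv F s = deriv H s ^ 2) :
    Approximable n μ (fun x => H (v x)) (inner ℝ w (hL.compLp h0 v)) := by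
  obtain ⟨φ, hv, hφ⟩ := exists_tendsto_of_formLaplacian h
  refine Approximable.of_tendsto_tests (φ := fun k => (φ k).comp H hH hH0)
    (fun k => ((φ k).inner_d_comp_eq μ hF h0 hH hH0 hFH).ge) (hφ F hF h0 C hL) fun K hK => ?_
  refine tendsto_lintegral_comp (abs_sub_le_of_abs_deriv_le (hH.differentiable (by simp)) hB) ?_
  have h1 : ∀ k, ∫⁻ x in K, ‖(φ k : M → ℝ) x - v x‖ₑ ^ 2 ∂μ ≤
      ENNReal.ofReal (‖(φ k).toL2 μ - v‖ ^ 2) := fun k => by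
    rw [← lintegral_enorm_sq_eq_ofReal]
    refine (setLIntegral_le_lintegral _ _).trans_eq (lintegral_congr_ae ?_)
    filter_upwards [(φ k).coeFn_toL2 μ, Lp.coeFn_sub ((φ k).toL2 μ) v] with x h1 h2
    rw [h2, Pi.sub_apply, h1]
  refine tendsto_of_tendsto_of_tendsto_of_le_of_le tendsto_const_nhds ?_ (fun k => zero_le) h1
  simpa using ENNReal.tendsto_ofReal ((tendsto_iff_norm_sub_tendsto_zero.1 hv).pow 2)

/-- The heat semigroup is sub-Markovian: `f ≤ 1` implies `e^{-tΔ} f ≤ 1`. -/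
theorem IsFormFlow.ae_le_one {f : Lp ℝ 2 μ} {u : ℝ → Lp ℝ 2 μ}
    (hu : IsFormFlow (Test.toL2 (n := n) (M := M) μ) (Test.d μ) f u) (hf : ∀ᵐ x ∂μ, f x ≤ 1)
    {t : ℝ} (ht : 0 < t) : ∀ᵐ x ∂μ, u t x ≤ 1 := by
  obtain ⟨Φ, F, hF, hF0, hF', hF1, hΦ, hΦ0, hΦ1⟩ := exists_convex_penalty
  have hL := lipschitzWith_of_abs_deriv_le (hF.differentiable (by simp)) hF1
  rw [Real.toNNReal_one] at hL
  have h00 : Φ 0 = 0 := (hΦ1 0).2 zero_le_one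
  have hN := hasFDerivAt_integral_comp (ν := μ) hΦ h00 hL hF0
  -- `N` penalizes values above `1`. It does not increase along the flow, as its derivative is `-∫
  -- F(u) Δ u ≤ 0`, and it vanishes at the initial value.
  set N : Lp ℝ 2 μ → ℝ := fun v => ∫ x, Φ (v x) ∂μ with hNdef
  have hder : ∀ s, 0 < s → ∃ a ≤ 0, HasDerivAt (fun s => N (u s)) a s := fun s hs => by
    obtain ⟨w, hw, hd⟩ := hu.1 s hs
    refine ⟨_, ?_, (hN (u s)).comp_hasDerivAt s hd⟩
    have h1 := inner_compLp_nonneg_of_formLaplacian hw hF hF0 hL hF'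
    rw [innerSL_apply_apply, inner_neg_right, real_inner_comm]
    linarith
  have hanti : AntitoneOn (fun s => N (u s)) (Ioi 0) := by
    refine antitoneOn_of_deriv_nonpos (convex_Ioi 0) (fun s hs => ?_) (fun s hs => ?_)
      fun s hs => ?_
    · obtain ⟨a, -, ha⟩ := hder s hs
      exact ha.continuousAt.continuousWithinAt
    · rw [interior_Ioi] at hs
      obtain ⟨a, -, ha⟩ := hder s hs
      exact ha.differentiableAt.differentiableWithinAt
    · rw [interior_Ioi] at hs
      obtain ⟨a, ha0, ha⟩ := hder s hs
      rwa [ha.deriv]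
  have hf0 : N f = 0 := by
    refine integral_eq_zero_of_ae ?_
    filter_upwards [hf] with x hx
    exact (hΦ1 _).2 hx
  have hlim : Tendsto (fun s => N (u s)) (𝓝[>] 0) (𝓝 0) := by
    have h := (hN f).continuousAt.tendsto.comp hu.2
    rwa [hf0] at h
  have hle : N (u t) ≤ 0 := by
    refine ge_of_tendsto hlim ?_
    filter_upwards [Ioo_mem_nhdsGT ht] with s hs
    exact hanti hs.1 ht hs.2.le
  have hzero : N (u t) = 0 := le_antisymm hle (integral_nonneg fun x => hΦ0 _)
  have hae := (integral_eq_zero_iff_of_nonneg (fun x => hΦ0 _)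
    (integrable_comp_Lp hΦ h00 hL hF0 (u t))).1 hzero
  filter_upwards [hae] with x hx
  exact (hΦ1 _).1 hx

end Energy

/-! ### Heat flows of functions -/

section Bridge

variable {μ}

theorem memLp_of_lintegral_sub_lt_top {X : Type*} [MeasurableSpace X] {ν : Measure X}
    {f u : X → ℝ} (hf : MemLp f 2 ν) (hu : AEMeasurable u ν)
    (h : ∫⁻ x, ‖f x - u x‖ₑ ^ 2 ∂ν < ⊤) : MemLp u 2 ν := by
  have h1 : MemLp (fun x => f x - u x) 2 ν := by
    refine ⟨hf.1.sub hu.aestronglyMeasurable, ?_⟩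
    rw [lintegral_enorm_sq_eq_eLpNorm_sq] at h
    exact (ENNReal.pow_lt_top_iff.1 h).resolve_right two_ne_zero
  refine (hf.sub h1).ae_eq (Eventually.of_forall fun x => ?_)
  simp

theorem lintegral_sub_eq_ofReal {X : Type*} [MeasurableSpace X] {ν : Measure X}
    {f g : X → ℝ} (hf : MemLp f 2 ν) (hg : MemLp g 2 ν) :
    ∫⁻ x, ‖f x - g x‖ₑ ^ 2 ∂ν = ENNReal.ofReal (‖hf.toLp f - hg.toLp g‖ ^ 2) := by
  rw [← lintegral_enorm_sq_eq_ofReal]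
  refine lintegral_congr_ae ?_
  filter_upwards [Lp.coeFn_sub (hf.toLp f) (hg.toLp g), hf.coeFn_toLp, hg.coeFn_toLp]
    with x h1 h2 h3
  rw [h1, Pi.sub_apply, h2, h3]

theorem tendsto_norm_of_tendsto_ofReal_sq {ι V : Type*} [SeminormedAddCommGroup V] {l : Filter ι}
    {f : ι → V} (h : Tendsto (fun i => ENNReal.ofReal (‖f i‖ ^ 2)) l (𝓝 0)) :
    Tendsto f l (𝓝 0) := by
  have h1 := (ENNReal.tendsto_toReal ENNReal.zero_ne_top).comp h
  have h2 : Tendsto (fun i => ‖f i‖ ^ 2) l (𝓝 0) :=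
    h1.congr fun i => by rw [Function.comp_apply, ENNReal.toReal_ofReal (by positivity)]
  have h3 := h2.sqrt
  rw [tendsto_zero_iff_norm_tendsto_zero]
  simpa using h3

theorem HasLaplacian.memLp {u w : M → ℝ} (h : HasLaplacian n μ u w) : MemLp u 2 μ := by
  obtain ⟨-, θ, ⟨hm, -, φ, hφ, -, hL⟩, -⟩ := h
  obtain ⟨k, hk⟩ := (hL.eventually_lt_const ENNReal.zero_lt_top).exists
  exact memLp_of_lintegral_sub_lt_top (Test.memLp μ ⟨φ k, hφ k⟩) hm hk

/-- The weak Laplacian of functions is the abstract operator of the Dirichlet form on `L²`. -/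
theorem HasLaplacian.formLaplacian {u w : M → ℝ} (h : HasLaplacian n μ u w) :
    FormLaplacian (Test.toL2 (n := n) (M := M) μ) (Test.d μ) (h.memLp.toLp u) (h.1.toLp w) := by
  obtain ⟨-, θ, ⟨-, hθ, φ', hφ', hd, hL⟩, hint⟩ := id h
  set φ : ℕ → Test n M := fun k => ⟨φ' k, hφ' k⟩ with hφ
  obtain ⟨hLp, hT⟩ := exists_tendsto_d (φ := φ) hθ hd
  refine ⟨hLp.toLp _, (mem_closedGraph_iff _ _).2 ⟨φ, ?_, hT⟩, fun ψ => ?_⟩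
  · have h1 : ∀ k, ∫⁻ x, ‖φ' k x - u x‖ₑ ^ 2 ∂μ =
        ENNReal.ofReal (‖(φ k).toL2 μ - h.memLp.toLp u‖ ^ 2) := fun k =>
      lintegral_sub_eq_ofReal ((φ k).memLp μ) h.memLp
    simp_rw [h1] at hL
    exact tendsto_sub_nhds_zero_iff.1 (tendsto_norm_of_tendsto_ofReal_sq hL)
  · rw [L2.inner_def, L2.inner_def]
    calc ∫ x, inner ℝ (hLp.toLp (coords θ) x) (ψ.d μ x) ∂μ
        = ∫ x, covectorInner (θ x) (differential n (ψ : M → ℝ) x) ∂μ := by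
          refine integral_congr_ae ?_
          filter_upwards [hLp.coeFn_toLp, ψ.coeFn_d μ] with x h1 h2
          rw [h1, h2, inner_coords]
      _ = ∫ x, w x * (ψ : M → ℝ) x ∂μ := hint ψ ψ.2
      _ = _ := by
          refine integral_congr_ae ?_
          filter_upwards [h.1.coeFn_toLp, ψ.coeFn_toL2 μ] with x h1 h2
          rw [h1, h2]
          simp [mul_comm]

/-- A heat flow of functions defines a heat flow in the space `L²` of classes. -/
theorem IsHeatFlow.exists_isFormFlow {f : M → ℝ} {u : ℝ → M → ℝ} (h : IsHeatFlow n μ f u)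
    (hf : MemLp f 2 μ) : ∃ U : ℝ → Lp ℝ 2 μ,
      IsFormFlow (Test.toL2 (n := n) (M := M) μ) (Test.d μ) (hf.toLp f) U ∧
        ∀ t, 0 < t → U t =ᵐ[μ] u t := by
  classical
  have hmem : ∀ t, 0 < t → MemLp (u t) 2 μ := fun t ht => by
    obtain ⟨w, hw, -⟩ := h.1 t ht
    exact hw.memLp
  -- The functions `u t` need not be square integrable for `t ≤ 0`, so the flow is set to `0`
  -- there.
  let U : ℝ → Lp ℝ 2 μ := fun t => if ht : 0 < t then (hmem t ht).toLp (u t) else 0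
  have hU : ∀ t (ht : 0 < t), U t = (hmem t ht).toLp (u t) := fun t ht => dif_pos ht
  refine ⟨U, ⟨fun t ht => ?_, ?_⟩, fun t ht => ?_⟩
  · obtain ⟨w, hw, hd⟩ := h.1 t ht
    refine ⟨hw.1.toLp w, ?_, ?_⟩
    · rw [hU t ht]
      exact hw.formLaplacian
    · rw [hasDerivAt_iff_tendsto_slope_zero, ← tendsto_sub_nhds_zero_iff]
      refine tendsto_norm_of_tendsto_ofReal_sq (hd.congr' ?_)
      have hev : ∀ᶠ s in 𝓝[≠] (0 : ℝ), 0 < t + s := by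
        have h1 : ∀ᶠ s in 𝓝 (0 : ℝ), 0 < t + s := by
          filter_upwards [Ioi_mem_nhds (neg_lt_zero.2 ht)] with s hs
          linarith [mem_Ioi.1 hs]
        exact h1.filter_mono nhdsWithin_le_nhds
      filter_upwards [hev] with s hs
      rw [hU t ht, hU _ hs, ← lintegral_enorm_sq_eq_ofReal, sub_neg_eq_add]
      refine lintegral_congr_ae ?_
      filter_upwards [Lp.coeFn_add (s⁻¹ • ((hmem _ hs).toLp (u (t + s)) - (hmem t ht).toLp (u t)))
        (hw.1.toLp w), Lp.coeFn_smul s⁻¹ ((hmem _ hs).toLp (u (t + s)) - (hmem t ht).toLp (u t)),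
        Lp.coeFn_sub ((hmem _ hs).toLp (u (t + s))) ((hmem t ht).toLp (u t)),
        (hmem _ hs).coeFn_toLp, (hmem t ht).coeFn_toLp, hw.1.coeFn_toLp] with x h1 h2 h3 h4 h5 h6
      rw [h1, Pi.add_apply, h2, Pi.smul_apply, h3, Pi.sub_apply, h4, h5, h6, smul_eq_mul,
        div_eq_inv_mul]
  · rw [← tendsto_sub_nhds_zero_iff]
    refine tendsto_norm_of_tendsto_ofReal_sq (h.2.congr' ?_)
    filter_upwards [self_mem_nhdsWithin] with t ht
    rw [hU t ht]
    exact lintegral_sub_eq_ofReal _ _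
  · rw [hU t ht]
    exact (hmem t ht).coeFn_toLp

end Bridge

/-! ### The heat kernel -/

theorem FormLaplacian.smul {T V H : Type*} [AddCommGroup T] [Module ℝ T]
    [NormedAddCommGroup V] [InnerProductSpace ℝ V] [NormedAddCommGroup H] [InnerProductSpace ℝ H]
    [CompleteSpace V] [CompleteSpace H]
    {J : T →ₗ[ℝ] V} {D : T →ₗ[ℝ] H} {u w : V} (h : FormLaplacian J D u w) (c : ℝ) :
    FormLaplacian J D (c • u) (c • w) := by
  obtain ⟨ζ, h1, h2⟩ := h
  refine ⟨c • ζ, (closedGraph J D).smul_mem c h1, fun φ => ?_⟩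
  rw [real_inner_smul_left, real_inner_smul_left, h2]

section Kernel

variable {μ}

theorem Approximable.mono {u : M → ℝ} {E E' : ℝ} (h : Approximable n μ u E) (hE : E ≤ E') :
    Approximable n μ u E' := fun K hK ε hε => by
  obtain ⟨φ, h1, h2⟩ := h K hK ε hε
  exact ⟨φ, h1, by linarith⟩

theorem Approximable.congr_ae {u v : M → ℝ} {E : ℝ} (h : Approximable n μ u E) (huv : u =ᵐ[μ] v) :
    Approximable n μ v E := fun K hK ε hε => by
  obtain ⟨φ, h1, h2⟩ := h K hK ε hε
  refine ⟨φ, le_of_eq_of_le (lintegral_congr_ae ?_) h1, h2⟩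
  filter_upwards [ae_restrict_of_ae huv] with x hx
  rw [hx]

/-- The characteristic function of a compact set, as an element of `L²`. -/
def indicatorL2 (μ : Measure M) [IsFiniteMeasureOnCompacts μ] {K : Set M} (hK : IsCompact K) :
    Lp ℝ 2 μ :=
  indicatorConstLp 2 hK.measurableSet hK.measure_lt_top.ne 1

theorem inner_indicatorL2_left {K : Set M} (hK : IsCompact K) (f : Lp ℝ 2 μ) :
    inner ℝ (indicatorL2 μ hK) f = ∫ x in K, f x ∂μ :=
  L2.inner_indicatorConstLp_one hK.measurableSet hK.measure_lt_top.ne f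

theorem inner_indicatorL2_right {K : Set M} (hK : IsCompact K) (f : Lp ℝ 2 μ) :
    inner ℝ f (indicatorL2 μ hK) = ∫ x in K, f x ∂μ := by
  rw [real_inner_comm, inner_indicatorL2_left]

/-- The heat flow starting from the characteristic function of a compact set. -/
theorem IsHeatKernel.exists_isFormFlow {P : ℝ → M → M → ℝ} (hP : IsHeatKernel n μ P) {K : Set M}
    (hK : IsCompact K) : ∃ U : ℝ → Lp ℝ 2 μ,
      IsFormFlow (Test.toL2 (n := n) (M := M) μ) (Test.d μ) (indicatorL2 μ hK) U ∧
        ∀ t, 0 < t → U t =ᵐ[μ] fun x => ∫ y in K, P t x y ∂μ := by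
  have hf : MemLp (K.indicator fun _ => (1 : ℝ)) 2 μ :=
    memLp_indicator_const 2 hK.measurableSet 1 (Or.inr hK.measure_lt_top.ne)
  obtain ⟨U, hU, hUt⟩ := (hP.2.2 _ hf
    (HasCompactSupport.intro hK fun x hx => indicator_of_notMem hx _)).exists_isFormFlow hf
  refine ⟨U, hU, fun t ht => (hUt t ht).trans (Eventually.of_forall fun x => ?_)⟩
  simp only
  rw [← integral_indicator hK.measurableSet]
  congr 1
  funext y
  by_cases hy : y ∈ K <;> simp [hy]

theorem IsHeatKernel.ae_nonneg {P : ℝ → M → M → ℝ} (hP : IsHeatKernel n μ P) {K : Set M}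
    {U : ℝ → Lp ℝ 2 μ} (hU : ∀ t, 0 < t → U t =ᵐ[μ] fun x => ∫ y in K, P t x y ∂μ) {t : ℝ}
    (ht : 0 < t) : ∀ᵐ x ∂μ, 0 ≤ U t x := by
  filter_upwards [hU t ht] with x hx
  rw [hx]
  exact integral_nonneg fun y => (hP.2.1 t ht x y).le

theorem IsHeatKernel.continuous {P : ℝ → M → M → ℝ} (hP : IsHeatKernel n μ P) {t : ℝ}
    (ht : 0 < t) : Continuous fun p : M × M => P t p.1 p.2 :=
  hP.1.comp_continuous (f := fun p : M × M => (t, p.1, p.2)) (by fun_prop) fun p => ⟨ht, trivial⟩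

/-- The heat kernel is symmetric, since the heat semigroup is. -/
theorem IsHeatKernel.symm [μ.IsOpenPosMeasure] {P : ℝ → M → M → ℝ} (hP : IsHeatKernel n μ P)
    {t : ℝ} (ht : 0 < t) (x y : M) : P t x y = P t y x := by
  have : LocallyCompactSpace M := ChartedSpace.locallyCompactSpace (EuclideanSpace ℝ (Fin n)) M
  suffices h : ∀ x y, P t x y ≤ P t y x from le_antisymm (h x y) (h y x)
  clear x y
  intro x₀ y₀
  by_contra! hlt
  -- If `P t y₀ x₀ < b < a < P t x₀ y₀`, these inequalities persist on a product `A ×ˢ B` of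
  -- neighbourhoods of `x₀` and `y₀`, and contradict `⟨e^{-tΔ} 1_B, 1_A⟩ = ⟨1_B, e^{-tΔ} 1_A⟩`.
  obtain ⟨b, hb1, hb2⟩ := exists_between hlt
  obtain ⟨a, ha1, ha2⟩ := exists_between hb2
  have hc1 := hP.continuous ht
  have hc2 : Continuous fun p : M × M => P t p.2 p.1 := hc1.comp continuous_swap
  have hnhds : {p : M × M | a < P t p.1 p.2 ∧ P t p.2 p.1 < b} ∈ 𝓝 (x₀, y₀) :=
    ((isOpen_lt continuous_const hc1).inter (isOpen_lt hc2 continuous_const)).mem_nhds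
      ⟨ha2, hb1⟩
  obtain ⟨A', hA', B', hB', hAB⟩ := mem_nhds_prod_iff.1 hnhds
  obtain ⟨A, hA, hAA', hAc⟩ := local_compact_nhds hA'
  obtain ⟨B, hB, hBB', hBc⟩ := local_compact_nhds hB'
  have hpos : ∀ {S : Set M} {z : M}, S ∈ 𝓝 z → IsCompact S → 0 < μ.real S := fun hS hSc =>
    ENNReal.toReal_pos (Measure.measure_pos_of_mem_nhds μ hS).ne' hSc.measure_lt_top.ne
  obtain ⟨U, hU, hUP⟩ := hP.exists_isFormFlow hAc
  obtain ⟨W, hW, hWP⟩ := hP.exists_isFormFlow hBc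
  have key := hW.inner_eq hU ht
  rw [inner_indicatorL2_right, inner_indicatorL2_left,
    setIntegral_congr_ae hAc.measurableSet ((hWP t ht).mono fun x hx _ => hx),
    setIntegral_congr_ae hBc.measurableSet ((hUP t ht).mono fun x hx _ => hx)] at key
  have hci : ∀ {S : Set M}, IsCompact S → Continuous fun x => ∫ y in S, P t x y ∂μ := fun hS =>
    continuous_parametric_integral_of_continuous (f := fun x y => P t x y) hc1 hS
  have hcx : ∀ x, Continuous fun y => P t x y := fun x =>
    hc1.comp (continuous_const.prodMk continuous_id)
  have h1 : a * μ.real B * μ.real A ≤ ∫ x in A, ∫ y in B, P t x y ∂μ ∂μ :=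
    setIntegral_ge_of_const_le_real hAc.measurableSet hAc.measure_lt_top.ne
      (fun x hx => setIntegral_ge_of_const_le_real hBc.measurableSet hBc.measure_lt_top.ne
        (fun y hy => (hAB (mk_mem_prod (hAA' hx) (hBB' hy))).1.le)
        ((hcx x).continuousOn.integrableOn_compact hBc))
      ((hci hBc).continuousOn.integrableOn_compact hAc)
  have h2 : ∫ x in B, ∫ y in A, P t x y ∂μ ∂μ ≤ b * μ.real A * μ.real B := by
    have hle : ∀ x ∈ B, ∫ y in A, P t x y ∂μ ≤ b * μ.real A := fun x hx => by
      have h := setIntegral_mono_on ((hcx x).continuousOn.integrableOn_compact (μ := μ) hAc)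
        (integrableOn_const (C := b) hAc.measure_lt_top.ne) hAc.measurableSet
        fun y hy => (hAB (mk_mem_prod (hAA' hy) (hBB' hx))).2.le
      rwa [setIntegral_const, smul_eq_mul, mul_comm] at h
    have h := setIntegral_mono_on ((hci hAc).continuousOn.integrableOn_compact (μ := μ) hBc)
      (integrableOn_const hBc.measure_lt_top.ne) hBc.measurableSet hle
    rwa [setIntegral_const, smul_eq_mul, mul_comm (μ.real B)] at h
  have h3 := mul_pos (hpos hA hAc) (hpos hB hBc)
  nlinarith

/-- Duality between the sub-Markov property and the contraction in `L¹`: against a function with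
values in `[0,B]`, the heat flow of the characteristic function of `K` has integral at most
`B μ(K)`. -/
theorem IsHeatKernel.inner_le {P : ℝ → M → M → ℝ} (hP : IsHeatKernel n μ P) {K : Set M}
    (hK : IsCompact K) {U : ℝ → Lp ℝ 2 μ}
    (hU : IsFormFlow (Test.toL2 (n := n) (M := M) μ) (Test.d μ) (indicatorL2 μ hK) U)
    (hUP : ∀ t, 0 < t → U t =ᵐ[μ] fun x => ∫ y in K, P t x y ∂μ) {t : ℝ} (ht : 0 < t)
    {g : Lp ℝ 2 μ} {B : ℝ} (hB : 0 ≤ B) (hg : ∀ᵐ x ∂μ, g x ≤ B) :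
    inner ℝ (U t) g ≤ B * μ.real K := by
  have : LocallyCompactSpace M := ChartedSpace.locallyCompactSpace (EuclideanSpace ℝ (Fin n)) M
  let S : CompactExhaustion M := default
  have hint : Integrable (fun x => inner ℝ (U t x) (g x)) μ := L2.integrable_inner (𝕜 := ℝ) _ _
  have hlim := tendsto_setIntegral_of_monotone (μ := μ) (f := fun x => inner ℝ (U t x) (g x))
    (s := fun m => S m) (fun m => (S.isCompact m).measurableSet) (fun i j hij => S.subset hij)
    hint.integrableOn
  rw [S.iUnion_eq, setIntegral_univ, ← L2.inner_def] at hlim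
  refine le_of_tendsto' hlim fun m => ?_
  obtain ⟨W, hW, -⟩ := hP.exists_isFormFlow (S.isCompact m)
  have hW1 : ∀ᵐ x ∂μ, W t x ≤ 1 := hW.ae_le_one (by
    filter_upwards [indicatorConstLp_coeFn (p := 2) (hs := (S.isCompact m).measurableSet)
      (hμs := (S.isCompact m).measure_lt_top.ne) (c := (1 : ℝ))] with x hx
    rw [indicatorL2, hx]
    exact indicator_le_self' (fun _ _ => zero_le_one) x) ht
  have hUi : IntegrableOn (U t) (S m) μ :=
    integrableOn_Lp_of_measure_ne_top (U t) one_le_two (S.isCompact m).measure_lt_top.ne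
  calc ∫ x in S m, inner ℝ (U t x) (g x) ∂μ ≤ ∫ x in S m, B * U t x ∂μ := by
        refine setIntegral_mono_ae hint.integrableOn (hUi.const_mul B) ?_
        filter_upwards [hP.ae_nonneg hUP ht, hg] with x h1 h2
        simp only [RCLike.inner_apply, conj_trivial]
        exact mul_le_mul_of_nonneg_right h2 h1
    _ = B * inner ℝ (indicatorL2 μ (S.isCompact m)) (U t) := by
        rw [integral_const_mul, inner_indicatorL2_left]
    _ = B * inner ℝ (indicatorL2 μ hK) (W t) := by
        rw [real_inner_comm, hU.inner_eq hW ht]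
    _ ≤ B * μ.real K := by
        refine mul_le_mul_of_nonneg_left ?_ hB
        rw [inner_indicatorL2_left]
        have h := setIntegral_mono_ae
          (integrableOn_Lp_of_measure_ne_top (W t) one_le_two hK.measure_lt_top.ne)
          (integrableOn_const (C := (1 : ℝ)) hK.measure_lt_top.ne) hW1
        rwa [setIntegral_const, smul_eq_mul, mul_one] at h

/-- Fubini for a continuous function on a relatively compact product. -/
theorem intervalIntegral_setIntegral_swap [LocallyCompactSpace M] {h : ℝ → M → ℝ}
    (hc : Continuous h.uncurry) {A S : Set M} (hS : IsCompact S) (hA : A ⊆ S) (a b : ℝ) :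
    ∫ t in a..b, (∫ x in A, h t x ∂μ) = ∫ x in A, (∫ t in a..b, h t x) ∂μ := by
  refine intervalIntegral_integral_swap ?_
  rw [Measure.prod_restrict]
  exact (hc.continuousOn.integrableOn_compact (isCompact_uIcc.prod hS)).mono_set
    (prod_mono uIoc_subset_uIcc hA)

/-- The time integral of the heat flow, computed in `L²`, is given pointwise by the integral of
the heat kernel. -/
theorem IsHeatKernel.integral_flow_ae_eq {P : ℝ → M → M → ℝ} (hP : IsHeatKernel n μ P) {K : Set M}
    (hK : IsCompact K) {U : ℝ → Lp ℝ 2 μ}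
    (hU : IsFormFlow (Test.toL2 (n := n) (M := M) μ) (Test.d μ) (indicatorL2 μ hK) U)
    (hUP : ∀ t, 0 < t → U t =ᵐ[μ] fun x => ∫ y in K, P t x y ∂μ) {a b : ℝ} (ha : 0 < a)
    (hab : a ≤ b) {k : M → M → ℝ} (hk : ∀ x y, k x y = ∫ t in a..b, P t x y)
    (hkc : Continuous k.uncurry) :
    (∫ t in a..b, U t : Lp ℝ 2 μ) =ᵐ[μ] fun x => ∫ y in K, k x y ∂μ := by
  have : LocallyCompactSpace M := ChartedSpace.locallyCompactSpace (EuclideanSpace ℝ (Fin n)) M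
  -- Freezing the time below `a` makes the kernel continuous on the whole of `ℝ × M × M`.
  set Q : ℝ → M → M → ℝ := fun t => P (max t a) with hQ
  have hQc : Continuous fun p : ℝ × M × M => Q p.1 p.2.1 p.2.2 :=
    hP.1.comp_continuous (f := fun p : ℝ × M × M => (max p.1 a, p.2.1, p.2.2)) (by fun_prop)
      fun p => ⟨ha.trans_le (le_max_right _ _), trivial⟩
  have hQP : ∀ t ∈ uIcc a b, Q t = P t := fun t ht => by
    rw [uIcc_of_le hab] at ht
    rw [hQ]
    simp only [max_eq_left ht.1]
  have hkQ : ∀ x y, k x y = ∫ t in a..b, Q t x y := fun x y => by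
    rw [hk]
    refine intervalIntegral.integral_congr fun t ht => ?_
    simp only [hQP t ht]
  have hkK : Continuous fun x => ∫ y in K, k x y ∂μ :=
    continuous_parametric_integral_of_continuous (f := k) hkc hK
  have hQK : Continuous (fun (t : ℝ) (x : M) => ∫ y in K, Q t x y ∂μ).uncurry :=
    continuous_parametric_integral_of_continuous (X := ℝ × M)
      (f := fun p y => Q p.1 p.2 y) (hQc.comp (by fun_prop :
        Continuous fun p : (ℝ × M) × M => (p.1.1, p.1.2, p.2))) hK
  have hint : IntervalIntegrable U volume a b := by
    refine (hU.continuousOn.mono fun t ht => ?_).intervalIntegrable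
    rw [uIcc_of_le hab] at ht
    exact ha.trans_le ht.1
  -- Both sides have the same integral over each relatively compact measurable set.
  have key : ∀ A S : Set M, MeasurableSet A → IsCompact S → A ⊆ S →
      ∫ x in A, (∫ t in a..b, U t : Lp ℝ 2 μ) x ∂μ = ∫ x in A, ∫ y in K, k x y ∂μ ∂μ := by
    intro A S hAm hS hAS
    have hμA : μ A ≠ ⊤ := ((measure_mono hAS).trans_lt hS.measure_lt_top).ne
    rw [← L2.inner_indicatorConstLp_one (𝕜 := ℝ) hAm hμA]
    have h1 := (innerSL ℝ (indicatorConstLp 2 hAm hμA (1 : ℝ))).intervalIntegral_comp_comm hint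
    simp only [innerSL_apply_apply] at h1
    rw [← h1]
    have h2 : ∫ t in a..b, inner ℝ (indicatorConstLp 2 hAm hμA (1 : ℝ)) (U t) =
        ∫ t in a..b, (∫ x in A, ∫ y in K, Q t x y ∂μ ∂μ) := by
      refine intervalIntegral.integral_congr fun t ht => ?_
      rw [L2.inner_indicatorConstLp_one, hQP t ht]
      rw [uIcc_of_le hab] at ht
      exact setIntegral_congr_ae hAm ((hUP t (ha.trans_le ht.1)).mono fun x hx _ => hx)
    rw [h2, intervalIntegral_setIntegral_swap hQK hS hAS]
    refine integral_congr_ae (Eventually.of_forall fun x => ?_)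
    simp only
    rw [intervalIntegral_setIntegral_swap (h := fun t y => Q t x y)
      (hQc.comp (by fun_prop : Continuous fun p : ℝ × M => (p.1, x, p.2))) hK subset_rfl]
    simp_rw [hkQ]
  let S : CompactExhaustion M := default
  have hloc : ∀ m, ∀ᵐ x ∂μ.restrict (S m),
      (∫ t in a..b, U t : Lp ℝ 2 μ) x = ∫ y in K, k x y ∂μ := fun m => by
    refine Integrable.ae_eq_of_forall_setIntegral_eq _ _
      (integrableOn_Lp_of_measure_ne_top _ one_le_two (S.isCompact m).measure_lt_top.ne)
      (hkK.continuousOn.integrableOn_compact (S.isCompact m)) fun A hA _ => ?_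
    rw [Measure.restrict_restrict hA]
    exact key _ _ (hA.inter (S.isCompact m).measurableSet) (S.isCompact m) inter_subset_right
  have h := ae_restrict_iUnion_iff (fun m => S m) (fun x =>
    (∫ t in a..b, U t : Lp ℝ 2 μ) x = ∫ y in K, k x y ∂μ) |>.2 hloc
  rwa [S.iUnion_eq, Measure.restrict_univ] at h

end Kernel

/-! ### Truncated powers of the Green function -/

section Green

variable {μ}

theorem IsHeatKernel.continuous_integral {P : ℝ → M → M → ℝ} (hP : IsHeatKernel n μ P) {a b : ℝ}
    (ha : 0 < a) (hab : a ≤ b) : Continuous fun p : M × M => ∫ t in a..b, P t p.1 p.2 := by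
  -- Freezing the time below `a` makes the kernel continuous on the whole of `ℝ × M × M`.
  have hQc : Continuous fun p : ℝ × M × M => P (max p.1 a) p.2.1 p.2.2 :=
    hP.1.comp_continuous (f := fun p : ℝ × M × M => (max p.1 a, p.2.1, p.2.2)) (by fun_prop)
      fun p => ⟨ha.trans_le (le_max_right _ _), trivial⟩
  have h := intervalIntegral.continuous_parametric_intervalIntegral_of_continuous'
    (μ := volume) (X := M × M) (f := fun p t => P (max t a) p.1 p.2)
    (hQc.comp (by fun_prop : Continuous fun q : (M × M) × ℝ => (q.2, q.1.1, q.1.2))) a b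
  refine h.congr fun p => intervalIntegral.integral_congr fun t ht => ?_
  rw [uIcc_of_le hab] at ht
  simp only [max_eq_left ht.1]

/-- The truncation `H(∫_a^b P(t,o,·) dt)` of a truncated Green function has energy at most `F 1`,
where `F' = (H')²`: it is the limit of the truncations of `v_j = ∫_a^b e^{-tΔ} f_j dt`, where `f_j`
is an approximation of the Dirac mass at `o`, and
`∫ |d H(v_j)|² = ∫ F(v_j) Δ v_j = ∫ F(v_j) (e^{-aΔ} f_j - e^{-bΔ} f_j) ≤ F 1 ∫ f_j`. -/
theorem IsHeatKernel.approximable_comp_integral [μ.IsOpenPosMeasure] {P : ℝ → M → M → ℝ}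
    (hP : IsHeatKernel n μ P) (o : M) {a b : ℝ} (ha : 0 < a) (hab : a ≤ b) {H F : ℝ → ℝ}
    (hH : ContDiff ℝ ∞ H) (hH0 : H 0 = 0) (hH' : ∀ s, 0 ≤ deriv H s) {B : ℝ}
    (hB : ∀ s, |deriv H s| ≤ B) (hF : ContDiff ℝ ∞ F) (hF0 : F 0 = 0)
    (hFH : ∀ s, deriv F s = deriv H s ^ 2) (h1 : ∀ s, 1 ≤ s → H s = H 1 ∧ F s = F 1) :
    Approximable n μ (fun x => H (∫ t in a..b, P t o x)) (F 1) := by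
  have : LocallyCompactSpace M := ChartedSpace.locallyCompactSpace (EuclideanSpace ℝ (Fin n)) M
  have hHm : Monotone H := monotone_of_deriv_nonneg (hH.differentiable (by simp)) hH'
  have hFm : Monotone F := monotone_of_deriv_nonneg (hF.differentiable (by simp))
    fun s => hFH s ▸ sq_nonneg _
  have hHle : ∀ s, H s ≤ H 1 := fun s =>
    (le_total s 1).elim (fun h => hHm h) fun h => (h1 s h).1.le
  have hFle : ∀ s, F s ≤ F 1 := fun s =>
    (le_total s 1).elim (fun h => hFm h) fun h => (h1 s h).2.le
  have hF1 : 0 ≤ F 1 := hF0 ▸ hFm zero_le_one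
  have hFB : ∀ s, |deriv F s| ≤ B ^ 2 := fun s => by
    rw [hFH, abs_of_nonneg (sq_nonneg _), ← sq_abs]
    exact pow_le_pow_left₀ (abs_nonneg _) (hB s) 2
  have hL := lipschitzWith_of_abs_deriv_le (hF.differentiable (by simp)) hFB
  set k : M → M → ℝ := fun x y => ∫ t in a..b, P t x y with hk
  have hkc : Continuous k.uncurry := hP.continuous_integral ha hab
  have hk0 : ∀ x y, 0 ≤ k x y := fun x y =>
    intervalIntegral.integral_nonneg hab fun t ht => (hP.2.1 t (ha.trans_le ht.1) x y).le
  obtain ⟨r, hr, hrc⟩ := Metric.exists_isCompact_closedBall o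
  -- The normalized characteristic functions of these shrinking compact balls approximate the Dirac
  -- mass at `o`.
  set S : ℕ → Set M := fun j => Metric.closedBall o (r / ((j : ℝ) + 1)) with hS
  have hSr : ∀ j : ℕ, 0 < r / ((j : ℝ) + 1) := fun j => by positivity
  have hSc : ∀ j, IsCompact (S j) := fun j => hrc.of_isClosed_subset Metric.isClosed_closedBall
    (Metric.closedBall_subset_closedBall (div_le_self hr.le (by
      have : (0 : ℝ) ≤ j := Nat.cast_nonneg j
      linarith)))
  have hSpos : ∀ j, 0 < μ.real (S j) := fun j => ENNReal.toReal_pos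
    (Metric.measure_closedBall_pos μ o (hSr j)).ne' (hSc j).measure_lt_top.ne
  have hcont : ∀ j, Continuous fun x => ∫ y in S j, k x y ∂μ := fun j =>
    continuous_parametric_integral_of_continuous (f := k) hkc (hSc j)
  have happ : ∀ j, Approximable n μ
      (fun x => H ((μ.real (S j))⁻¹ * ∫ y in S j, k x y ∂μ)) (F 1) := by
    intro j
    obtain ⟨U, hU, hUP⟩ := hP.exists_isFormFlow (hSc j)
    set c := (μ.real (S j))⁻¹ with hc
    have hc0 : 0 ≤ c := inv_nonneg.2 (hSpos j).le
    set V : Lp ℝ 2 μ := ∫ t in a..b, U t with hV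
    have hVk : V =ᵐ[μ] fun x => ∫ y in S j, k x y ∂μ :=
      hP.integral_flow_ae_eq (hSc j) hU hUP ha hab (fun _ _ => rfl) hkc
    have hcV : (c • V : Lp ℝ 2 μ) =ᵐ[μ] fun x => c * ∫ y in S j, k x y ∂μ := by
      filter_upwards [Lp.coeFn_smul c V, hVk] with x h2 h3
      rw [h2, Pi.smul_apply, h3, smul_eq_mul]
    have hlap := (hU.formLaplacian_integral ha hab).smul c
    set g := hL.compLp hF0 (c • V) with hg
    have hg1 : ∀ᵐ x ∂μ, g x ≤ F 1 := by
      filter_upwards [hL.coeFn_compLp hF0 (c • V)] with x h2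
      rw [hg, h2]
      exact hFle _
    have hg0 : ∀ᵐ x ∂μ, 0 ≤ g x := by
      filter_upwards [hL.coeFn_compLp hF0 (c • V), hcV] with x h2 h3
      rw [hg, h2, Function.comp_apply, h3, ← hF0]
      exact hFm (mul_nonneg hc0 (integral_nonneg fun y => hk0 x y))
    -- `g = F(c V)` takes its values in `[0, F 1]`: the term with `e^{-bΔ}` has a sign, and the one
    -- with `e^{-aΔ}` is bounded by the contraction property in `L¹`.
    have hE : inner ℝ (c • (U a - U b)) g ≤ F 1 := by
      have h2 : inner ℝ (U a) g ≤ F 1 * μ.real (S j) :=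
        hP.inner_le (hSc j) hU hUP ha hF1 hg1
      have h3 : 0 ≤ inner ℝ (U b) g := by
        rw [L2.inner_def]
        refine integral_nonneg_of_ae ?_
        filter_upwards [hP.ae_nonneg hUP (ha.trans_le hab), hg0] with x h4 h5
        exact mul_nonneg h5 h4
      rw [real_inner_smul_left, inner_sub_left]
      calc c * (inner ℝ (U a) g - inner ℝ (U b) g) ≤ c * (F 1 * μ.real (S j)) :=
            mul_le_mul_of_nonneg_left (by linarith) hc0
        _ = F 1 := by
            rw [hc]
            field_simp [(hSpos j).ne']
    refine ((approximable_comp_of_formLaplacian hlap hH hH0 hB hF hF0 hL hFH).mono hE).congr_ae ?_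
    filter_upwards [hcV] with x h2
    rw [h2]
  refine Approximable.of_tendsto_ae happ tendsto_const_nhds (B := H 1)
    (fun j => (hH.continuous.comp (continuous_const.mul (hcont j))).aemeasurable)
    (fun j => Eventually.of_forall fun x => ?_) (Eventually.of_forall fun x => ?_)
  · have h2 : 0 ≤ (μ.real (S j))⁻¹ * ∫ y in S j, k x y ∂μ :=
      mul_nonneg (inv_nonneg.2 (hSpos j).le) (integral_nonneg fun y => hk0 x y)
    rw [abs_of_nonneg (hH0 ▸ hHm h2)]
    exact hHle _
  · have hsymm : ∫ t in a..b, P t o x = k x o := by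
      refine intervalIntegral.integral_congr fun t ht => ?_
      rw [uIcc_of_le hab] at ht
      exact hP.symm (ha.trans_le ht.1) o x
    rw [hsymm]
    refine (hH.continuous.tendsto _).comp ?_
    rw [Metric.tendsto_atTop]
    intro ε hε
    have hkx : Continuous (k x) := hkc.comp (continuous_const.prodMk continuous_id)
    obtain ⟨δ, hδ, hball⟩ := Metric.continuousAt_iff.1 (hkx.continuousAt (x := o)) (ε / 2)
      (half_pos hε)
    obtain ⟨N, hN⟩ := exists_nat_gt (r / δ)
    refine ⟨N, fun j hj => ?_⟩
    have hjδ : r / ((j : ℝ) + 1) < δ := by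
      have hNj : (N : ℝ) ≤ j := by exact_mod_cast hj
      rw [div_lt_iff₀ (by positivity)]
      rw [div_lt_iff₀ hδ] at hN
      nlinarith
    -- averages of `k x` over small balls around `o` are close to `k x o`
    have hmem := (convex_closedBall (k x o) (ε / 2)).set_average_mem (μ := μ) (t := S j)
      Metric.isClosed_closedBall (Metric.measure_closedBall_pos μ o (hSr j)).ne'
      (hSc j).measure_lt_top.ne
      ((ae_restrict_mem (hSc j).measurableSet).mono fun y hy => (hball (hy.trans_lt hjδ)).le)
      (hkx.continuousOn.integrableOn_compact (hSc j))
    rw [setAverage_eq, smul_eq_mul] at hmem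
    exact (Metric.mem_closedBall.1 hmem).trans_lt (half_lt_self hε)

/-- The Green function is the increasing limit of the time integrals over `[1 / (m + 1), m + 1]`.
The truncation at `1` makes the limit finite even where `G_o = ∞`. -/
theorem IsHeatKernel.tendsto_toReal_min_green {P : ℝ → M → M → ℝ} (hP : IsHeatKernel n μ P)
    (o x : M) : Tendsto (fun m : ℕ => min (∫ t in ((m : ℝ) + 1)⁻¹..(m : ℝ) + 1, P t o x) 1) atTop
      (𝓝 (min (greenKernel P o x) 1).toReal) := by
  have hpos : ∀ m : ℕ, (0 : ℝ) < ((m : ℝ) + 1)⁻¹ := fun m => by positivity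
  have hle : ∀ m : ℕ, ((m : ℝ) + 1)⁻¹ ≤ (m : ℝ) + 1 := fun m => by
    have : (0 : ℝ) ≤ m := Nat.cast_nonneg m
    exact (inv_le_one_of_one_le₀ (by linarith)).trans (by linarith)
  have hcx : ContinuousOn (fun t => P t o x) (Ioi 0) :=
    hP.1.comp (f := fun t : ℝ => (t, o, x)) (by fun_prop) fun t ht => ⟨ht, trivial⟩
  have hm : AEMeasurable (fun t => ENNReal.ofReal (P t o x)) (volume.restrict (Ioi 0)) :=
    (hcx.aemeasurable measurableSet_Ioi).ennreal_ofReal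
  have hlim : Tendsto (fun m : ℕ => ∫⁻ t in Ioc ((m : ℝ) + 1)⁻¹ ((m : ℝ) + 1),
      ENNReal.ofReal (P t o x)) atTop (𝓝 (greenKernel P o x)) := by
    have hcover : AECover (volume.restrict (Ioi (0 : ℝ))) atTop
        fun m : ℕ => Ioc ((m : ℝ) + 1)⁻¹ ((m : ℝ) + 1) := by
      refine ⟨?_, fun m => measurableSet_Ioc⟩
      filter_upwards [ae_restrict_mem measurableSet_Ioi] with t ht
      have h1 : Tendsto (fun m : ℕ => (m : ℝ) + 1) atTop atTop :=
        tendsto_natCast_atTop_atTop.atTop_add tendsto_const_nhds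
      filter_upwards [h1.inv_tendsto_atTop.eventually_lt_const ht, h1.eventually_ge_atTop t]
        with m h2 h3
      exact ⟨h2, h3⟩
    refine (hcover.lintegral_tendsto_of_nat hm).congr fun m => ?_
    rw [Measure.restrict_restrict measurableSet_Ioc, inter_eq_left.2
      (Ioc_subset_Ioi_self.trans (Ioi_subset_Ioi (hpos m).le))]
  have hint : ∀ m : ℕ, ∫⁻ t in Ioc ((m : ℝ) + 1)⁻¹ ((m : ℝ) + 1), ENNReal.ofReal (P t o x) =
      ENNReal.ofReal (∫ t in ((m : ℝ) + 1)⁻¹..(m : ℝ) + 1, P t o x) := fun m => by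
    rw [intervalIntegral.integral_of_le (hle m), ofReal_integral_eq_lintegral_ofReal]
    · exact ((hcx.mono fun t ht => (hpos m).trans_le ht.1).integrableOn_Icc).mono_set
        Ioc_subset_Icc_self
    · filter_upwards [ae_restrict_mem measurableSet_Ioc] with t ht
      exact (hP.2.1 t ((hpos m).trans ht.1) o x).le
  simp_rw [hint] at hlim
  have h1 := (ENNReal.tendsto_toReal (min_lt_of_right_lt ENNReal.one_lt_top).ne).comp
    (hlim.min (tendsto_const_nhds (x := (1 : ℝ≥0∞))))
  refine h1.congr fun m => ?_
  have h0 : 0 ≤ ∫ t in ((m : ℝ) + 1)⁻¹..(m : ℝ) + 1, P t o x :=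
    intervalIntegral.integral_nonneg (hle m) fun t ht =>
      (hP.2.1 t ((hpos m).trans_le ht.1) o x).le
  rw [Function.comp_apply, ← ENNReal.ofReal_one, ← ENNReal.ofReal_min,
    ENNReal.toReal_ofReal (le_min h0 zero_le_one)]

/-- Approximating first `G_o` by time integrals over compact intervals and then `s ^ τ` by the
smooth profiles `H i`, the energies stay bounded by `F i 1` and in the limit by `τ ^ 2 / (2 τ -
1)`. -/
theorem IsHeatKernel.memHomSobolev_min_green [μ.IsOpenPosMeasure] {P : ℝ → M → M → ℝ}
    (hP : IsHeatKernel n μ P) (o : M) {τ : ℝ} (hτ : 1 / 2 < τ) :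
    MemHomSobolev n μ (fun x => (min (greenKernel P o x ^ τ) 1).toReal) := by
  obtain ⟨H, F, hH, hF, hFH, hH', hC, h1, hlim, hpow⟩ := exists_powerProfile hτ
  have hmono : ∀ i, Monotone (H i) := fun i =>
    monotone_of_deriv_nonneg ((hH i).1.differentiable (by simp)) (hH' i)
  have hHle : ∀ i s, H i s ≤ H i 1 := fun i s =>
    (le_total s 1).elim (fun h => hmono i h) fun h => (h1 i s h).1.le
  have hHmin : ∀ i s, H i (min s 1) = H i s := fun i s =>
    (le_total s 1).elim (fun h => by rw [min_eq_left h]) fun h => by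
      rw [min_eq_right h, (h1 i s h).1]
  obtain ⟨B, hB⟩ : ∃ B, ∀ i, H i 1 ≤ B := by
    obtain ⟨B, hB⟩ := (hpow 1 zero_le_one le_rfl).bddAbove_range
    exact ⟨B, fun i => hB ⟨i, rfl⟩⟩
  have hpos : ∀ m : ℕ, (0 : ℝ) < ((m : ℝ) + 1)⁻¹ := fun m => by positivity
  have hle : ∀ m : ℕ, ((m : ℝ) + 1)⁻¹ ≤ (m : ℝ) + 1 := fun m => by
    have : (0 : ℝ) ≤ m := Nat.cast_nonneg m
    exact (inv_le_one_of_one_le₀ (by linarith)).trans (by linarith)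
  set G : M → ℝ := fun x => (min (greenKernel P o x) 1).toReal with hG
  have hG0 : ∀ x, 0 ≤ G x := fun x => ENNReal.toReal_nonneg
  have hG1 : ∀ x, G x ≤ 1 := fun x =>
    ENNReal.toReal_mono ENNReal.one_ne_top (min_le_right _ _)
  set g : ℕ → M → ℝ := fun m x => ∫ t in ((m : ℝ) + 1)⁻¹..(m : ℝ) + 1, P t o x with hg
  have hg0 : ∀ m x, 0 ≤ g m x := fun m x =>
    intervalIntegral.integral_nonneg (hle m) fun t ht =>
      (hP.2.1 t ((hpos m).trans_le ht.1) o x).le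
  have hgm : ∀ m, Measurable (g m) := fun m =>
    ((hP.continuous_integral (hpos m) (hle m)).comp
      (continuous_const.prodMk continuous_id : Continuous fun x : M => (o, x))).measurable
  have hGm : Measurable G := measurable_of_tendsto_metrizable
    (fun m => (hgm m).min measurable_const) (tendsto_pi_nhds.2 fun x =>
      hP.tendsto_toReal_min_green o x)
  have happ : ∀ i, Approximable n μ (fun x => H i (G x)) (F i 1) := fun i => by
    obtain ⟨C, hC⟩ := hC i
    refine Approximable.of_tendsto_ae (B := H i 1) (fun m => hP.approximable_comp_integral o
      (hpos m) (hle m) (hH i).1 (hH i).2 (hH' i) hC (hF i).1 (hF i).2 (hFH i) (h1 i))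
      tendsto_const_nhds (fun m => ((hH i).1.continuous.measurable.comp (hgm m)).aemeasurable)
      (fun m => Eventually.of_forall fun x => ?_) (Eventually.of_forall fun x => ?_)
    · rw [abs_of_nonneg ((hH i).2 ▸ hmono i (hg0 m x))]
      exact hHle i _
    · have h2 := ((hH i).1.continuous.tendsto _).comp (hP.tendsto_toReal_min_green o x)
      refine h2.congr fun m => hHmin i _
  have happ' : Approximable n μ (fun x => G x ^ τ) (τ ^ 2 / (2 * τ - 1)) :=
    Approximable.of_tendsto_ae (B := B) happ hlim
      (fun i => ((hH i).1.continuous.measurable.comp hGm).aemeasurable)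
      (fun i => Eventually.of_forall fun x => by
        rw [abs_of_nonneg ((hH i).2 ▸ hmono i (hG0 x))]
        exact (hHle i _).trans (hB i))
      (Eventually.of_forall fun x => hpow _ (hG0 x) (hG1 x))
  -- `min (G ^ τ) 1 = (min G 1) ^ τ`
  have heq : (fun x => (min (greenKernel P o x ^ τ) 1).toReal) = fun x => G x ^ τ := by
    funext x
    rw [hG]
    simp only
    rw [ENNReal.toReal_rpow,
      (ENNReal.monotone_rpow_of_nonneg (show 0 ≤ τ by linarith)).map_min, ENNReal.one_rpow]
  rw [heq]
  obtain ⟨θ, hθ, -⟩ := happ'.exists_hasHomDifferential μ (hGm.pow_const τ).aemeasurable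
  exact ⟨θ, hθ⟩

end Green

end WeightedManifold

end

theorem mainTheorem10 (n : ℕ) (M : Type*) [MetricSpace M]
    [ChartedSpace (EuclideanSpace ℝ (Fin n)) M] [IsManifold (𝓡 n) ∞ M]
    [SecondCountableTopology M]
    [RiemannianBundle (fun x : M => TangentSpace (𝓡 n) x)]
    [IsContMDiffRiemannianBundle (𝓡 n) ∞ (EuclideanSpace ℝ (Fin n))
      (fun x : M => TangentSpace (𝓡 n) x)]
    [IsRiemannianManifold (𝓡 n) M] [CompleteSpace M]
    [MeasurableSpace M] [BorelSpace M]
    (μ : Measure M) (hμ : WeightedManifold.IsWeightedVolume n μ)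
    (hM : ¬ WeightedManifold.IsParabolic n μ)
    (τ : ℝ) (hτ : 1 / 2 < τ) :
    (∀ P : ℝ → M → M → ℝ, WeightedManifold.IsHeatKernel n μ P → ∀ o : M,
      WeightedManifold.MemHomSobolev n μ
        (fun x => (min (WeightedManifold.greenKernel P o x ^ τ) 1).toReal)) ∧
    (∀ U : Set M, IsOpen U → Bornology.IsBounded U → ∀ h : M → ℝ,
      WeightedManifold.IsEquilibriumPotential n μ U h →
      ∃ θ : WeightedManifold.CovectorField n M,
        WeightedManifold.HasHomDifferential μ (fun x => h x ^ τ) θ ∧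
        ∫⁻ x, ‖θ x‖ₑ ^ 2 ∂μ
          ≤ ENNReal.ofReal (τ ^ 2 / (2 * τ - 1)) * WeightedManifold.capacity n μ U) := by
  have hlf : IsLocallyFiniteMeasure μ := WeightedManifold.isLocallyFiniteMeasure hμ
  have hop : μ.IsOpenPosMeasure := WeightedManifold.isOpenPosMeasure hμ
  have hpc : PreconnectedSpace M := WeightedManifold.preconnectedSpace (n := n)
  exact ⟨fun P hP o => hP.memHomSobolev_min_green o hτ,
    fun U _ _ h hh => hh.exists_hasHomDifferential_rpow hμ hM hτ⟩
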